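/- **Setting.** Let $d\ge 2$, $s\ge 1$ be integers, $\varepsilon,T>0$. For $N\geq 1$ let $$\mathcal D^\varepsilon_N=\{Z_N=(X_N,V_N)=(x_1,\dots,x_N,v_1,\dots,v_N)\in\mathbb R^{2dN}:\ x_l\cdot e_1\ge\varepsilon/2\ \forall l,\ |x_j-x_k|\ge\varepsilon\ \forall j<k\}$$ be the phase space of $N$ hard spheres of radius $\varepsilon/2$ in the half-space $\{x\cdot e_1>0\}$, with Lebesgue measure. Let $T^{N,\varepsilon}_t$ ($t\in\mathbb R$) be the hard sphere flow (free transport, elastic collisions $v_j'=v_j-\varepsilon^{-2}((v_j-v_k)\cdot(x_j-x_k))(x_j-x_k)$, $v_k'=v_k+\varepsilon^{-2}((v_j-v_k)\cdot(x_j-x_k))(x_j-x_k)$ when $|x_j-x_k|=\varepsilon$, and specular reflection $v_l'=v_l-2(v_l\cdot e_1)e_1$ when $x_l\cdot e_1=\varepsilon/2$), which is defined for almost every initial configuration. **Truncated operators.** Let $1\le i\le s$. For $Z_s\in\mathcal D^\varepsilon_s$, $\omega\in\mathbb S^{d-1}$, $v_{s+1}\in\mathbb R^d$ put $x_{s+1}=x_i+\varepsilon\omega$,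 $X_{s+1}=(X_s,x_{s+1})$, $V_{s+1}=(V_s,v_{s+1})$. For $\delta,R_1,R_2>0$ let $D(\delta,R_1,R_2)$ be the set of $(Z_s,\omega,v_{s+1})$ such that $|x_j-x_k|>\varepsilon+\sqrt2\,\delta R_2$ for all $1\le j<k\le s+1$ with $(j,k)\ne(i,s+1)$, $x_l\cdot e_1>\varepsilon/2+\delta R_2$ for all $1\le l\le s+1$, $|X_{s+1}|\le R_1$ and $|V_{s+1}|\le R_2$. Let $S^-(Z_s,u,\omega,v_{s+1})=(X_{s+1}-uV_{s+1},V_{s+1})$, and let $S^+(Z_s,u,\omega,v_{s+1})=(X_{s+1}-uV'_{s+1},V'_{s+1})$, where $V'_{s+1}$ is obtained from $V_{s+1}$ by the collision law for the pair $(i,s+1)$. For $\varphi:[0,T]\to L^\infty(\mathcal D^\varepsilon_{s+1})$ piecewise constant in time, define, with $k=\lfloor t/\delta\rfloor$, $$\mathcal C_\pm(\delta,R_1,R_2)\varphi\,(t,Z_s)=\varepsilon^{d-1}\int_{\mathbb S^{d-1}\times\mathbb R^d}\mathbf 1_{D(\delta,R_1,R_2)}\,\big(\omega\cdot(v_{s+1}-v_i)\big)_\pm\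 \varphi\big(t,\,T^{s+1,\varepsilon}_{-k\delta}\,S^\pm(Z_s,t-k\delta,\omega,v_{s+1})\big)\,d\omega\,dv_{s+1}.$$ For $h\in\mathcal C([0,T],L^\infty(\mathcal D^\varepsilon_{s+1}))$, $\mathcal C_\pm(\delta,R_1,R_2)h$ is the limit in $L^\infty([0,T]\times\mathcal D^\varepsilon_s)$, as $\tau\to0^+$, of $\mathcal C_\pm(\delta,R_1,R_2)h_\tau$, where $h_\tau(t)=h(\lfloor t/\tau\rfloor\tau)$. The transport-collision operator $\mathcal C^\varepsilon_{s,s+1,\pm,i}\mathcal T^{s+1,\varepsilon}_t h$ is the result of the following three successive limits of $\mathcal C_\pm(\delta,R_1,R_2)h$: first $\delta\to0^+$, strongly in $L^1([0,T]\times\mathcal D^\varepsilon_s)$, with a limit in $L^1\cap L^\infty$; then $R_1\to+\infty$, almost everywhere, with a limit in $L^\infty$; then $R_2\to+\infty$, in $L^\infty([0,T]\times\mathcal D^\varepsilon_s)$. It is *well defined* if all these integrals converge for almost every $(t,Z_s)$, all these limits exist, and the result does not depend on the chosen representatives of the classes $h(t)$. **Theorem (Definition of the BBGKY collision operator).** Let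 $g_{s+1}:[0,T]\times\mathbb R_+\to\mathbb R_+$ satisfy: - $g_{s+1}$ is measurable and almost everywhere positive; - for all $x\in\mathbb R_+$, $t\mapsto g_{s+1}(t,x)$ is nondecreasing; - for all $t\in[0,T]$ and almost every $(v_1,\dots,v_s)\in\mathbb R^{ds}$, the function $v_{s+1}\mapsto|V_{s+1}|\,g_{s+1}(t,|V_{s+1}|)$ is integrable on $\mathbb R^d$; - for all $t\in[0,T]$, $(v_1,\dots,v_s)\mapsto\int_{\mathbb R^d}|V_{s+1}|\,g_{s+1}(t,|V_{s+1}|)\,dv_{s+1}$ is bounded almost everywhere, and $$\operatorname*{ess\,sup}_{t\in[0,T],\ (v_1,\dots,v_s)\in\mathbb R^{ds}}\ \int_{\mathbb R^d}\mathbf 1_{|V_{s+1}|\ge R}\,|V_{s+1}|\,g_{s+1}(t,|V_{s+1}|)\,dv_{s+1}\ \longrightarrow\ 0\quad\text{as }R\to+\infty .$$ Let $1\le i\le s$, let $\pm$ be either sign, and let $h\in\mathcal C([0,T],L^\infty(\mathcal D^\varepsilon_{s+1}))$ be such that, for some $\lambda\in\mathbb R_+$, $|h(t,Z_{s+1})|\le\lambda\,g_{s+1}(t,|V_{s+1}|)$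 for almost every $t\in[0,T]$ and almost every $Z_{s+1}\in\mathcal D^\varepsilon_{s+1}$. Then $\mathcal C^\varepsilon_{s,s+1,\pm,i}\mathcal T^{s+1,\varepsilon}_th$ is a well defined element of $L^\infty([0,T]\times\mathcal D^\varepsilon_s)$, and for almost every $(t,Z_s)\in[0,T]\times\mathcal D^\varepsilon_s$ $$\Big|\mathcal C^\varepsilon_{s,s+1,\pm,i}\mathcal T^{s+1,\varepsilon}_th\,(t,Z_s)\Big|\le\lambda\,\varepsilon^{d-1}\,\frac{|\mathbb S^{d-1}|}2\int_{\mathbb R^d}\big(|v_i|+|v_{s+1}|\big)\,g_{s+1}\big(t,|V_{s+1}|\big)\,dv_{s+1},$$ the integral on the right-hand side being convergent. -/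

import Mathlib

open MeasureTheory Filter Topology
open scoped ENNReal

noncomputable section

/-- The Euclidean space `ℝ^d`. -/
abbrev Euc (d : ℕ) : Type := EuclideanSpace ℝ (Fin d)

/-- Configurations of `N` particles: the positions, then the velocities. -/
abbrev Config (d N : ℕ) : Type := (Fin N → Euc d) × (Fin N → Euc d)

/-- The Euclidean norm of a family of vectors, e.g. `|V_N| = (∑ |v_j|²)^{1/2}`. -/
def famNorm {d n : ℕ} (V : Fin n → Euc d) : ℝ := Real.sqrt (∑ j, ‖V j‖ ^ 2)

/-- The first vector of the canonical basis. -/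
def e₁ (d : ℕ) [NeZero d] : Euc d := EuclideanSpace.single 0 1

/-- The phase space of `N` hard spheres of radius `ε / 2` in the half-space. -/
def phaseSpace (d N : ℕ) [NeZero d] (ε : ℝ) : Set (Config d N) :=
  {Z | (∀ l, ε / 2 ≤ inner ℝ (Z.1 l) (e₁ d)) ∧ ∀ j k, j < k → ε ≤ ‖Z.1 j - Z.1 k‖}

/-- Lebesgue measure on the phase space. -/
def phaseMeasure (d N : ℕ) [NeZero d] (ε : ℝ) : Measure (Config d N) :=
  volume.restrict (phaseSpace d N ε)

/-! ### Hard sphere dynamics -/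

/-- Free flow during a time `t`. -/
def freeFlow {d N : ℕ} (t : ℝ) (Z : Config d N) : Config d N :=
  (fun l => Z.1 l + t • Z.2 l, Z.2)

/-- No contact at all. -/
def NoContact {d N : ℕ} [NeZero d] (ε : ℝ) (Z : Config d N) : Prop :=
  (∀ l, ε / 2 < inner ℝ (Z.1 l) (e₁ d)) ∧ ∀ j k, j < k → ε < ‖Z.1 j - Z.1 k‖

/-- The particles `j < k` touch each other, and there is no other contact. -/
def PairContact {d N : ℕ} [NeZero d] (ε : ℝ) (j k : Fin N) (Z : Config d N) : Prop :=
  j < k ∧ ‖Z.1 j - Z.1 k‖ = ε ∧ (∀ l, ε / 2 < inner ℝ (Z.1 l) (e₁ d)) ∧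
    ∀ j' k', j' < k' → (j', k') ≠ (j, k) → ε < ‖Z.1 j' - Z.1 k'‖

/-- The particle `l` touches the wall, and there is no other contact. -/
def WallContact {d N : ℕ} [NeZero d] (ε : ℝ) (l : Fin N) (Z : Config d N) : Prop :=
  inner ℝ (Z.1 l) (e₁ d) = ε / 2 ∧ (∀ m, m ≠ l → ε / 2 < inner ℝ (Z.1 m) (e₁ d)) ∧
    ∀ j k, j < k → ε < ‖Z.1 j - Z.1 k‖

/-- The elastic collision law for the particles `j` and `k`. -/
def pairCollision {d N : ℕ} (ε : ℝ) (j k : Fin N) (Z : Config d N) : Config d N :=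
  (Z.1, fun l =>
    if l = j then
      Z.2 j - ((1 / ε ^ 2) * inner ℝ (Z.2 j - Z.2 k) (Z.1 j - Z.1 k)) • (Z.1 j - Z.1 k)
    else if l = k then
      Z.2 k + ((1 / ε ^ 2) * inner ℝ (Z.2 j - Z.2 k) (Z.1 j - Z.1 k)) • (Z.1 j - Z.1 k)
    else Z.2 l)

/-- The specular reflection of the particle `l` against the wall. -/
def wallReflection {d N : ℕ} [NeZero d] (l : Fin N) (Z : Config d N) : Config d N :=
  (Z.1, fun m => if m = l then Z.2 l - (2 * inner ℝ (Z.2 l) (e₁ d)) • e₁ d else Z.2 m)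

/-- `Z'` is the configuration just after an instant at which the configuration just before is `Z`:
nothing happens without contact, and the boundary condition acts at a single contact. There is no
such `Z'` if `Z` has several simultaneous contacts, or does not lie in the phase space. -/
def EventRule {d N : ℕ} [NeZero d] (ε : ℝ) (Z Z' : Config d N) : Prop :=
  (NoContact ε Z ∧ Z' = Z) ∨
  (∃ j k, PairContact ε j k Z ∧ Z' = pairCollision ε j k Z) ∨
  (∃ l, WallContact ε l Z ∧ Z' = wallReflection l Z)

/-- Global non-pathological hard sphere trajectories (with right-continuous velocities): near every
time the motion is free on each side, and the one-sided limits are related by the event rule.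
In particular the trajectory remains in the phase space. -/
def IsHardSphereTrajectory {d N : ℕ} [NeZero d] (ε : ℝ) (γ : ℝ → Config d N) : Prop :=
  ∀ t, (∀ᶠ t' in 𝓝[>] t, γ t' = freeFlow (t' - t) (γ t)) ∧
    ∃ Zbefore, EventRule ε Zbefore (γ t) ∧
      ∀ᶠ t' in 𝓝[<] t, γ t' = freeFlow (t' - t) Zbefore

open Classical in
/-- The hard sphere transport `T^{N,ε}_t`, meaningful on the configurations through which a global
trajectory passes (this trajectory is then unique), and with the dummy value `Z` elsewhere. -/
def hardSphereFlow {d N : ℕ} [NeZero d] (ε t : ℝ) (Z : Config d N) : Config d N :=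
  if H : ∃ γ : ℝ → Config d N, IsHardSphereTrajectory ε γ ∧ γ 0 = Z then H.choose t else Z

/-! ### The truncated transport-collision operators -/

/-- The two elementary terms: `plus` (post-collisional) and `minus` (pre-collisional). -/
inductive CollisionSign
  | plus
  | minus

/-- The positive part `(a)_+` or the negative part `(a)_-` of `a`. -/
def CollisionSign.part : CollisionSign → ℝ → ℝ
  | .plus, a => max a 0
  | .minus, a => max (-a) 0

/-- The unit sphere. -/
abbrev USphere (d : ℕ) : Type := Metric.sphere (0 : Euc d) 1

/-- The surface measure of the unit sphere. -/
def sphereMeasure (d : ℕ) : Measure (USphere d) := (volume : Measure (Euc d)).toSphere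

/-- The configuration `(Z_s, x_i + ε ω, v)` of `s + 1` particles. -/
def adjoin {d s : ℕ} (ε : ℝ) (i : Fin s) (Z : Config d s) (ω : USphere d) (v : Euc d) :
    Config d (s + 1) :=
  (Fin.snoc (α := fun _ => Euc d) Z.1 (Z.1 i + ε • (ω : Euc d)),
    Fin.snoc (α := fun _ => Euc d) Z.2 v)

/-- The adjoined configuration, in pre-collisional form: for `plus`, the scattering mapping is
applied to the velocities of the pair that collides. -/
def adjoinPre {d s : ℕ} (sg : CollisionSign) (ε : ℝ) (i : Fin s) (Z : Config d s)
    (ω : USphere d) (v : Euc d) : Config d (s + 1) :=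
  match sg with
  | .plus => pairCollision ε i.castSucc (Fin.last s) (adjoin ε i Z ω v)
  | .minus => adjoin ε i Z ω v

/-- The maps `S^±_{s+1}`: the configuration from which, after a (small) time `u` of free flow, the
particle adjoined next to the particle `i` touches it. -/
def preFree {d s : ℕ} (sg : CollisionSign) (ε : ℝ) (i : Fin s) (u : ℝ) (Z : Config d s)
    (ω : USphere d) (v : Euc d) : Config d (s + 1) :=
  freeFlow (-u) (adjoinPre sg ε i Z ω v)

/-- The cut-off domain `D^ε_{s+1}(δ, R₁, R₂)`. -/
def cutoffDomain {d s : ℕ} [NeZero d] (ε : ℝ) (i : Fin s) (δ R₁ R₂ : ℝ) (Z : Config d s) :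
    Set (USphere d × Euc d) :=
  {p | (∀ j k, j < k → (j, k) ≠ (i.castSucc, Fin.last s) →
          ε + Real.sqrt 2 * δ * R₂ <
            ‖(adjoin ε i Z p.1 p.2).1 j - (adjoin ε i Z p.1 p.2).1 k‖) ∧
       (∀ l, ε / 2 + δ * R₂ < inner ℝ ((adjoin ε i Z p.1 p.2).1 l) (e₁ d)) ∧
       famNorm (adjoin ε i Z p.1 p.2).1 ≤ R₁ ∧ famNorm (adjoin ε i Z p.1 p.2).2 ≤ R₂}

/-- The left end `k a` of the interval `[k a, (k + 1) a)` that contains `t`. -/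
def gridTime (a t : ℝ) : ℝ := (⌊t / a⌋ : ℝ) * a

/-- The function of time with values in functions on the phase space that is constant on the
intervals `[k τ, (k + 1) τ)` and coincides with `φ` at their left ends. -/
def stepInTime {d N : ℕ} (τ : ℝ) (φ : ℝ → Config d N → ℝ) (t : ℝ) : Config d N → ℝ :=
  φ (gridTime τ t)

/-- Integrand of the truncated transport-collision operator. On `[k δ, (k + 1) δ)` the backward
transport of the adjoined configuration during the time `t` is the backward free transport during
`t - k δ`, with which it coincides on the cut-off domain, followed by `T_{-k δ}`. -/
def cutoffIntegrand {d s : ℕ} [NeZero d] (sg : CollisionSign) (ε : ℝ) (i : Fin s) (δ R₁ R₂ : ℝ)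
    (φ : ℝ → Config d (s + 1) → ℝ) (q : ℝ × Config d s) : USphere d × Euc d → ℝ :=
  (cutoffDomain ε i δ R₁ R₂ q.2).indicator fun p =>
    sg.part (inner ℝ (p.1 : Euc d) (p.2 - q.2.2 i)) *
      φ q.1 (hardSphereFlow ε (-gridTime δ q.1)
        (preFree sg ε i (q.1 - gridTime δ q.1) q.2 p.1 p.2))

/-- The truncated elementary transport-collision operator `C_{s,s+1,±,i}(δ, R₁, R₂) T_t`. -/
def cutoffOperator {d s : ℕ} [NeZero d] (sg : CollisionSign) (ε : ℝ) (i : Fin s) (δ R₁ R₂ : ℝ)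
    (φ : ℝ → Config d (s + 1) → ℝ) (q : ℝ × Config d s) : ℝ :=
  ε ^ (d - 1) *
    ∫ p, cutoffIntegrand sg ε i δ R₁ R₂ φ q p ∂((sphereMeasure d).prod volume)

/-- Lebesgue measure on `[0, T] × D^ε_s`. -/
def timePhaseMeasure (d s : ℕ) [NeZero d] (ε T : ℝ) : Measure (ℝ × Config d s) :=
  (volume.restrict (Set.Icc 0 T)).prod (phaseMeasure d s ε)

/-- `q` is the truncated operator `C_{s,s+1,±,i}(δ, R₁, R₂) T_t` applied to the family
`t ↦ φ t`: the truncated operators are given by convergent integrals for functions that are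
piecewise constant in time, and `q` is the limit in `L^∞` obtained by refining in time. -/
def IsCutoffTransportCollision {d s : ℕ} [NeZero d] (sg : CollisionSign) (ε T : ℝ) (i : Fin s)
    (δ R₁ R₂ : ℝ) (φ : ℝ → Config d (s + 1) → ℝ) (q : ℝ × Config d s → ℝ) : Prop :=
  (∀ τ, 0 < τ →
    (∀ᵐ z ∂timePhaseMeasure d s ε T,
      Integrable (cutoffIntegrand sg ε i δ R₁ R₂ (stepInTime τ φ) z)
        ((sphereMeasure d).prod volume)) ∧
    MemLp (cutoffOperator sg ε i δ R₁ R₂ (stepInTime τ φ)) ∞ (timePhaseMeasure d s ε T)) ∧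
  MemLp q ∞ (timePhaseMeasure d s ε T) ∧
  Tendsto (fun τ => eLpNorm (cutoffOperator sg ε i δ R₁ R₂ (stepInTime τ φ) - q) ∞
    (timePhaseMeasure d s ε T)) (𝓝[>] 0) (𝓝 0)

/-- `Q` is the elementary transport-collision operator `C_{s,s+1,±,i} T_t` applied to the family
`t ↦ φ t`, obtained from the truncated operators by relaxing the cut-off `δ → 0` (strong limit in
`L¹`), then `R₁ → ∞` (almost everywhere limit) and finally `R₂ → ∞` (limit in `L^∞`). -/
def IsTransportCollision {d s : ℕ} [NeZero d] (sg : CollisionSign) (ε T : ℝ) (i : Fin s)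
    (φ : ℝ → Config d (s + 1) → ℝ) (Q : ℝ × Config d s → ℝ) : Prop :=
  ∃ (q₃ : ℝ → ℝ → ℝ → ℝ × Config d s → ℝ) (q₂ : ℝ → ℝ → ℝ × Config d s → ℝ)
    (q₁ : ℝ → ℝ × Config d s → ℝ),
    (∀ δ R₁ R₂, 0 < δ → 0 < R₁ → 0 < R₂ →
      IsCutoffTransportCollision sg ε T i δ R₁ R₂ φ (q₃ δ R₁ R₂) ∧
      MemLp (q₃ δ R₁ R₂) 1 (timePhaseMeasure d s ε T)) ∧
    (∀ R₁ R₂, 0 < R₁ → 0 < R₂ →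
      MemLp (q₂ R₁ R₂) 1 (timePhaseMeasure d s ε T) ∧
      MemLp (q₂ R₁ R₂) ∞ (timePhaseMeasure d s ε T) ∧
      Tendsto (fun δ => eLpNorm (q₃ δ R₁ R₂ - q₂ R₁ R₂) 1 (timePhaseMeasure d s ε T))
        (𝓝[>] 0) (𝓝 0)) ∧
    (∀ R₂, 0 < R₂ →
      MemLp (q₁ R₂) ∞ (timePhaseMeasure d s ε T) ∧
      ∀ᵐ z ∂timePhaseMeasure d s ε T, Tendsto (fun R₁ => q₂ R₁ R₂ z) atTop (𝓝 (q₁ R₂ z))) ∧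
    Tendsto (fun R₂ => eLpNorm (q₁ R₂ - Q) ∞ (timePhaseMeasure d s ε T)) atTop (𝓝 0)

/-! ### The weights -/

/-- `|V_{s+1}|` for `V_{s+1} = (v_1, …, v_s, v)`. -/
def velNorm {d s : ℕ} (V : Fin s → Euc d) (v : Euc d) : ℝ :=
  famNorm (Fin.snoc (α := fun _ => Euc d) V v : Fin (s + 1) → Euc d)

/-- The admissible weights `g_{s+1}` on `[0, T] × ℝ_+` (values outside are irrelevant). -/
structure IsVelocityWeight (d s : ℕ) (T : ℝ) (g : ℝ → ℝ → ℝ) : Prop where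
  nonneg : ∀ t ∈ Set.Icc 0 T, ∀ x, 0 ≤ x → 0 ≤ g t x
  measurable : AEMeasurable (fun p : ℝ × ℝ => g p.1 p.2)
    (volume.restrict (Set.Icc 0 T ×ˢ Set.Ici 0))
  ae_pos : ∀ᵐ p : ℝ × ℝ ∂volume.restrict (Set.Icc 0 T ×ˢ Set.Ici 0), 0 < g p.1 p.2
  increasing : ∀ x, 0 ≤ x → MonotoneOn (fun t => g t x) (Set.Icc 0 T)
  integrable : ∀ t ∈ Set.Icc 0 T, ∀ᵐ V : Fin s → Euc d,
    Integrable fun v : Euc d => velNorm V v * g t (velNorm V v)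
  bounded : ∀ t ∈ Set.Icc 0 T, ∃ C : ℝ, ∀ᵐ V : Fin s → Euc d,
    ∫ v : Euc d, velNorm V v * g t (velNorm V v) ≤ C
  tail : Tendsto (fun R : ℝ =>
      eLpNorm (fun p : ℝ × (Fin s → Euc d) =>
        ∫ v in {v : Euc d | R ≤ velNorm p.2 v}, velNorm p.2 v * g p.1 (velNorm p.2 v))
      ∞ ((volume.restrict (Set.Icc 0 T)).prod volume)) atTop (𝓝 0)

end

/-! The truncated operators evaluate classes of functions along configurations in contact, which
form a set of codimension one. The main question is whether this has a meaning; the limits are then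
a matter of dominated convergence.

Two facts give the meaning. The first is a flux formula (`lintegral_flux`, `lintegral_config_flux`):
on the configurations whose pair is about to collide, Lebesgue measure is ε^(d-1) (ω·w)_- dω du dV
dX, with ω the direction of impact, w the relative velocity and u the time left before the
collision. Time supplies the missing dimension, so the maps S^± pull null sets back to null sets of
(t, Z_s, ω, v) wherever the factor (ω·(v - v_i))_± is positive (`ae_preFree`). Scattering preserves
dV and exchanges the two signs. The second fact is Alexander's theorem. During a time δ, a
configuration with speed at most r and at most one contact nearer than 4rδ moves by an explicit step
map that does not increase volumes (`volume_regular_inter_stepMap_le`). The exceptional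
configurations in a bounded box have volume O(δ²), because two distinct contacts never involve the
same particles (`exists_volume_near_le`). Cutting a time t into n steps therefore loses a volume
O(1/n). Hence almost every configuration has a global trajectory (`ae_alive`), the past coming from
velocity reversal, and the flow is measurable, nonsingular and conserves energy
(`isNonsingularFlow`).

On the cut-off domain the motion just before the contact is free, so T_{-kδ} S^± is the backward
transport, during the time t, of the post-collisional configuration (`flow_preFree_eq_backward`).
This no longer depends on δ, R₁, R₂: all truncated operators are integrals, over various sets, of a
single `collisionKernel`, and the limit must be its full integral.

As for h, continuity in time yields a jointly measurable representative H with |H t Z - H t' Z| ≤ ‖h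
t - h t'‖ for every Z, and with |H t Z| ≤ λ g for every t > 0 (`exists_continuous_representative`);
monotonicity of g carries the bound from earlier sample times to t. A function piecewise constant in
time uses countably many times only, so the choice of representatives is invisible. By conservation
of energy the kernel is at most (ω·(v - v_i))_± λ g(t, |V_{s+1}|). Dominated convergence gives the
limits δ → 0 in L¹ and R₁ → ∞ almost everywhere, and the tail hypothesis on g gives R₂ → ∞
uniformly. The factor |S^{d-1}|/2 comes from the antipodal symmetry of the sphere
(`integral_part_inner_le`), and uniqueness from the almost everywhere uniqueness of each limit
(`isTransportCollision_ae_eq`). -/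

noncomputable section

namespace HardSphere

/-! ### Hitting a sphere along a straight line -/

section Flux

variable {d : ℕ}

/-- A quarter of the discriminant of `‖y + u • w‖ ^ 2 = r ^ 2` as an equation in `u`. -/
def disc (r : ℝ) (y w : Euc d) : ℝ := inner ℝ y w ^ 2 - ‖w‖ ^ 2 * (‖y‖ ^ 2 - r ^ 2)

/-- The time at which the line `u ↦ y + u • w` enters the ball of radius `r`. -/
def hitTime (r : ℝ) (y w : Euc d) : ℝ := (-inner ℝ y w - √(disc r y w)) / ‖w‖ ^ 2

/-- The points from which the motion with velocity `w` enters the ball of radius `r`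
transversally and at a positive time. -/
def hitSet (r : ℝ) (w : Euc d) : Set (Euc d) := {y | 0 < disc r y w ∧ 0 < hitTime r y w}

lemma disc_pos_ne_zero {r : ℝ} {y w : Euc d} (h : 0 < disc r y w) : w ≠ 0 := by
  rintro rfl
  simp [disc] at h

lemma norm_add_smul_sq (y w : Euc d) (u : ℝ) :
    ‖y + u • w‖ ^ 2 = ‖y‖ ^ 2 + 2 * u * inner ℝ y w + u ^ 2 * ‖w‖ ^ 2 := by
  rw [norm_add_sq_real, inner_smul_right, norm_smul, mul_pow, Real.norm_eq_abs, sq_abs]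
  ring

lemma inner_add_smul_self (y w : Euc d) (u : ℝ) :
    inner ℝ (y + u • w) w = inner ℝ y w + u * ‖w‖ ^ 2 := by
  rw [inner_add_left, inner_smul_left, real_inner_self_eq_norm_sq]
  simp

/-- Half the derivative of the squared distance is `inner y w + u * ‖w‖ ^ 2`, whose square equals
the discriminant at the roots. Its negative sign selects the smaller root, where the ball is
entered. -/
lemma hit_iff {r : ℝ} (hr : 0 ≤ r) {y w : Euc d} {u : ℝ} :
    (‖y + u • w‖ = r ∧ inner ℝ (y + u • w) w < 0) ↔ (0 < disc r y w ∧ u = hitTime r y w) := by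
  constructor
  · rintro ⟨h1, h2⟩
    have h3 := norm_add_smul_sq y w u
    rw [inner_add_smul_self] at h2
    rw [h1] at h3
    have hw : w ≠ 0 := by rintro rfl; simp at h2
    have hw' : 0 < ‖w‖ ^ 2 := by positivity
    have h4 : disc r y w = (inner ℝ y w + u * ‖w‖ ^ 2) ^ 2 := by
      rw [disc, h3]; ring
    refine ⟨by rw [h4]; exact sq_pos_of_neg h2, ?_⟩
    rw [hitTime, h4, Real.sqrt_sq_eq_abs, abs_of_neg h2]
    field_simp
    ring
  · rintro ⟨h1, rfl⟩
    have hw := disc_pos_ne_zero h1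
    have hw' : 0 < ‖w‖ ^ 2 := by positivity
    have h2 : inner ℝ y w + hitTime r y w * ‖w‖ ^ 2 = -√(disc r y w) := by
      rw [hitTime]; field_simp; ring
    have h3 := Real.sq_sqrt h1.le
    constructor
    · rw [← sq_eq_sq₀ (norm_nonneg _) hr, norm_add_smul_sq]
      have h4 : (inner ℝ y w + hitTime r y w * ‖w‖ ^ 2) ^ 2 = disc r y w := by
        rw [h2, neg_sq, h3]
      rw [disc] at h4
      have : ‖w‖ ^ 2 * (‖y‖ ^ 2 + 2 * hitTime r y w * inner ℝ y w +
          hitTime r y w ^ 2 * ‖w‖ ^ 2) = ‖w‖ ^ 2 * r ^ 2 := by linear_combination h4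
      exact mul_left_cancel₀ hw'.ne' this
    · rw [inner_add_smul_self, h2]
      simpa using h1

lemma measurable_disc {α : Type*} [MeasurableSpace α] {r : α → ℝ} {y w : α → Euc d}
    (hr : Measurable r) (hy : Measurable y) (hw : Measurable w) :
    Measurable fun a => disc (r a) (y a) (w a) := by
  unfold disc
  fun_prop

lemma measurable_hitTime {α : Type*} [MeasurableSpace α] {r : α → ℝ} {y w : α → Euc d}
    (hr : Measurable r) (hy : Measurable y) (hw : Measurable w) :
    Measurable fun a => hitTime (r a) (y a) (w a) := by
  unfold hitTime
  have := measurable_disc hr hy hw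
  fun_prop

lemma measurableSet_hitSet {α : Type*} [MeasurableSpace α] {r : α → ℝ} {y w : α → Euc d}
    (hr : Measurable r) (hy : Measurable y) (hw : Measurable w) :
    MeasurableSet {a | y a ∈ hitSet (r a) (w a)} :=
  (measurableSet_lt measurable_const (measurable_disc hr hy hw)).inter
    (measurableSet_lt measurable_const (measurable_hitTime hr hy hw))

lemma measurableSet_hitSet_right (r : ℝ) (w : Euc d) : MeasurableSet (hitSet r w) :=
  measurableSet_hitSet (y := fun y => y) measurable_const measurable_id measurable_const

lemma hitSet_smul {r c : ℝ} (hc : 0 < c) {y w : Euc d} :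
    c • y ∈ hitSet (c * r) w ↔ y ∈ hitSet r w := by
  have h1 : disc (c * r) (c • y) w = c ^ 2 * disc r y w := by
    simp only [disc, inner_smul_left, norm_smul, Real.norm_eq_abs, abs_of_pos hc]
    simp only [conj_trivial]
    ring
  have h2 : hitTime (c * r) (c • y) w = c * hitTime r y w := by
    simp only [hitTime, h1, inner_smul_left, conj_trivial]
    rw [Real.sqrt_mul (by positivity), Real.sqrt_sq hc.le]
    ring
  simp only [hitSet, Set.mem_ofPred_eq, h1, h2]
  rw [mul_pos_iff_of_pos_left (by positivity), mul_pos_iff_of_pos_left hc]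

lemma lintegral_polar [NeZero d] {f : Euc d → ℝ≥0∞} (hf : Measurable f) :
    ∫⁻ x, f x = ∫⁻ ω, ∫⁻ r in Set.Ioi (0 : ℝ), ENNReal.ofReal (r ^ (d - 1)) * f (r • (ω : Euc d))
      ∂volume ∂sphereMeasure d := by
  have hdim : Module.finrank ℝ (Euc d) = d := by simp
  have h := (volume : Measure (Euc d)).measurePreserving_homeomorphUnitSphereProd
  have hs : MeasurableSet ({0}ᶜ : Set (Euc d)) := (measurableSet_singleton _).compl
  have e1 : ∫⁻ x, f x = ∫⁻ x : ({0}ᶜ : Set (Euc d)), f x ∂(volume.comap Subtype.val) := by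
    rw [lintegral_subtype_comap hs, restrict_compl_singleton]
  have e2 := h.lintegral_comp (f := fun p => f (p.2.1 • (p.1 : Euc d))) (by fun_prop)
  have e3 : ∀ x : ({0}ᶜ : Set (Euc d)),
      ((homeomorphUnitSphereProd (Euc d) x).2.1 • ((homeomorphUnitSphereProd (Euc d) x).1 : Euc d))
        = x := by
    intro x
    have hx : ‖(x : Euc d)‖ ≠ 0 := norm_ne_zero_iff.2 x.2
    simp [smul_smul, hx]
  simp only [e3] at e2
  rw [e1, e2, lintegral_prod _ (by fun_prop)]
  refine lintegral_congr fun ω => ?_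
  rw [Measure.volumeIoiPow, lintegral_withDensity_eq_lintegral_mul _ (by fun_prop) (by fun_prop), hdim]
  exact lintegral_subtype_comap measurableSet_Ioi
    (fun r : ℝ => ENNReal.ofReal (r ^ (d - 1)) * f (r • (ω : Euc d)))

/-- One-dimensional substitution r = ‖y + u • w‖. For fixed y the radius decreases while the motion
approaches the origin, and the radii so attained at positive times are exactly those whose ball is
entered from y. The ratio on the right is the absolute value of the derivative of the radius. -/
lemma lintegral_hit (r₀ : ℝ → ℝ≥0∞) (y w : Euc d) :
    ∫⁻ r in Set.Ioi (0 : ℝ), {r | y ∈ hitSet r w}.indicator r₀ r =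
      ∫⁻ u in Set.Ioi (0 : ℝ), ENNReal.ofReal (max (-inner ℝ (y + u • w) w) 0 / ‖y + u • w‖) *
        r₀ ‖y + u • w‖ := by
  set I : Set ℝ := {u | 0 < u ∧ inner ℝ (y + u • w) w < 0} with hI
  have hIm : MeasurableSet I := by
    have h1 : Measurable fun u : ℝ => inner ℝ (y + u • w) w := by fun_prop
    exact (measurableSet_lt measurable_const measurable_id).inter
      (measurableSet_lt h1 measurable_const)
  have hIne : ∀ u ∈ I, y + u • w ≠ 0 := by
    intro u hu h0
    have := hu.2
    rw [h0] at this
    simp at this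
  have himg : (fun u : ℝ => ‖y + u • w‖) '' I = Set.Ioi 0 ∩ {r | y ∈ hitSet r w} := by
    ext r
    constructor
    · rintro ⟨u, hu, rfl⟩
      refine ⟨norm_pos_iff.2 (hIne u hu), ?_⟩
      obtain ⟨h1, h2⟩ := (hit_iff (norm_nonneg _)).1 ⟨rfl, hu.2⟩
      exact ⟨h1, h2 ▸ hu.1⟩
    · rintro ⟨hr, h1, h2⟩
      obtain ⟨h3, h4⟩ := (hit_iff (y := y) (w := w) (le_of_lt hr)).2 ⟨h1, rfl⟩
      exact ⟨_, ⟨h2, h4⟩, h3⟩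
  have hder : ∀ u ∈ I, HasDerivWithinAt (fun u : ℝ => ‖y + u • w‖)
      (inner ℝ (y + u • w) w / ‖y + u • w‖) I u := by
    intro u hu
    have h1 : HasDerivAt (fun u : ℝ => y + u • w) w u := by
      simpa using ((hasDerivAt_id u).smul_const w).const_add y
    have h2 := h1.norm_sq.sqrt (by
      have := norm_pos_iff.2 (hIne u hu)
      positivity)
    simp only [Real.sqrt_sq (norm_nonneg _)] at h2
    refine (h2.congr_deriv ?_).hasDerivWithinAt
    have := (norm_pos_iff.2 (hIne u hu)).ne'
    field_simp
  have hinj : Set.InjOn (fun u : ℝ => ‖y + u • w‖) I := by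
    intro u hu u' hu' h
    have h1 := (hit_iff (norm_nonneg _)).1 ⟨rfl, hu.2⟩
    have h2 := (hit_iff (norm_nonneg _)).1 ⟨h.symm, hu'.2⟩
    rw [h1.2, h2.2]
  have hS : MeasurableSet {r : ℝ | y ∈ hitSet r w} :=
    measurableSet_hitSet measurable_id measurable_const measurable_const
  rw [setLIntegral_indicator hS, Set.inter_comm, ← himg,
    lintegral_image_eq_lintegral_abs_deriv_mul hIm hder hinj,
    ← lintegral_indicator hIm, ← lintegral_indicator measurableSet_Ioi]
  refine lintegral_congr fun u => ?_
  by_cases hu : u ∈ I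
  · rw [Set.indicator_of_mem hu, Set.indicator_of_mem (Set.mem_Ioi.2 hu.1), abs_div, abs_norm,
      abs_of_neg hu.2, max_eq_left (by linarith [hu.2])]
  · rw [Set.indicator_of_notMem hu]
    by_cases hu' : 0 < u
    · rw [Set.indicator_of_mem (Set.mem_Ioi.2 hu')]
      have : 0 ≤ inner ℝ (y + u • w) w := by
        by_contra! hc
        exact hu ⟨hu', hc⟩
      rw [max_eq_right (by linarith)]
      simp
    · rw [Set.indicator_of_notMem (by simpa using hu')]

/-- Integrating over all radii at once avoids a change of variables on a surface. Fubini and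
`lintegral_hit` exchange the radius for the time of entrance, a translation exchanges the starting
point for the point of entrance, and the latter, now free in the whole space, is written in polar
coordinates. -/
lemma lintegral_flux_radii [NeZero d] (w : Euc d) {F : ℝ → Euc d → ℝ≥0∞}
    (hF : Measurable (Function.uncurry F)) :
    ∫⁻ r in Set.Ioi (0 : ℝ), ∫⁻ y in hitSet r w, F r y =
      ∫⁻ r in Set.Ioi (0 : ℝ), ∫⁻ ω, ∫⁻ u in Set.Ioi (0 : ℝ), ENNReal.ofReal (r ^ (d - 1)) *
        (ENNReal.ofReal (max (-inner ℝ (ω : Euc d) w) 0) * F r (r • (ω : Euc d) - u • w))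
        ∂volume ∂sphereMeasure d := by
  have : IsFiniteMeasure (sphereMeasure d) := by unfold sphereMeasure; infer_instance
  have hS : MeasurableSet {p : Euc d × ℝ | p.1 ∈ hitSet p.2 w} :=
    measurableSet_hitSet measurable_snd measurable_fst measurable_const
  have hF' : ∀ {α : Type} [MeasurableSpace α] {a : α → ℝ} {b : α → Euc d},
      Measurable a → Measurable b → Measurable fun x => F (a x) (b x) :=
    fun ha hb => hF.comp (ha.prodMk hb)
  calc ∫⁻ r in Set.Ioi (0 : ℝ), ∫⁻ y in hitSet r w, F r y
      = ∫⁻ r in Set.Ioi (0 : ℝ), ∫⁻ y, {p : Euc d × ℝ | p.1 ∈ hitSet p.2 w}.indicator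
          (fun p => F p.2 p.1) (y, r) := by
        refine lintegral_congr fun r => ?_
        rw [← lintegral_indicator (measurableSet_hitSet_right r w)]
        rfl
    _ = ∫⁻ y, ∫⁻ r in Set.Ioi (0 : ℝ), {r | y ∈ hitSet r w}.indicator (fun r => F r y) r := by
        rw [lintegral_lintegral_swap]
        · rfl
        · refine Measurable.aemeasurable ?_
          exact ((hF' measurable_snd measurable_fst).indicator hS).comp measurable_swap
    _ = ∫⁻ y, ∫⁻ u in Set.Ioi (0 : ℝ),
          ENNReal.ofReal (max (-inner ℝ (y + u • w) w) 0 / ‖y + u • w‖) * F ‖y + u • w‖ y :=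
        lintegral_congr fun y => lintegral_hit (fun r => F r y) y w
    _ = ∫⁻ u in Set.Ioi (0 : ℝ), ∫⁻ y,
          ENNReal.ofReal (max (-inner ℝ (y + u • w) w) 0 / ‖y + u • w‖) * F ‖y + u • w‖ y := by
        rw [lintegral_lintegral_swap]
        refine Measurable.aemeasurable ?_
        exact Measurable.mul (by fun_prop) (hF' (by fun_prop) (by fun_prop))
    _ = ∫⁻ u in Set.Ioi (0 : ℝ), ∫⁻ x,
          ENNReal.ofReal (max (-inner ℝ x w) 0 / ‖x‖) * F ‖x‖ (x - u • w) := by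
        refine lintegral_congr fun u => ?_
        rw [← lintegral_add_right_eq_self (μ := volume)
          (fun x => ENNReal.ofReal (max (-inner ℝ x w) 0 / ‖x‖) * F ‖x‖ (x - u • w)) (u • w)]
        simp
    _ = ∫⁻ u in Set.Ioi (0 : ℝ), ∫⁻ ω, ∫⁻ r in Set.Ioi (0 : ℝ), ENNReal.ofReal (r ^ (d - 1)) *
        (ENNReal.ofReal (max (-inner ℝ (ω : Euc d) w) 0) * F r (r • (ω : Euc d) - u • w))
        ∂volume ∂sphereMeasure d := by
        refine lintegral_congr fun u => ?_
        have hm : Measurable fun x : Euc d =>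
            ENNReal.ofReal (max (-inner ℝ x w) 0 / ‖x‖) * F ‖x‖ (x - u • w) :=
          Measurable.mul (by fun_prop) (hF' (by fun_prop) (by fun_prop))
        rw [lintegral_polar hm]
        refine lintegral_congr fun ω => setLIntegral_congr_fun measurableSet_Ioi fun r hr => ?_
        have hr : (0 : ℝ) < r := hr
        have hω : ‖(ω : Euc d)‖ = 1 := by simp
        have h1 : ‖r • (ω : Euc d)‖ = r := by
          rw [norm_smul, hω, Real.norm_eq_abs, abs_of_pos hr, mul_one]
        have h2 : max (-inner ℝ (r • (ω : Euc d)) w) 0 / r = max (-inner ℝ (ω : Euc d) w) 0 := by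
          rw [inner_smul_left, conj_trivial, ← mul_neg, ← mul_zero r,
            ← mul_max_of_nonneg _ _ hr.le, mul_zero, mul_div_cancel_left₀ _ hr.ne']
        simp only [h1, h2]
    _ = ∫⁻ u in Set.Ioi (0 : ℝ), ∫⁻ r in Set.Ioi (0 : ℝ), ∫⁻ ω, ENNReal.ofReal (r ^ (d - 1)) *
        (ENNReal.ofReal (max (-inner ℝ (ω : Euc d) w) 0) * F r (r • (ω : Euc d) - u • w))
        ∂sphereMeasure d := by
        refine lintegral_congr fun u => ?_
        rw [lintegral_lintegral_swap]
        refine Measurable.aemeasurable ?_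
        exact Measurable.mul (by fun_prop) (Measurable.mul (by fun_prop)
          (hF' (by fun_prop) (by fun_prop)))
    _ = ∫⁻ r in Set.Ioi (0 : ℝ), ∫⁻ u in Set.Ioi (0 : ℝ), ∫⁻ ω, ENNReal.ofReal (r ^ (d - 1)) *
        (ENNReal.ofReal (max (-inner ℝ (ω : Euc d) w) 0) * F r (r • (ω : Euc d) - u • w))
        ∂sphereMeasure d := by
        rw [lintegral_lintegral_swap]
        refine Measurable.aemeasurable (Measurable.lintegral_prod_right ?_)
        exact Measurable.mul (by fun_prop) (Measurable.mul (by fun_prop)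
          (hF' (by fun_prop) (by fun_prop)))
    _ = _ := by
        refine lintegral_congr fun r => ?_
        rw [lintegral_lintegral_swap]
        refine Measurable.aemeasurable ?_
        exact Measurable.mul (by fun_prop) (Measurable.mul (by fun_prop)
          (hF' (by fun_prop) (by fun_prop)))

lemma lintegral_comp_smul_of_pos {c : ℝ} (hc : 0 < c) {f : Euc d → ℝ≥0∞} (hf : Measurable f) :
    ENNReal.ofReal (c ^ d) * ∫⁻ y, f (c • y) = ∫⁻ y, f y := by
  have h := Measure.map_addHaar_smul (volume : Measure (Euc d)) hc.ne'
  rw [← lintegral_map (μ := volume) (g := fun y : Euc d => c • y) hf (by fun_prop), h,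
    lintegral_smul_measure, smul_eq_mul, ← mul_assoc, ← ENNReal.ofReal_mul (by positivity)]
  simp [abs_of_pos hc, hc.ne']

lemma lintegral_Ioi_comp_mul {c : ℝ} (hc : 0 < c) {f : ℝ → ℝ≥0∞} (hf : Measurable f) :
    ENNReal.ofReal c * ∫⁻ u in Set.Ioi 0, f (c * u) = ∫⁻ u in Set.Ioi 0, f u := by
  have h := Real.map_volume_mul_left hc.ne'
  rw [← lintegral_indicator measurableSet_Ioi, ← lintegral_indicator measurableSet_Ioi]
  have e : ∀ u, (Set.Ioi 0).indicator (fun u => f (c * u)) u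
      = (Set.Ioi 0).indicator f (c * u) := by
    intro u
    simp only [Set.indicator_apply, Set.mem_Ioi, mul_pos_iff_of_pos_left hc]
  simp_rw [e]
  rw [← lintegral_map (g := fun u => c * u) (hf.indicator measurableSet_Ioi) (by fun_prop), h,
    lintegral_smul_measure, smul_eq_mul, ← mul_assoc, ← ENNReal.ofReal_mul hc.le, abs_inv,
    abs_of_pos hc, mul_inv_cancel₀ hc.ne', ENNReal.ofReal_one, one_mul]

/-- Lebesgue measure on the points that enter the ball of radius `ε` with velocity `w`, in terms
of the point of entrance and of the time of entrance. -/
theorem lintegral_flux [NeZero d] {ε : ℝ} (hε : 0 < ε) (w : Euc d) {f : Euc d → ℝ≥0∞}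
    (hf : Measurable f) :
    ∫⁻ y in hitSet ε w, f y = ENNReal.ofReal (ε ^ (d - 1)) *
      ∫⁻ ω, ∫⁻ u in Set.Ioi (0 : ℝ), ENNReal.ofReal (max (-inner ℝ (ω : Euc d) w) 0) *
        f (ε • (ω : Euc d) - u • w) ∂volume ∂sphereMeasure d := by
  set K := ∫⁻ y in hitSet ε w, f y with hK
  set J := ∫⁻ ω, ∫⁻ u in Set.Ioi (0 : ℝ), ENNReal.ofReal (max (-inner ℝ (ω : Euc d) w) 0) *
        f (ε • (ω : Euc d) - u • w) ∂volume ∂sphereMeasure d with hJ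
  have hH : MeasurableSet (hitSet ε w) := measurableSet_hitSet_right ε w
  have hd : d - 1 + 1 = d := Nat.sub_add_cancel (NeZero.pos d)
  -- Homogeneity recovers the single radius ε: f is transplanted to every radius r in (1, 2) with
  -- the Jacobian (ε / r) ^ d. Both sides are then constants integrated over an interval of length
  -- 1.
  have h := lintegral_flux_radii w (F := fun r y => (Set.Ioo 1 2).indicator
    (fun r : ℝ => ENNReal.ofReal ((ε / r) ^ d)) r * f ((ε / r) • y)) (by
      refine Measurable.mul ?_ ?_
      · exact ((Measurable.indicator (by fun_prop) measurableSet_Ioo)).comp measurable_fst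
      · exact hf.comp (by fun_prop))
  have hsub : Set.Ioo (1 : ℝ) 2 ⊆ Set.Ioi 0 := fun r hr => lt_trans zero_lt_one hr.1
  have hL : ∀ r ∈ Set.Ioi (0 : ℝ), ∫⁻ y in hitSet r w, (Set.Ioo 1 2).indicator
      (fun r : ℝ => ENNReal.ofReal ((ε / r) ^ d)) r * f ((ε / r) • y)
      = (Set.Ioo 1 2).indicator (fun _ => K) r := by
    intro r hr
    have hr : (0 : ℝ) < r := hr
    by_cases hr2 : r ∈ Set.Ioo (1 : ℝ) 2
    · simp only [Set.indicator_of_mem hr2]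
      have hc : 0 < ε / r := by positivity
      rw [lintegral_const_mul _ (by fun_prop), hK, ← lintegral_indicator hH,
        ← lintegral_comp_smul_of_pos hc (hf.indicator hH), ← lintegral_indicator
          (measurableSet_hitSet_right r w)]
      congr 1
      refine lintegral_congr fun y => ?_
      have : (ε / r) • y ∈ hitSet ε w ↔ y ∈ hitSet r w := by
        conv_lhs => rw [show ε = (ε / r) * r by field_simp]
        rw [show ε / r * r / r = ε / r by field_simp]
        exact hitSet_smul hc
      by_cases hy : y ∈ hitSet r w
      · rw [Set.indicator_of_mem hy, Set.indicator_of_mem (this.2 hy)]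
      · rw [Set.indicator_of_notMem hy, Set.indicator_of_notMem (fun h => hy (this.1 h))]
    · simp [Set.indicator_of_notMem hr2]
  have hR : ∀ r ∈ Set.Ioi (0 : ℝ), ∫⁻ ω, ∫⁻ u in Set.Ioi (0 : ℝ), ENNReal.ofReal (r ^ (d - 1)) *
        (ENNReal.ofReal (max (-inner ℝ (ω : Euc d) w) 0) * ((Set.Ioo 1 2).indicator
      (fun r : ℝ => ENNReal.ofReal ((ε / r) ^ d)) r * f ((ε / r) • (r • (ω : Euc d) - u • w))))
        ∂volume ∂sphereMeasure d
      = (Set.Ioo 1 2).indicator (fun _ => ENNReal.ofReal (ε ^ (d - 1)) * J) r := by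
    intro r hr
    have hr : (0 : ℝ) < r := hr
    by_cases hr2 : r ∈ Set.Ioo (1 : ℝ) 2
    · simp only [Set.indicator_of_mem hr2]
      have hc : 0 < ε / r := by positivity
      rw [hJ, ← lintegral_const_mul _ (by
        refine Measurable.lintegral_prod_right ?_
        fun_prop)]
      refine lintegral_congr fun ω => ?_
      rw [← lintegral_Ioi_comp_mul hc (f := fun u =>
          ENNReal.ofReal (max (-inner ℝ (ω : Euc d) w) 0) * f (ε • (ω : Euc d) - u • w))
          (by fun_prop), ← lintegral_const_mul _ (by fun_prop),
        ← lintegral_const_mul _ (by fun_prop)]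
      refine lintegral_congr fun u => ?_
      have e : (ε / r) • (r • (ω : Euc d) - u • w) = ε • (ω : Euc d) - (ε / r * u) • w := by
        rw [smul_sub, smul_smul, smul_smul, div_mul_cancel₀ _ hr.ne']
      rw [e]
      have e2 : ENNReal.ofReal (r ^ (d - 1)) * ENNReal.ofReal ((ε / r) ^ d)
          = ENNReal.ofReal (ε ^ (d - 1)) * ENNReal.ofReal (ε / r) := by
        rw [← ENNReal.ofReal_mul (by positivity), ← ENNReal.ofReal_mul (by positivity)]
        congr 1
        rw [← hd, pow_succ, div_pow]
        simp only [Nat.add_sub_cancel]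
        field_simp
      calc _ = (ENNReal.ofReal (r ^ (d - 1)) * ENNReal.ofReal ((ε / r) ^ d)) *
            (ENNReal.ofReal (max (-inner ℝ (ω : Euc d) w) 0) *
              f (ε • (ω : Euc d) - (ε / r * u) • w)) := by ring
        _ = _ := by rw [e2, mul_assoc]
    · simp [Set.indicator_of_notMem hr2]
  rw [setLIntegral_congr_fun measurableSet_Ioi hL, setLIntegral_congr_fun measurableSet_Ioi hR,
    setLIntegral_indicator measurableSet_Ioo, setLIntegral_indicator measurableSet_Ioo,
    Set.inter_eq_left.2 hsub, setLIntegral_const, setLIntegral_const, Real.volume_Ioo] at h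
  norm_num at h
  exact h

end Flux

/-! ### Flux coordinates on the configurations about to collide -/

section ConfigFlux

variable {d : ℕ}

instance : IsFiniteMeasure (sphereMeasure d) := by
  unfold sphereMeasure; infer_instance

/-- Reversal of the velocities. -/
def rev {N : ℕ} (Z : Config d N) : Config d N := (Z.1, -Z.2)

@[simp] lemma rev_rev {N : ℕ} (Z : Config d N) : rev (rev Z) = Z := by simp [rev]

@[simp] lemma rev_fst {N : ℕ} (Z : Config d N) : (rev Z).1 = Z.1 := rfl

@[simp] lemma rev_snd {N : ℕ} (Z : Config d N) : (rev Z).2 = -Z.2 := rfl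

@[simp] lemma freeFlow_zero {N : ℕ} (Z : Config d N) : freeFlow 0 Z = Z := by
  simp [freeFlow]

lemma freeFlow_add {N : ℕ} (s t : ℝ) (Z : Config d N) :
    freeFlow s (freeFlow t Z) = freeFlow (s + t) Z := by
  ext1
  · funext l
    simp only [freeFlow]
    module
  · rfl

lemma rev_freeFlow {N : ℕ} (t : ℝ) (Z : Config d N) :
    rev (freeFlow t Z) = freeFlow (-t) (rev Z) := by
  ext1
  · funext l
    simp [freeFlow]
  · rfl

lemma freeFlow_injective {N : ℕ} (t : ℝ) : Function.Injective (freeFlow (d := d) (N := N) t) := by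
  intro Z Z' h
  have := congrArg (freeFlow (-t)) h
  simpa [freeFlow_add] using this

@[fun_prop]
lemma measurable_insertNth {α : Type*} [MeasurableSpace α] {n : ℕ} (k : Fin (n + 1))
    {x : α → Euc d} {X : α → Fin n → Euc d} (hx : Measurable x) (hX : Measurable X) :
    Measurable fun a => k.insertNth (α := fun _ => Euc d) (x a) (X a) :=
  (MeasurableEquiv.piFinSuccAbove (fun _ => Euc d) k).symm.measurable.comp (hx.prodMk hX)

@[fun_prop]
lemma measurable_freeFlow {α : Type*} [MeasurableSpace α] {N : ℕ} {u : α → ℝ}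
    {Z : α → Config d N} (hu : Measurable u) (hZ : Measurable Z) :
    Measurable fun a => freeFlow (u a) (Z a) := by
  unfold freeFlow
  fun_prop

@[fun_prop]
lemma measurable_pairCollision {N : ℕ} (ε : ℝ) (j k : Fin N) :
    Measurable (pairCollision (d := d) ε j k) := by
  unfold pairCollision
  refine measurable_fst.prodMk (measurable_pi_lambda _ fun l => ?_)
  split_ifs <;> fun_prop

@[fun_prop]
lemma measurable_rev {N : ℕ} : Measurable (rev (d := d) (N := N)) := by
  unfold rev
  fun_prop

lemma lintegral_insertNth {n : ℕ} (k : Fin (n + 1)) {f : (Fin (n + 1) → Euc d) → ℝ≥0∞}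
    (hf : Measurable f) :
    ∫⁻ X, f X = ∫⁻ X' : Fin n → Euc d, ∫⁻ x : Euc d, f (k.insertNth x X') := by
  have h := (volume_preserving_piFinSuccAbove (fun _ : Fin (n + 1) => Euc d) k).symm
  rw [← h.lintegral_comp hf, Measure.volume_eq_prod, lintegral_prod_symm' _ (by fun_prop)]
  rfl

/-- The determinant of a linear involution is ±1. Reversal, scattering and reflection at the wall
are all of this kind. -/
lemma measurePreserving_involution {N : ℕ} {L : (Fin N → Euc d) →ₗ[ℝ] (Fin N → Euc d)}
    (hL : L ∘ₗ L = LinearMap.id) : MeasurePreserving L := by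
  have h1 : LinearMap.det L * LinearMap.det L = 1 := by
    rw [← LinearMap.det_comp, hL, LinearMap.det_id]
  have h2 : LinearMap.det L ≠ 0 := left_ne_zero_of_mul_eq_one h1
  refine ⟨L.continuous_of_finiteDimensional.measurable, ?_⟩
  rw [Measure.map_linearMap_addHaar_eq_smul_addHaar _ h2]
  have h3 : |(LinearMap.det L)⁻¹| = 1 := by
    rcases mul_self_eq_one_iff.1 h1 with h | h <;> simp [h]
  simp [h3]

lemma measurePreserving_freeFlow {N : ℕ} (t : ℝ) :
    MeasurePreserving (freeFlow (d := d) (N := N) t) := by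
  refine ⟨by fun_prop, Measure.ext fun s hs => ?_⟩
  rw [Measure.map_apply (by fun_prop) hs, Measure.volume_eq_prod,
    Measure.prod_apply_symm ((by fun_prop : Measurable (freeFlow (d := d) (N := N) t)) hs),
    Measure.prod_apply_symm hs]
  refine lintegral_congr fun V => ?_
  rw [← measure_preimage_add_right volume (t • V) ((fun x => (x, V)) ⁻¹' s)]
  rfl

lemma measurePreserving_rev {N : ℕ} : MeasurePreserving (rev (d := d) (N := N)) :=
  (MeasurePreserving.id volume).prod (measurePreserving_involution
    (L := -LinearMap.id) (LinearMap.ext fun V => by simp))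

/-- The scattering of the velocities of the particles `j` and `k` with impact direction `ω`. -/
def scatter {N : ℕ} (j k : Fin N) (ω : Euc d) (V : Fin N → Euc d) : Fin N → Euc d := fun l =>
  if l = j then V j - (inner ℝ (V j - V k) ω) • ω
  else if l = k then V k + (inner ℝ (V j - V k) ω) • ω
  else V l

lemma scatter_left {N : ℕ} (j k : Fin N) (ω : Euc d) (V : Fin N → Euc d) :
    scatter j k ω V j = V j - (inner ℝ (V j - V k) ω) • ω := by simp [scatter]

lemma scatter_right {N : ℕ} {j k : Fin N} (hjk : j ≠ k) (ω : Euc d) (V : Fin N → Euc d) :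
    scatter j k ω V k = V k + (inner ℝ (V j - V k) ω) • ω := by simp [scatter, hjk.symm]

lemma inner_scatter {N : ℕ} {j k : Fin N} (hjk : j ≠ k) {ω : Euc d} (hω : ‖ω‖ = 1)
    (V : Fin N → Euc d) :
    inner ℝ (scatter j k ω V j - scatter j k ω V k) ω = - inner ℝ (V j - V k) ω := by
  rw [scatter_left, scatter_right hjk]
  simp only [inner_sub_left, inner_add_left, inner_smul_left, real_inner_self_eq_norm_sq, hω,
    conj_trivial]
  ring

lemma scatter_scatter {N : ℕ} {j k : Fin N} (hjk : j ≠ k) {ω : Euc d} (hω : ‖ω‖ = 1)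
    (V : Fin N → Euc d) : scatter j k ω (scatter j k ω V) = V := by
  have h := inner_scatter hjk hω V
  funext l
  by_cases h1 : l = j
  · subst h1
    rw [scatter_left, h, scatter_left]
    module
  by_cases h2 : l = k
  · subst h2
    rw [scatter_right hjk, h, scatter_right hjk]
    module
  simp [scatter, h1, h2]

@[fun_prop]
lemma measurable_scatter {α : Type*} [MeasurableSpace α] {N : ℕ} (j k : Fin N)
    {ω : α → Euc d} {V : α → Fin N → Euc d} (hω : Measurable ω) (hV : Measurable V) :
    Measurable fun a => scatter j k (ω a) (V a) := by
  unfold scatter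
  refine measurable_pi_lambda _ fun l => ?_
  split_ifs <;> fun_prop

lemma measurePreserving_scatter {N : ℕ} {j k : Fin N} (hjk : j ≠ k) {ω : Euc d} (hω : ‖ω‖ = 1) :
    MeasurePreserving (scatter j k ω) := by
  let L : (Fin N → Euc d) →ₗ[ℝ] (Fin N → Euc d) :=
    { toFun := scatter j k ω
      map_add' := fun V W => by
        funext l
        by_cases h1 : l = j
        · subst h1
          simp only [scatter_left, Pi.add_apply, inner_sub_left, inner_add_left]
          module
        by_cases h2 : l = k
        · subst h2
          simp only [scatter_right hjk, Pi.add_apply, inner_sub_left, inner_add_left]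
          module
        simp [scatter, h1, h2]
      map_smul' := fun c V => by
        funext l
        by_cases h1 : l = j
        · subst h1
          simp only [scatter_left, Pi.smul_apply, inner_sub_left, inner_smul_left, conj_trivial,
            RingHom.id_apply]
          module
        by_cases h2 : l = k
        · subst h2
          simp only [scatter_right hjk, Pi.smul_apply, inner_sub_left, inner_smul_left,
            conj_trivial, RingHom.id_apply]
          module
        simp [scatter, h1, h2] }
  exact measurePreserving_involution (L := L) (LinearMap.ext fun V => scatter_scatter hjk hω V)

/-- Positions of `n + 1` particles, the particle `k` being put in contact with the `i`-th of the
others, in the direction `ω`. -/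
def contactPos {n : ℕ} (ε : ℝ) (k : Fin (n + 1)) (i : Fin n) (ω : Euc d) (X : Fin n → Euc d) :
    Fin (n + 1) → Euc d :=
  k.insertNth (α := fun _ => Euc d) (X i + ε • ω) X

@[fun_prop]
lemma measurable_contactPos {α : Type*} [MeasurableSpace α] {n : ℕ} (ε : ℝ) (k : Fin (n + 1))
    (i : Fin n) {ω : α → Euc d} {X : α → Fin n → Euc d} (hω : Measurable ω) (hX : Measurable X) :
    Measurable fun a => contactPos ε k i (ω a) (X a) := by
  unfold contactPos
  fun_prop

lemma contactPos_same {n : ℕ} (ε : ℝ) (k : Fin (n + 1)) (i : Fin n) (ω : Euc d)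
    (X : Fin n → Euc d) : contactPos ε k i ω X k = X i + ε • ω := by simp [contactPos]

lemma contactPos_succAbove {n : ℕ} (ε : ℝ) (k : Fin (n + 1)) (i l : Fin n) (ω : Euc d)
    (X : Fin n → Euc d) : contactPos ε k i ω X (k.succAbove l) = X l := by simp [contactPos]

lemma contactPos_sub {n : ℕ} (ε : ℝ) (k : Fin (n + 1)) (i : Fin n) (ω : Euc d)
    (X : Fin n → Euc d) :
    contactPos ε k i ω X k - contactPos ε k i ω X (k.succAbove i) = ε • ω := by
  rw [contactPos_same, contactPos_succAbove]
  module

lemma pairCollision_contactPos {n : ℕ} {ε : ℝ} (hε : 0 < ε) (k : Fin (n + 1)) (i : Fin n)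
    (ω : Euc d) (X : Fin n → Euc d) (V : Fin (n + 1) → Euc d) :
    pairCollision ε (k.succAbove i) k (contactPos ε k i ω X, V) =
      (contactPos ε k i ω X, scatter (k.succAbove i) k ω V) := by
  have h : contactPos ε k i ω X (k.succAbove i) - contactPos ε k i ω X k = -(ε • ω) := by
    rw [← contactPos_sub ε k i ω X]; abel
  have h2 : ∀ a : ℝ, (1 / ε ^ 2 * -(ε * a)) * -ε = a := by
    intro a; field_simp
  ext1
  · rfl
  · funext l
    simp only [pairCollision, scatter, h, inner_neg_right, inner_smul_right, smul_neg, smul_smul]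
    rw [← neg_smul, ← mul_neg, h2]

/-- Lebesgue measure on the configurations whose pair `(k, i)` is about to collide if the motion is
free, in terms of the configuration at the collision and of the collision time. -/
theorem lintegral_config_flux [NeZero d] {n : ℕ} {ε : ℝ} (hε : 0 < ε) (k : Fin (n + 1)) (i : Fin n)
    {F : Config d (n + 1) → ℝ≥0∞} (hF : Measurable F) :
    ∫⁻ Z in {Z | Z.1 k - Z.1 (k.succAbove i) ∈ hitSet ε (Z.2 k - Z.2 (k.succAbove i))}, F Z =
      ENNReal.ofReal (ε ^ (d - 1)) * ∫⁻ ω, ∫⁻ u in Set.Ioi (0 : ℝ),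
        ∫⁻ V : Fin (n + 1) → Euc d, ∫⁻ X : Fin n → Euc d,
        ENNReal.ofReal (max (-inner ℝ (ω : Euc d) (V k - V (k.succAbove i))) 0) *
          F (freeFlow (-u) (contactPos ε k i (ω : Euc d) X, V))
          ∂volume ∂volume ∂volume ∂sphereMeasure d := by
  have hS : MeasurableSet {Z : Config d (n + 1) |
      Z.1 k - Z.1 (k.succAbove i) ∈ hitSet ε (Z.2 k - Z.2 (k.succAbove i))} :=
    measurableSet_hitSet measurable_const (by fun_prop) (by fun_prop)
  calc _ = ∫⁻ V : Fin (n + 1) → Euc d, ∫⁻ X : Fin n → Euc d,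
        ∫⁻ y in hitSet ε (V k - V (k.succAbove i)), F (k.insertNth (X i + y) X, V) := by
        rw [← lintegral_indicator hS, Measure.volume_eq_prod,
          lintegral_prod_symm' _ (hF.indicator hS)]
        refine lintegral_congr fun V => ?_
        have hm : Measurable fun X : Fin (n + 1) → Euc d => {Z : Config d (n + 1) |
            Z.1 k - Z.1 (k.succAbove i) ∈ hitSet ε (Z.2 k - Z.2 (k.succAbove i))}.indicator F
            (X, V) := (hF.indicator hS).comp (by fun_prop)
        rw [lintegral_insertNth k hm]
        refine lintegral_congr fun X => ?_
        rw [← lintegral_add_left_eq_self _ (X i), ← lintegral_indicator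
          (measurableSet_hitSet_right _ _)]
        refine lintegral_congr fun y => ?_
        by_cases hy : y ∈ hitSet ε (V k - V (k.succAbove i))
        · rw [Set.indicator_of_mem hy, Set.indicator_of_mem (by simpa using hy)]
        · rw [Set.indicator_of_notMem hy, Set.indicator_of_notMem (by simpa using hy)]
    _ = ∫⁻ V : Fin (n + 1) → Euc d, ∫⁻ X : Fin n → Euc d, ENNReal.ofReal (ε ^ (d - 1)) *
        ∫⁻ ω, ∫⁻ u in Set.Ioi (0 : ℝ),
        ENNReal.ofReal (max (-inner ℝ (ω : Euc d) (V k - V (k.succAbove i))) 0) *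
          F (k.insertNth (X i + (ε • (ω : Euc d) - u • (V k - V (k.succAbove i)))) X, V)
          ∂volume ∂sphereMeasure d := by
        refine lintegral_congr fun V => lintegral_congr fun X => ?_
        rw [lintegral_flux hε _ (f := fun y => F (k.insertNth (X i + y) X, V)) (by fun_prop)]
    _ = ENNReal.ofReal (ε ^ (d - 1)) * ∫⁻ V : Fin (n + 1) → Euc d, ∫⁻ X : Fin n → Euc d,
        ∫⁻ ω, ∫⁻ u in Set.Ioi (0 : ℝ),
        ENNReal.ofReal (max (-inner ℝ (ω : Euc d) (V k - V (k.succAbove i))) 0) *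
          F (k.insertNth (X i + (ε • (ω : Euc d) - u • (V k - V (k.succAbove i)))) X, V)
          ∂volume ∂sphereMeasure d := by
        rw [← lintegral_const_mul]
        · refine lintegral_congr fun V => ?_
          rw [lintegral_const_mul]
          refine Measurable.lintegral_prod_right (Measurable.lintegral_prod_right ?_)
          fun_prop
        · refine Measurable.lintegral_prod_right (Measurable.lintegral_prod_right
            (Measurable.lintegral_prod_right ?_))
          fun_prop
    _ = ENNReal.ofReal (ε ^ (d - 1)) * ∫⁻ V : Fin (n + 1) → Euc d,
        ∫⁻ ω, ∫⁻ u in Set.Ioi (0 : ℝ), ∫⁻ X : Fin n → Euc d,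
        ENNReal.ofReal (max (-inner ℝ (ω : Euc d) (V k - V (k.succAbove i))) 0) *
          F (k.insertNth (X i + (ε • (ω : Euc d) - u • (V k - V (k.succAbove i)))) X, V)
          ∂volume ∂volume ∂sphereMeasure d := by
        congr 1
        refine lintegral_congr fun V => ?_
        rw [lintegral_lintegral_swap]
        · refine lintegral_congr fun ω => ?_
          rw [lintegral_lintegral_swap]
          refine Measurable.aemeasurable ?_
          unfold Function.uncurry
          fun_prop
        · refine Measurable.aemeasurable (Measurable.lintegral_prod_right ?_)
          unfold Function.uncurry
          fun_prop
    _ = ENNReal.ofReal (ε ^ (d - 1)) * ∫⁻ V : Fin (n + 1) → Euc d,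
        ∫⁻ ω, ∫⁻ u in Set.Ioi (0 : ℝ), ∫⁻ X : Fin n → Euc d,
        ENNReal.ofReal (max (-inner ℝ (ω : Euc d) (V k - V (k.succAbove i))) 0) *
          F (freeFlow (-u) (contactPos ε k i (ω : Euc d) X, V))
          ∂volume ∂volume ∂sphereMeasure d := by
        congr 1
        refine lintegral_congr fun V => lintegral_congr fun ω => lintegral_congr fun u => ?_
        -- Moving the other particles along their velocities makes X their positions at the
        -- collision instead of at the start.
        rw [← lintegral_sub_right_eq_self _ (u • fun l => V (k.succAbove l))]
        refine lintegral_congr fun X => ?_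
        congr 2
        ext1
        · funext l
          rcases Fin.eq_self_or_eq_succAbove k l with rfl | ⟨m, rfl⟩
          · simp only [Fin.insertNth_apply_same, freeFlow, contactPos_same, Pi.sub_apply,
              Pi.smul_apply]
            module
          · simp only [Fin.insertNth_apply_succAbove, freeFlow, contactPos_succAbove, Pi.sub_apply,
              Pi.smul_apply]
            module
        · rfl
    _ = _ := by
        congr 1
        rw [lintegral_lintegral_swap]
        · refine lintegral_congr fun ω => ?_
          rw [lintegral_lintegral_swap]
          refine Measurable.aemeasurable (Measurable.lintegral_prod_right ?_)
          unfold Function.uncurry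
          fun_prop
        · refine Measurable.aemeasurable (Measurable.lintegral_prod_right
            (Measurable.lintegral_prod_right ?_))
          unfold Function.uncurry
          fun_prop

end ConfigFlux

/-! ### Contacts, and the motion during a short time with at most one collision -/

section Pair

variable {d : ℕ} {N : ℕ}

/-- The pair `(j, k)` collides before the time `δ` if it moves freely. -/
def pairHit (ε δ : ℝ) (j k : Fin N) : Set (Config d N) :=
  {Z | Z.1 k - Z.1 j ∈ hitSet ε (Z.2 k - Z.2 j) ∧ hitTime ε (Z.1 k - Z.1 j) (Z.2 k - Z.2 j) < δ}

lemma measurableSet_pairHit (ε δ : ℝ) (j k : Fin N) :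
    MeasurableSet (pairHit (d := d) ε δ j k) := by
  refine (measurableSet_hitSet measurable_const (by fun_prop) (by fun_prop)).inter
    (measurableSet_lt (measurable_hitTime measurable_const ?_ ?_) measurable_const) <;> fun_prop

lemma freeFlow_rel (u : ℝ) (Z : Config d N) (j k : Fin N) :
    (freeFlow u Z).1 k - (freeFlow u Z).1 j = (Z.1 k - Z.1 j) + u • (Z.2 k - Z.2 j) := by
  simp only [freeFlow]
  module

@[simp] lemma freeFlow_snd (u : ℝ) (Z : Config d N) : (freeFlow u Z).2 = Z.2 := rfl

lemma pairCollision_rel {ε : ℝ} {j k : Fin N} (hjk : j ≠ k) (Z : Config d N) :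
    (pairCollision ε j k Z).2 k - (pairCollision ε j k Z).2 j =
      (Z.2 k - Z.2 j) - (2 / ε ^ 2 * inner ℝ (Z.1 k - Z.1 j) (Z.2 k - Z.2 j)) •
        (Z.1 k - Z.1 j) := by
  have h : inner ℝ (Z.2 j - Z.2 k) (Z.1 j - Z.1 k) = inner ℝ (Z.1 k - Z.1 j) (Z.2 k - Z.2 j) := by
    rw [real_inner_comm, ← neg_sub (Z.1 k), ← neg_sub (Z.2 k), inner_neg_neg]
  simp only [pairCollision, if_true, if_neg hjk.symm, h]
  module

lemma inner_pairCollision_rel {ε : ℝ} (hε : 0 < ε) {j k : Fin N} (hjk : j ≠ k) {Z : Config d N}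
    (hZ : ‖Z.1 k - Z.1 j‖ = ε) :
    inner ℝ (Z.1 k - Z.1 j) ((pairCollision ε j k Z).2 k - (pairCollision ε j k Z).2 j) =
      - inner ℝ (Z.1 k - Z.1 j) (Z.2 k - Z.2 j) := by
  rw [pairCollision_rel hjk, inner_sub_right, inner_smul_right, real_inner_self_eq_norm_sq, hZ]
  field_simp
  ring

lemma pairCollision_eq_self {ε : ℝ} {j k : Fin N} {Z : Config d N}
    (h : inner ℝ (Z.1 k - Z.1 j) (Z.2 k - Z.2 j) = 0) : pairCollision ε j k Z = Z := by
  have h : inner ℝ (Z.2 j - Z.2 k) (Z.1 j - Z.1 k) = 0 := by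
    rw [real_inner_comm, ← neg_sub (Z.1 k), ← neg_sub (Z.2 k), inner_neg_neg, h]
  ext1
  · rfl
  · funext l
    simp only [pairCollision, h]
    split_ifs with h1 h2 <;> simp_all

lemma hitTime_mul_add {r : ℝ} {y w : Euc d} (h : 0 < disc r y w) :
    inner ℝ y w + hitTime r y w * ‖w‖ ^ 2 = -√(disc r y w) := by
  have hw := disc_pos_ne_zero h
  have hw' : 0 < ‖w‖ ^ 2 := by positivity
  rw [hitTime]; field_simp; ring

lemma norm_gt_of_lt_hitTime {r : ℝ} (hr : 0 ≤ r) {y w : Euc d} (h : 0 < disc r y w) {u : ℝ}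
    (hu : u < hitTime r y w) : r < ‖y + u • w‖ := by
  have hw := disc_pos_ne_zero h
  have hw' : 0 < ‖w‖ ^ 2 := by positivity
  have h1 := hitTime_mul_add h
  have h2 := Real.sq_sqrt h.le
  have h3 : 0 < √(disc r y w) := Real.sqrt_pos.2 h
  have h4 : u * ‖w‖ ^ 2 < hitTime r y w * ‖w‖ ^ 2 := by gcongr
  have h5 : disc r y w < (inner ℝ y w + u * ‖w‖ ^ 2) ^ 2 := by
    rw [← h2]; nlinarith
  rw [← sq_lt_sq₀ hr (norm_nonneg _), norm_add_smul_sq]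
  rw [disc] at h5
  have : ‖w‖ ^ 2 * r ^ 2 < ‖w‖ ^ 2 *
      (‖y‖ ^ 2 + 2 * u * inner ℝ y w + u ^ 2 * ‖w‖ ^ 2) := by linarith
  exact lt_of_mul_lt_mul_left this hw'.le

/-- With b = `inner y w` and a = ‖w‖², the assumption at time u says that |b + ua| ≤ √D and that u
is not the smaller root. Since y is outside the ball, √D < |b|, so the two roots have the same sign;
a nonnegative b would give b + ua > √D. Hence both roots are positive and the smaller one precedes
u. -/
lemma mem_hitSet_of_norm_le {r : ℝ} (hr : 0 ≤ r) {y w : Euc d} (hy : r < ‖y‖) {u : ℝ} (hu : 0 < u)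
    (h : ‖y + u • w‖ < r ∨ (‖y + u • w‖ = r ∧ 0 < inner ℝ (y + u • w) w)) :
    y ∈ hitSet r w ∧ hitTime r y w < u := by
  have hw : w ≠ 0 := by
    rintro rfl
    rcases h with h | h
    · simp at h; linarith
    · simp at h
  have hw' : 0 < ‖w‖ ^ 2 := by positivity
  have h1 := norm_add_smul_sq y w u
  have h6 : r ^ 2 < ‖y‖ ^ 2 := by rwa [sq_lt_sq₀ hr (norm_nonneg _)]
  have h2 : disc r y w = (inner ℝ y w + u * ‖w‖ ^ 2) ^ 2 +
      ‖w‖ ^ 2 * (r ^ 2 - ‖y + u • w‖ ^ 2) := by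
    rw [disc, h1]; ring
  have h7 : ‖w‖ ^ 2 * (‖y‖ ^ 2 - r ^ 2) = inner ℝ y w ^ 2 - disc r y w := by rw [disc]; ring
  have h8 : 0 < ‖w‖ ^ 2 * (‖y‖ ^ 2 - r ^ 2) := mul_pos hw' (by linarith)
  rw [inner_add_smul_self] at h
  set b := inner ℝ y w
  set a := ‖w‖ ^ 2
  set D := disc r y w
  have hD : 0 < D ∧ -√D < b + u * a ∧ |b + u * a| ≤ √D := by
    rcases h with h | ⟨h, h'⟩
    · have h9 : ‖y + u • w‖ ^ 2 < r ^ 2 := by rwa [sq_lt_sq₀ (norm_nonneg _) hr]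
      have h10 : (b + u * a) ^ 2 < D := by nlinarith
      have h11 : |b + u * a| < √D := abs_lt_of_sq_lt_sq
        (by rwa [Real.sq_sqrt (lt_of_le_of_lt (sq_nonneg _) h10).le]) (Real.sqrt_nonneg _)
      exact ⟨lt_of_le_of_lt (sq_nonneg _) h10, (abs_lt.1 h11).1, h11.le⟩
    · rw [h, sub_self, mul_zero, add_zero] at h2
      rw [h2, Real.sqrt_sq h'.le, abs_of_pos h']
      exact ⟨by positivity, by linarith, le_rfl⟩
  obtain ⟨hD0, hD1, hD2⟩ := hD
  have h12 : √D < |b| := by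
    apply Real.lt_sqrt_of_sq_lt _ |>.trans_eq (Real.sqrt_sq_eq_abs b)
    rw [Real.sq_sqrt hD0.le]; linarith
  have hb : b < 0 := by
    by_contra! hb
    rw [abs_of_nonneg hb] at h12
    have := (abs_le.1 hD2).2
    nlinarith [mul_pos hu hw']
  rw [abs_of_neg hb] at h12
  refine ⟨⟨hD0, ?_⟩, ?_⟩
  · rw [hitTime]
    apply div_pos _ hw'
    linarith
  · rw [hitTime, div_lt_iff₀ hw']
    linarith

lemma norm_lt_after_hit {r : ℝ} (hr : 0 < r) {y w : Euc d} (h : 0 < disc r y w) {δ : ℝ}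
    (hδ : hitTime r y w < δ) : ∃ u, hitTime r y w < u ∧ u < δ ∧ ‖y + u • w‖ < r := by
  obtain ⟨h1, h2⟩ := (hit_iff hr.le (y := y) (w := w)).2 ⟨h, rfl⟩
  have hw := disc_pos_ne_zero h
  have hw' : 0 < ‖w‖ ^ 2 := by positivity
  set τ := hitTime r y w
  set c := inner ℝ (y + τ • w) w
  -- At time τ + η the squared distance is r² + 2cη + η²‖w‖² with c < 0; the condition η‖w‖² ≤ -c
  -- lets the linear term win.
  set η := min ((δ - τ) / 2) (-c / ‖w‖ ^ 2) with hη
  have hη0 : 0 < η := lt_min (by linarith) (div_pos (by linarith) hw')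
  have hη1 : η ≤ (δ - τ) / 2 := min_le_left _ _
  have hη2 : η * ‖w‖ ^ 2 ≤ -c := by
    have : η ≤ -c / ‖w‖ ^ 2 := min_le_right _ _
    rwa [le_div_iff₀ hw'] at this
  refine ⟨τ + η, by linarith, by linarith, ?_⟩
  rw [← sq_lt_sq₀ (norm_nonneg _) hr.le, add_smul, ← add_assoc, norm_add_smul_sq, h1]
  nlinarith

/-- The motion during the time `δ` of a configuration in which exactly the pair `(j, k)`
collides. -/
def pairStep (ε δ : ℝ) (j k : Fin N) (Z : Config d N) : Config d N :=
  freeFlow (δ - hitTime ε (Z.1 k - Z.1 j) (Z.2 k - Z.2 j))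
    (pairCollision ε j k (freeFlow (hitTime ε (Z.1 k - Z.1 j) (Z.2 k - Z.2 j)) Z))

lemma measurable_pairStep (ε δ : ℝ) (j k : Fin N) : Measurable (pairStep (d := d) ε δ j k) := by
  have h : Measurable fun Z : Config d N => hitTime ε (Z.1 k - Z.1 j) (Z.2 k - Z.2 j) :=
    measurable_hitTime measurable_const (by fun_prop) (by fun_prop)
  unfold pairStep
  fun_prop

lemma hit_contact {ε : ℝ} (hε : 0 < ε) {ω w : Euc d} (hω : ‖ω‖ = 1)
    (h : inner ℝ ω w < 0) {u : ℝ} (hu : 0 < u) :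
    ε • ω - u • w ∈ hitSet ε w ∧ hitTime ε (ε • ω - u • w) w = u := by
  have h1 : ε • ω - u • w + u • w = ε • ω := by module
  have h2 := (hit_iff hε.le (y := ε • ω - u • w) (w := w) (u := u)).1
    ⟨by rw [h1, norm_smul, hω, Real.norm_eq_abs, abs_of_pos hε, mul_one],
     by rw [h1, inner_smul_left, conj_trivial]; exact mul_neg_of_pos_of_neg hε h⟩
  exact ⟨⟨h2.1, h2.2 ▸ hu⟩, h2.2.symm⟩

/-- The two-body step preserves Lebesgue measure. -/
theorem lintegral_pairStep [NeZero d] {ε δ : ℝ} (hε : 0 < ε) {j k : Fin N} (hjk : j ≠ k)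
    {F : Config d N → ℝ≥0∞} (hF : Measurable F) :
    ∫⁻ Z in pairHit ε δ j k, F (pairStep ε δ j k Z) =
      ∫⁻ Z in rev ⁻¹' pairHit ε δ j k, F Z := by
  obtain ⟨n, rfl⟩ : ∃ n, N = n + 1 := Nat.exists_eq_succ_of_ne_zero (by
    rintro rfl; exact j.elim0)
  obtain ⟨i, rfl⟩ := Fin.exists_succAbove_eq hjk
  set S : Set (Config d (n + 1)) :=
    {Z | Z.1 k - Z.1 (k.succAbove i) ∈ hitSet ε (Z.2 k - Z.2 (k.succAbove i))} with hS
  set P : Set (Config d (n + 1)) := pairHit ε δ (k.succAbove i) k with hP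
  have hPm : MeasurableSet P := measurableSet_pairHit ε δ _ k
  have hSm : MeasurableSet S :=
    measurableSet_hitSet measurable_const (by fun_prop) (by fun_prop)
  have hPS : P ⊆ S := fun Z hZ => hZ.1
  -- In flux coordinates the set of colliding configurations is simply given by u < δ.
  have key : ∀ G : Config d (n + 1) → ℝ≥0∞, Measurable G →
      ∫⁻ Z in P, G Z = ENNReal.ofReal (ε ^ (d - 1)) * ∫⁻ ω, ∫⁻ u in Set.Ioo (0 : ℝ) δ,
        ∫⁻ V : Fin (n + 1) → Euc d, ∫⁻ X : Fin n → Euc d,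
        ENNReal.ofReal (max (-inner ℝ (ω : Euc d) (V k - V (k.succAbove i))) 0) *
          G (freeFlow (-u) (contactPos ε k i (ω : Euc d) X, V))
          ∂volume ∂volume ∂volume ∂sphereMeasure d := by
    intro G hG
    have h1 := lintegral_config_flux hε k i (hG.indicator hPm)
    rw [setLIntegral_indicator hPm, Set.inter_eq_left.2 hPS] at h1
    rw [h1]
    congr 1
    refine lintegral_congr fun ω => ?_
    rw [← lintegral_indicator measurableSet_Ioi, ← lintegral_indicator measurableSet_Ioo]
    refine lintegral_congr fun u => ?_
    by_cases hu : 0 < u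
    · rw [Set.indicator_of_mem (Set.mem_Ioi.2 hu)]
      have h2 : ∀ V : Fin (n + 1) → Euc d, ∀ X : Fin n → Euc d,
          inner ℝ (ω : Euc d) (V k - V (k.succAbove i)) < 0 →
          (freeFlow (-u) (contactPos ε k i (ω : Euc d) X, V) ∈ P ↔ u < δ) := by
        intro V X hin
        obtain ⟨h3, h4⟩ := hit_contact hε (by simp) hin hu
        have h5 := freeFlow_rel (-u) (contactPos ε k i (ω : Euc d) X, V) (k.succAbove i) k
        simp only [contactPos_sub, neg_smul, ← sub_eq_add_neg] at h5
        simp only [hP, pairHit, Set.mem_ofPred_eq, h5, freeFlow_snd, h4]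
        exact ⟨fun h => h.2, fun h => ⟨h3, h⟩⟩
      by_cases hu2 : u < δ
      · rw [Set.indicator_of_mem (Set.mem_Ioo.2 ⟨hu, hu2⟩)]
        refine lintegral_congr fun V => lintegral_congr fun X => ?_
        by_cases hin : inner ℝ (ω : Euc d) (V k - V (k.succAbove i)) < 0
        · rw [Set.indicator_of_mem ((h2 V X hin).2 hu2)]
        · rw [max_eq_right (by linarith)]
          simp
      · rw [Set.indicator_of_notMem (fun h => hu2 h.2)]
        have h3 : ∀ V : Fin (n + 1) → Euc d, ∀ X : Fin n → Euc d,
            ENNReal.ofReal (max (-inner ℝ (ω : Euc d) (V k - V (k.succAbove i))) 0) *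
            P.indicator G (freeFlow (-u) (contactPos ε k i (ω : Euc d) X, V)) = 0 := by
          intro V X
          by_cases hin : inner ℝ (ω : Euc d) (V k - V (k.succAbove i)) < 0
          · rw [Set.indicator_of_notMem (fun h => hu2 ((h2 V X hin).1 h)), mul_zero]
          · rw [max_eq_right (by linarith)]
            simp
        simp only [h3, lintegral_zero]
    · rw [Set.indicator_of_notMem (by simpa using hu),
        Set.indicator_of_notMem (fun h => hu h.1)]
  have hrev : ∫⁻ Z in rev ⁻¹' P, F Z = ∫⁻ Z in P, F (rev Z) := by
    have := (measurePreserving_rev (d := d) (N := n + 1)).setLIntegral_comp_preimage hPm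
      (f := fun Z => F (rev Z)) (by fun_prop)
    simpa using this
  have hmeas := measurable_pairStep (d := d) ε δ (k.succAbove i) k
  rw [hrev, key (fun Z => F (pairStep ε δ (k.succAbove i) k Z)) (hF.comp hmeas), key (fun Z => F (rev Z)) (by fun_prop)]
  congr 1
  refine lintegral_congr fun ω => ?_
  have hω : ‖(ω : Euc d)‖ = 1 := by simp
  have hne : k.succAbove i ≠ k := Fin.succAbove_ne k i
  -- Both sides are integrals over (0, δ) of this function. The step replaces u by δ - u and
  -- scatters the velocities, which changes the sign of the impact factor just as velocity reversal
  -- does; the symmetry u ↦ δ - u then matches the two integrals.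
  set g : ℝ → ℝ≥0∞ := fun u => ∫⁻ V : Fin (n + 1) → Euc d, ∫⁻ X : Fin n → Euc d,
    ENNReal.ofReal (max (inner ℝ (ω : Euc d) (V k - V (k.succAbove i))) 0) *
      F (freeFlow u (contactPos ε k i (ω : Euc d) X, V)) with hg
  have e1 : ∀ u ∈ Set.Ioo (0 : ℝ) δ, (∫⁻ V : Fin (n + 1) → Euc d, ∫⁻ X : Fin n → Euc d,
        ENNReal.ofReal (max (-inner ℝ (ω : Euc d) (V k - V (k.succAbove i))) 0) *
          F (pairStep ε δ (k.succAbove i) k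
            (freeFlow (-u) (contactPos ε k i (ω : Euc d) X, V)))) = g (δ - u) := by
    intro u hu
    have hm : Measurable fun V : Fin (n + 1) → Euc d => ∫⁻ X : Fin n → Euc d,
        ENNReal.ofReal (max (inner ℝ (ω : Euc d) (V k - V (k.succAbove i))) 0) *
          F (freeFlow (δ - u) (contactPos ε k i (ω : Euc d) X, V)) := by
      refine Measurable.lintegral_prod_right ?_
      unfold Function.uncurry
      fun_prop
    simp only [hg]
    rw [← (measurePreserving_scatter hne hω).lintegral_comp hm]
    refine lintegral_congr fun V => lintegral_congr fun X => ?_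
    have h3 := inner_scatter hne hω V
    rw [real_inner_comm, ← neg_sub (scatter _ _ _ _ k), ← neg_sub (V k), inner_neg_right,
      inner_neg_left, neg_neg, neg_eq_iff_eq_neg, real_inner_comm (ω : Euc d)] at h3
    rw [h3]
    by_cases hin : inner ℝ (ω : Euc d) (V k - V (k.succAbove i)) < 0
    · obtain ⟨h4, h5⟩ := hit_contact hε hω hin hu.1
      have h6 := freeFlow_rel (-u) (contactPos ε k i (ω : Euc d) X, V) (k.succAbove i) k
      simp only [contactPos_sub, neg_smul, ← sub_eq_add_neg] at h6
      simp only [pairStep, h6, freeFlow_snd, h5, freeFlow_add, add_neg_cancel,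
        freeFlow_zero, pairCollision_contactPos hε]
    · rw [max_eq_right (by linarith)]
      simp
  have e2 : ∀ u, (∫⁻ V : Fin (n + 1) → Euc d, ∫⁻ X : Fin n → Euc d,
        ENNReal.ofReal (max (-inner ℝ (ω : Euc d) (V k - V (k.succAbove i))) 0) *
          F (rev (freeFlow (-u) (contactPos ε k i (ω : Euc d) X, V)))) = g u := by
    intro u
    have hm : Measurable fun V : Fin (n + 1) → Euc d => ∫⁻ X : Fin n → Euc d,
        ENNReal.ofReal (max (inner ℝ (ω : Euc d) (V k - V (k.succAbove i))) 0) *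
          F (freeFlow u (contactPos ε k i (ω : Euc d) X, V)) := by
      refine Measurable.lintegral_prod_right ?_
      unfold Function.uncurry
      fun_prop
    simp only [hg]
    rw [← (measurePreserving_involution (N := n + 1) (d := d) (L := -LinearMap.id)
      (LinearMap.ext fun V => by simp)).lintegral_comp hm]
    refine lintegral_congr fun V => lintegral_congr fun X => ?_
    have h7 : (-V) k - (-V) (k.succAbove i) = -(V k - V (k.succAbove i)) := by
      simp only [Pi.neg_apply]; abel
    simp only [LinearMap.neg_apply, LinearMap.id_apply, rev_freeFlow, neg_neg, h7,
      inner_neg_right]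
    rfl
  rw [setLIntegral_congr_fun measurableSet_Ioo e1, setLIntegral_congr_fun measurableSet_Ioo
    (fun u _ => e2 u), ← lintegral_indicator measurableSet_Ioo,
    ← lintegral_indicator measurableSet_Ioo, ← lintegral_sub_left_eq_self _ δ]
  refine lintegral_congr fun u => ?_
  have : δ - u ∈ Set.Ioo 0 δ ↔ u ∈ Set.Ioo 0 δ := by
    simp only [Set.mem_Ioo, sub_pos, sub_lt_self_iff]
    exact and_comm
  by_cases hu : u ∈ Set.Ioo 0 δ
  · rw [Set.indicator_of_mem (this.2 hu), Set.indicator_of_mem hu, sub_sub_cancel]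
  · rw [Set.indicator_of_notMem (fun h => hu (this.1 h)), Set.indicator_of_notMem hu]

end Pair

/-! ### Contacts of pairs and contacts with the wall, treated uniformly -/

section Contacts

variable {d : ℕ} [NeZero d] {N : ℕ}

@[simp] lemma norm_e₁ : ‖e₁ d‖ = 1 := by simp [e₁]

lemma inner_e₁_e₁ : inner ℝ (e₁ d) (e₁ d) = (1 : ℝ) := by
  rw [real_inner_self_eq_norm_sq, norm_e₁, one_pow]

/-- The particle `l` reaches the wall before the time `δ` if it moves freely. -/
def wallHit (ε δ : ℝ) (l : Fin N) : Set (Config d N) :=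
  {Z | ε / 2 < inner ℝ (Z.1 l) (e₁ d) ∧
    inner ℝ (Z.1 l) (e₁ d) + δ * inner ℝ (Z.2 l) (e₁ d) < ε / 2}

/-- The time at which the particle `l` reaches the wall. -/
def wallTime (ε : ℝ) (l : Fin N) (Z : Config d N) : ℝ :=
  (inner ℝ (Z.1 l) (e₁ d) - ε / 2) / -inner ℝ (Z.2 l) (e₁ d)

/-- The possible contacts between `N` particles and the wall: pairs, and particles at the wall. -/
abbrev Contact (N : ℕ) : Type := {p : Fin N × Fin N // p.1 < p.2} ⊕ Fin N

/-- The distance to a contact. -/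
def gap (ε : ℝ) : Contact N → (Fin N → Euc d) → ℝ
  | .inl p, X => ‖X p.1.1 - X p.1.2‖ - ε
  | .inr l, X => inner ℝ (X l) (e₁ d) - ε / 2

/-- The effect of a contact on the velocities. -/
def collide (ε : ℝ) : Contact N → Config d N → Config d N
  | .inl p, Z => pairCollision ε p.1.1 p.1.2 Z
  | .inr l, Z => wallReflection l Z

/-- The contact takes place, transversally, before the time `δ` if the motion is free. -/
def hit (ε δ : ℝ) : Contact N → Set (Config d N)
  | .inl p => pairHit ε δ p.1.1 p.1.2
  | .inr l => wallHit ε δ l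

/-- The time of the contact if the motion is free. -/
def contactTime (ε : ℝ) : Contact N → Config d N → ℝ
  | .inl p, Z => hitTime ε (Z.1 p.1.2 - Z.1 p.1.1) (Z.2 p.1.2 - Z.2 p.1.1)
  | .inr l, Z => wallTime ε l Z

/-- The motion during the time `δ` when the given contact takes place. -/
def hitStep (ε δ : ℝ) (c : Contact N) (Z : Config d N) : Config d N :=
  freeFlow (δ - contactTime ε c Z) (collide ε c (freeFlow (contactTime ε c Z) Z))

lemma mem_phaseSpace_iff {ε : ℝ} {Z : Config d N} :
    Z ∈ phaseSpace d N ε ↔ ∀ c, 0 ≤ gap ε c Z.1 := by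
  constructor
  · rintro ⟨h1, h2⟩ (⟨p, hp⟩ | l)
    · exact sub_nonneg.2 (h2 _ _ hp)
    · exact sub_nonneg.2 (h1 l)
  · intro h
    exact ⟨fun l => sub_nonneg.1 (h (.inr l)), fun j k hjk => sub_nonneg.1 (h (.inl ⟨(j, k), hjk⟩))⟩

lemma noContact_iff {ε : ℝ} {Z : Config d N} : NoContact ε Z ↔ ∀ c, 0 < gap ε c Z.1 := by
  constructor
  · rintro ⟨h1, h2⟩ (⟨p, hp⟩ | l)
    · exact sub_pos.2 (h2 _ _ hp)
    · exact sub_pos.2 (h1 l)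
  · intro h
    exact ⟨fun l => sub_pos.1 (h (.inr l)), fun j k hjk => sub_pos.1 (h (.inl ⟨(j, k), hjk⟩))⟩

/-- The contact `c` takes place and there is no other one. -/
def OnlyContact (ε : ℝ) (c : Contact N) (Z : Config d N) : Prop :=
  gap ε c Z.1 = 0 ∧ ∀ c', c' ≠ c → 0 < gap ε c' Z.1

lemma eventRule_iff {ε : ℝ} {Z Z' : Config d N} :
    EventRule ε Z Z' ↔
      (NoContact ε Z ∧ Z' = Z) ∨ ∃ c, OnlyContact ε c Z ∧ Z' = collide ε c Z := by
  have hp : ∀ j k (hjk : j < k), PairContact ε j k Z ↔ OnlyContact ε (.inl ⟨(j, k), hjk⟩) Z := by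
    intro j k hjk
    constructor
    · rintro ⟨-, h1, h2, h3⟩
      refine ⟨sub_eq_zero.2 h1, ?_⟩
      rintro (⟨p, hp⟩ | l) hne
      · exact sub_pos.2 (h3 _ _ hp (fun h => hne (by congr 2)))
      · exact sub_pos.2 (h2 l)
    · rintro ⟨h1, h2⟩
      refine ⟨hjk, sub_eq_zero.1 h1, fun l => sub_pos.1 (h2 (.inr l) (by simp)), ?_⟩
      intro j' k' hjk' hne
      exact sub_pos.1 (h2 (.inl ⟨(j', k'), hjk'⟩) (by simpa using hne))
  have hw : ∀ l, WallContact ε l Z ↔ OnlyContact ε (.inr l) Z := by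
    intro l
    constructor
    · rintro ⟨h1, h2, h3⟩
      refine ⟨sub_eq_zero.2 h1, ?_⟩
      rintro (⟨p, hp⟩ | m) hne
      · exact sub_pos.2 (h3 _ _ hp)
      · exact sub_pos.2 (h2 m (fun h => hne (by rw [h])))
    · rintro ⟨h1, h2⟩
      refine ⟨sub_eq_zero.1 h1, fun m hm => sub_pos.1 (h2 (.inr m) (by simpa using hm)), ?_⟩
      intro j' k' hjk'
      exact sub_pos.1 (h2 (.inl ⟨(j', k'), hjk'⟩) (by simp))
  constructor
  · rintro (h | ⟨j, k, h, h'⟩ | ⟨l, h, h'⟩)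
    · exact .inl h
    · exact .inr ⟨.inl ⟨(j, k), h.1⟩, (hp j k h.1).1 h, h'⟩
    · exact .inr ⟨.inr l, (hw l).1 h, h'⟩
  · rintro (h | ⟨⟨p, hpp⟩ | l, h, h'⟩)
    · exact .inl h
    · exact .inr (.inl ⟨_, _, (hp _ _ hpp).2 h, h'⟩)
    · exact .inr (.inr ⟨l, (hw l).2 h, h'⟩)

@[simp] lemma collide_fst (ε : ℝ) (c : Contact N) (Z : Config d N) : (collide ε c Z).1 = Z.1 := by
  rcases c with p | l <;> rfl

@[simp] lemma wallReflection_fst (l : Fin N) (Z : Config d N) :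
    (wallReflection l Z).1 = Z.1 := rfl

lemma wallReflection_snd_self (l : Fin N) (Z : Config d N) :
    (wallReflection l Z).2 l = Z.2 l - (2 * inner ℝ (Z.2 l) (e₁ d)) • e₁ d := by
  simp [wallReflection]

lemma inner_wallReflection (l : Fin N) (Z : Config d N) :
    inner ℝ ((wallReflection l Z).2 l) (e₁ d) = - inner ℝ (Z.2 l) (e₁ d) := by
  rw [wallReflection_snd_self, inner_sub_left, inner_smul_left, inner_e₁_e₁, conj_trivial]
  ring

lemma norm_reflect_sq (v : Euc d) :
    ‖v - (2 * inner ℝ v (e₁ d)) • e₁ d‖ ^ 2 = ‖v‖ ^ 2 := by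
  rw [norm_sub_sq_real, inner_smul_right, norm_smul, norm_e₁, Real.norm_eq_abs, mul_one, sq_abs]
  ring

lemma sum_collide {ε : ℝ} (hε : 0 < ε) (c : Contact N) {Z : Config d N} (h : gap ε c Z.1 = 0) :
    ∑ l, ‖(collide ε c Z).2 l‖ ^ 2 = ∑ l, ‖Z.2 l‖ ^ 2 := by
  rw [← sub_eq_zero, ← Finset.sum_sub_distrib]
  rcases c with ⟨⟨j, k⟩, hjk⟩ | l
  · have hn : ‖Z.1 j - Z.1 k‖ = ε := sub_eq_zero.1 h
    have hjk : j < k := hjk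
    rw [Finset.sum_eq_add (a := j) (b := k) hjk.ne]
    · simp only [collide, pairCollision, if_true, if_neg hjk.ne']
      set n := Z.1 j - Z.1 k
      rw [norm_sub_sq_real, norm_add_sq_real, inner_smul_right, inner_smul_right, norm_smul, hn,
        Real.norm_eq_abs, mul_pow, sq_abs, inner_sub_left]
      field_simp
      ring
    · rintro l - ⟨h1, h2⟩
      simp [collide, pairCollision, h1, h2]
    · simp
    · simp
  · rw [Finset.sum_eq_single l]
    · simp only [collide, wallReflection_snd_self, norm_reflect_sq, sub_self]
    · intro m _ hm
      simp [collide, wallReflection, hm]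
    · simp

lemma famNorm_collide {ε : ℝ} (hε : 0 < ε) (c : Contact N) {Z : Config d N}
    (h : gap ε c Z.1 = 0) : famNorm (collide ε c Z).2 = famNorm Z.2 := by
  rw [famNorm, famNorm, sum_collide hε c h]

lemma collide_rev_collide {ε : ℝ} (hε : 0 < ε) (c : Contact N) {Z : Config d N}
    (h : gap ε c Z.1 = 0) : collide ε c (rev (collide ε c Z)) = rev Z := by
  rcases c with ⟨⟨j, k⟩, hjk⟩ | l
  · have hn : ‖Z.1 j - Z.1 k‖ = ε := sub_eq_zero.1 h
    have hjk : j < k := hjk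
    ext1
    · rfl
    funext m
    have h1 : inner ℝ (-(Z.2 j - (1 / ε ^ 2 * inner ℝ (Z.2 j - Z.2 k) (Z.1 j - Z.1 k)) •
        (Z.1 j - Z.1 k)) - -(Z.2 k + (1 / ε ^ 2 * inner ℝ (Z.2 j - Z.2 k) (Z.1 j - Z.1 k)) •
        (Z.1 j - Z.1 k))) (Z.1 j - Z.1 k) = inner ℝ (Z.2 j - Z.2 k) (Z.1 j - Z.1 k) := by
      set n := Z.1 j - Z.1 k
      simp only [inner_sub_left, inner_neg_left, inner_add_left, inner_smul_left,
        real_inner_self_eq_norm_sq, hn, conj_trivial]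
      field_simp
      ring
    simp only [collide, pairCollision, rev_snd, rev_fst, Pi.neg_apply, if_true, if_neg hjk.ne', h1]
    split_ifs with h2 h3
    · subst h2; abel
    · subst h3; abel
    · rfl
  · ext1
    · rfl
    funext m
    by_cases hm : m = l
    · subst hm
      have h1 := wallReflection_snd_self m Z
      have h2 := inner_wallReflection m Z
      rw [h1] at h2
      simp only [collide, wallReflection_snd_self, rev_snd, Pi.neg_apply, inner_neg_left, h2]
      module
    · simp [collide, wallReflection, hm]

lemma abs_gap_sub_le (ε : ℝ) (c : Contact N) {X X' : Fin N → Euc d} {r : ℝ}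
    (h : ∀ l, ‖X l - X' l‖ ≤ r) : |gap ε c X - gap ε c X'| ≤ 2 * r := by
  rcases c with p | l
  · simp only [gap, sub_sub_sub_cancel_right]
    refine (abs_norm_sub_norm_le _ _).trans ?_
    have : X p.1.1 - X p.1.2 - (X' p.1.1 - X' p.1.2) =
      (X p.1.1 - X' p.1.1) - (X p.1.2 - X' p.1.2) := by abel
    rw [this]
    exact (norm_sub_le _ _).trans (by linarith [h p.1.1, h p.1.2])
  · simp only [gap, sub_sub_sub_cancel_right, ← inner_sub_left]
    refine (abs_real_inner_le_norm _ _).trans ?_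
    rw [norm_e₁, mul_one]
    linarith [h l, norm_nonneg (X l - X' l)]

lemma continuous_gap (ε : ℝ) (c : Contact N) : Continuous (gap (d := d) ε c) := by
  rcases c with p | l
  · exact (by fun_prop : Continuous fun X : Fin N → Euc d => ‖X p.1.1 - X p.1.2‖ - ε)
  · exact (by fun_prop : Continuous fun X : Fin N → Euc d => inner ℝ (X l) (e₁ d) - ε / 2)

lemma measurableSet_hit (ε δ : ℝ) (c : Contact N) : MeasurableSet (hit (d := d) ε δ c) := by
  rcases c with p | l
  · exact measurableSet_pairHit ε δ _ _
  · have h1 : Measurable fun Z : Config d N => inner ℝ (Z.1 l) (e₁ d) := by fun_prop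
    have h2 : Measurable fun Z : Config d N =>
      inner ℝ (Z.1 l) (e₁ d) + δ * inner ℝ (Z.2 l) (e₁ d) := by fun_prop
    exact (measurableSet_lt measurable_const h1).inter (measurableSet_lt h2 measurable_const)

lemma measurable_contactTime (ε : ℝ) (c : Contact N) : Measurable (contactTime (d := d) ε c) := by
  rcases c with p | l
  · exact measurable_hitTime measurable_const (by fun_prop) (by fun_prop)
  · exact (by fun_prop : Measurable fun Z : Config d N =>
      (inner ℝ (Z.1 l) (e₁ d) - ε / 2) / -inner ℝ (Z.2 l) (e₁ d))

lemma measurable_wallReflection (l : Fin N) : Measurable (wallReflection (d := d) l) := by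
  unfold wallReflection
  refine measurable_fst.prodMk (measurable_pi_lambda _ fun l => ?_)
  split_ifs <;> fun_prop

lemma measurable_collide (ε : ℝ) (c : Contact N) : Measurable (collide (d := d) ε c) := by
  rcases c with p | l
  · exact measurable_pairCollision _ _ _
  · exact measurable_wallReflection l

lemma measurable_hitStep (ε δ : ℝ) (c : Contact N) : Measurable (hitStep (d := d) ε δ c) := by
  unfold hitStep
  have := measurable_contactTime (d := d) ε c
  have := measurable_collide (d := d) ε c
  fun_prop

lemma inner_freeFlow_e₁ (u : ℝ) (Z : Config d N) (l : Fin N) :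
    inner ℝ ((freeFlow u Z).1 l) (e₁ d) =
      inner ℝ (Z.1 l) (e₁ d) + u * inner ℝ (Z.2 l) (e₁ d) := by
  simp [freeFlow, inner_add_left, inner_smul_left]

lemma gap_inl (ε : ℝ) (p : {p : Fin N × Fin N // p.1 < p.2}) (X : Fin N → Euc d) :
    gap ε (.inl p) X = ‖X p.1.2 - X p.1.1‖ - ε := by
  rw [norm_sub_rev]; rfl

lemma gap_inl_freeFlow (ε u : ℝ) (p : {p : Fin N × Fin N // p.1 < p.2}) (Z : Config d N) :
    gap ε (.inl p) (freeFlow u Z).1 =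
      ‖Z.1 p.1.2 - Z.1 p.1.1 + u • (Z.2 p.1.2 - Z.2 p.1.1)‖ - ε := by
  rw [gap_inl, freeFlow_rel]

lemma gap_inr_freeFlow (ε u : ℝ) (l : Fin N) (Z : Config d N) :
    gap ε (.inr l) (freeFlow u Z).1 =
      inner ℝ (Z.1 l) (e₁ d) + u * inner ℝ (Z.2 l) (e₁ d) - ε / 2 := by
  rw [gap, inner_freeFlow_e₁]

variable {ε δ : ℝ} {c : Contact N} {Z : Config d N}

lemma contactTime_mem (hδ : 0 < δ) (h : Z ∈ hit ε δ c) :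
    0 < contactTime ε c Z ∧ contactTime ε c Z < δ := by
  rcases c with p | l
  · exact ⟨h.1.2, h.2⟩
  · obtain ⟨h1, h2⟩ := h
    have h3 : inner ℝ (Z.2 l) (e₁ d) < 0 := by nlinarith
    simp only [contactTime, wallTime]
    exact ⟨div_pos (by linarith) (by linarith), by rw [div_lt_iff₀ (by linarith)]; linarith⟩

lemma inner_neg_of_wallHit {l : Fin N} (hδ : 0 < δ) (h : Z ∈ wallHit ε δ l) :
    inner ℝ (Z.2 l) (e₁ d) < 0 := by
  obtain ⟨h1, h2⟩ := h
  nlinarith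

lemma inner_wallTime {l : Fin N} (hδ : 0 < δ) (h : Z ∈ wallHit ε δ l) :
    inner ℝ (Z.1 l) (e₁ d) + wallTime ε l Z * inner ℝ (Z.2 l) (e₁ d) = ε / 2 := by
  have h3 := inner_neg_of_wallHit hδ h
  rw [wallTime, div_neg, neg_mul, div_mul_cancel₀ _ h3.ne]
  ring

lemma gap_contactTime (hε : 0 < ε) (hδ : 0 < δ) (h : Z ∈ hit ε δ c) :
    gap ε c (freeFlow (contactTime ε c Z) Z).1 = 0 := by
  rcases c with p | l
  · rw [gap_inl_freeFlow, sub_eq_zero]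
    exact ((hit_iff hε.le).2 ⟨h.1.1, rfl⟩).1
  · rw [gap_inr_freeFlow, sub_eq_zero]
    exact inner_wallTime hδ h

lemma gap_pos_of_lt_contactTime (hε : 0 < ε) (hδ : 0 < δ) (h : Z ∈ hit ε δ c) {u : ℝ}
    (hu : u < contactTime ε c Z) : 0 < gap ε c (freeFlow u Z).1 := by
  rcases c with p | l
  · rw [gap_inl_freeFlow, sub_pos]
    exact norm_gt_of_lt_hitTime hε.le h.1.1 hu
  · rw [gap_inr_freeFlow, sub_pos, ← inner_wallTime hδ h]
    have := inner_neg_of_wallHit hδ h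
    have hu : u < wallTime ε l Z := hu
    nlinarith

/-- The collision reverses the normal component of the velocity, so the gap opens: for a pair the
squared distance is ε² plus a positive linear term and a nonnegative quadratic one. -/
lemma gap_pos_after (hε : 0 < ε) (hδ : 0 < δ) (h : Z ∈ hit ε δ c) {u : ℝ} (hu : 0 < u) :
    0 < gap ε c (freeFlow u (collide ε c (freeFlow (contactTime ε c Z) Z))).1 := by
  have h0 := gap_contactTime hε hδ h
  rcases c with p | l
  · rw [gap_inl_freeFlow, collide_fst, sub_pos]
    rw [gap_inl, sub_eq_zero] at h0
    have h1 := inner_pairCollision_rel hε p.2.ne h0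
    have h2 := ((hit_iff hε.le).2 ⟨h.1.1, rfl⟩).2
    rw [← freeFlow_rel] at h2
    rw [← sq_lt_sq₀ hε.le (norm_nonneg _), norm_add_smul_sq, h0]
    simp only [collide, h1, freeFlow_snd]
    have h2 : inner ℝ ((freeFlow (contactTime ε (.inl p) Z) Z).1 p.1.2 -
      (freeFlow (contactTime ε (.inl p) Z) Z).1 p.1.1) (Z.2 p.1.2 - Z.2 p.1.1) < 0 := h2
    nlinarith [mul_pos hu (neg_pos.2 h2), mul_nonneg (sq_nonneg u) (sq_nonneg
      ‖(pairCollision ε p.1.1 p.1.2 (freeFlow (contactTime ε (.inl p) Z) Z)).2 p.1.2 -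
        (pairCollision ε p.1.1 p.1.2 (freeFlow (contactTime ε (.inl p) Z) Z)).2 p.1.1‖)]
  · rw [gap, sub_eq_zero] at h0
    rw [gap_inr_freeFlow, collide_fst, h0]
    simp only [collide, inner_wallReflection, freeFlow_snd]
    have := inner_neg_of_wallHit hδ h
    nlinarith

/-- After reversal, the final configuration flows back to the same contact in the remaining time δ -
`contactTime`. The contact that took place can thus be read off from the image, which later makes
the images belonging to different contacts disjoint. -/
lemma rev_hitStep_mem (hε : 0 < ε) (hδ : 0 < δ) (h : Z ∈ hit ε δ c) :
    rev (hitStep ε δ c Z) ∈ hit ε δ c := by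
  have h0 := gap_contactTime hε hδ h
  have ht := contactTime_mem hδ h
  rcases c with p | l
  · rw [gap_inl, sub_eq_zero] at h0
    have h1 := inner_pairCollision_rel hε p.2.ne h0
    have h2 := ((hit_iff hε.le).2 ⟨h.1.1, rfl⟩).2
    rw [← freeFlow_rel] at h2
    set Z₀ := freeFlow (contactTime ε (.inl p) Z) Z with hZ₀
    set s := δ - contactTime ε (.inl p) Z with hs
    set w' := (pairCollision ε p.1.1 p.1.2 Z₀).2 p.1.2 - (pairCollision ε p.1.1 p.1.2 Z₀).2 p.1.1
      with hw'
    have e1 : (rev (hitStep ε δ (.inl p) Z)).1 p.1.2 - (rev (hitStep ε δ (.inl p) Z)).1 p.1.1 =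
        (Z₀.1 p.1.2 - Z₀.1 p.1.1) + s • w' := freeFlow_rel _ _ _ _
    have e2 : (rev (hitStep ε δ (.inl p) Z)).2 p.1.2 - (rev (hitStep ε δ (.inl p) Z)).2 p.1.1 =
        -w' := by
      simp only [rev_snd, Pi.neg_apply, hitStep, collide, freeFlow_snd, ← hZ₀, hw']
      abel
    have e3 : (Z₀.1 p.1.2 - Z₀.1 p.1.1) + s • w' + s • (-w') = Z₀.1 p.1.2 - Z₀.1 p.1.1 := by module
    have h2 : inner ℝ (Z₀.1 p.1.2 - Z₀.1 p.1.1) (Z₀.2 p.1.2 - Z₀.2 p.1.1) < 0 := h2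
    have h5 := (hit_iff hε.le (y := (Z₀.1 p.1.2 - Z₀.1 p.1.1) + s • w') (w := -w') (u := s)).1
      ⟨by rw [e3, h0], by rw [e3, inner_neg_right, h1]; linarith⟩
    simp only [hit, pairHit, hitSet, Set.mem_ofPred_eq, e1, e2]
    rw [← h5.2]
    exact ⟨⟨h5.1, by linarith⟩, by linarith⟩
  · rw [gap, sub_eq_zero] at h0
    have := inner_neg_of_wallHit hδ h
    have e1 : inner ℝ ((rev (hitStep ε δ (.inr l) Z)).1 l) (e₁ d) =
        ε / 2 + (δ - contactTime ε (.inr l) Z) * -inner ℝ (Z.2 l) (e₁ d) := by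
      simp only [rev_fst, hitStep, inner_freeFlow_e₁, collide_fst, h0]
      simp only [collide, inner_wallReflection, freeFlow_snd]
    have e2 : inner ℝ ((rev (hitStep ε δ (.inr l) Z)).2 l) (e₁ d) = inner ℝ (Z.2 l) (e₁ d) := by
      simp only [rev_snd, hitStep, freeFlow_snd, collide, Pi.neg_apply, inner_neg_left,
        inner_wallReflection, neg_neg]
    simp only [hit, wallHit, Set.mem_ofPred_eq, e1, e2]
    constructor
    · nlinarith
    · nlinarith

lemma exists_gap_neg (hε : 0 < ε) (hδ : 0 < δ) (h : Z ∈ hit ε δ c) :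
    ∃ u, 0 < u ∧ u < δ ∧ gap ε c (freeFlow u Z).1 < 0 := by
  have ht := contactTime_mem hδ h
  rcases c with p | l
  · obtain ⟨u, h1, h2, h3⟩ := norm_lt_after_hit hε h.1.1 h.2
    exact ⟨u, ht.1.trans h1, h2, by rw [gap_inl_freeFlow]; linarith⟩
  · refine ⟨(contactTime ε (.inr l) Z + δ) / 2, by linarith, by linarith, ?_⟩
    rw [gap_inr_freeFlow]
    have h1 := inner_wallTime hδ h
    have h2 := inner_neg_of_wallHit hδ h
    have ht : wallTime ε l Z < δ := ht.2
    simp only [contactTime]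
    nlinarith

lemma gap_nonneg_of_notMem_hit (hε : 0 < ε) (h0 : 0 < gap ε c Z.1) (h : Z ∉ hit ε δ c) {u : ℝ}
    (hu : 0 ≤ u) (huδ : u ≤ δ) : 0 ≤ gap ε c (freeFlow u Z).1 := by
  by_contra! hc
  have hu : 0 < u := by
    rcases hu.eq_or_lt with rfl | h
    · rw [freeFlow_zero] at hc; linarith
    · exact h
  refine h ?_
  rcases c with p | l
  · rw [gap_inl_freeFlow, sub_neg] at hc
    rw [gap_inl, sub_pos] at h0
    have := mem_hitSet_of_norm_le hε.le h0 hu (.inl hc)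
    exact ⟨this.1, this.2.trans_le huδ⟩
  · rw [gap_inr_freeFlow, sub_neg] at hc
    rw [gap, sub_pos] at h0
    refine ⟨h0, ?_⟩
    have : inner ℝ (Z.2 l) (e₁ d) < 0 := by nlinarith
    nlinarith

/-- Such a contact is grazing: an incoming one would itself be a hit, and an outgoing one would have
been preceded by a hit. The relative velocity is then tangent and the collision law acts trivially.
At the wall the situation cannot occur, since a positive gap closes only at a nonzero normal
velocity. -/
lemma collide_eq_self_of_notMem_hit (hε : 0 < ε) (h0 : 0 < gap ε c Z.1) (h : Z ∉ hit ε δ c) {u : ℝ}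
    (hu : 0 < u) (huδ : u < δ) (hc : gap ε c (freeFlow u Z).1 = 0) :
    collide ε c (freeFlow u Z) = freeFlow u Z := by
  rcases c with p | l
  · refine pairCollision_eq_self ?_
    rw [gap_inl_freeFlow, sub_eq_zero] at hc
    rw [gap_inl, sub_pos] at h0
    rw [freeFlow_rel, freeFlow_snd]
    rcases lt_trichotomy (inner ℝ (Z.1 p.1.2 - Z.1 p.1.1 + u • (Z.2 p.1.2 - Z.2 p.1.1))
      (Z.2 p.1.2 - Z.2 p.1.1)) 0 with h1 | h1 | h1
    · obtain ⟨h2, h3⟩ := (hit_iff hε.le).1 ⟨hc, h1⟩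
      exact absurd ⟨⟨h2, h3 ▸ hu⟩, h3 ▸ huδ⟩ h
    · exact h1
    · have := mem_hitSet_of_norm_le hε.le h0 hu (.inr ⟨hc, h1⟩)
      exact absurd ⟨this.1, this.2.trans huδ⟩ h
  · rw [gap_inr_freeFlow, sub_eq_zero] at hc
    rw [gap, sub_pos] at h0
    exfalso
    have h1 : inner ℝ (Z.2 l) (e₁ d) < 0 := by nlinarith
    exact h ⟨h0, by nlinarith⟩

lemma lintegral_hitStep (hε : 0 < ε) (hδ : 0 < δ) (c : Contact N) {F : Config d N → ℝ≥0∞}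
    (hF : Measurable F) :
    ∫⁻ Z in hit ε δ c, F (hitStep ε δ c Z) = ∫⁻ Z in rev ⁻¹' hit ε δ c, F Z := by
  rcases c with p | l
  · exact lintegral_pairStep hε p.2.ne hF
  let L : (Fin N → Euc d) →ₗ[ℝ] (Fin N → Euc d) :=
    { toFun := fun V m => if m = l then V l - (2 * inner ℝ (V l) (e₁ d)) • e₁ d else V m
      map_add' := fun V W => by
        funext m
        by_cases h1 : m = l
        · subst h1
          simp only [if_true, Pi.add_apply, inner_add_left]
          module
        · simp [h1]
      map_smul' := fun c V => by
        funext m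
        by_cases h1 : m = l
        · subst h1
          simp only [if_true, Pi.smul_apply, inner_smul_left, conj_trivial, RingHom.id_apply]
          module
        · simp [h1] }
  have hLL : ∀ V, L (L V) = V := by
    intro V
    funext m
    by_cases h1 : m = l
    · subst h1
      simp only [L, LinearMap.coe_mk, AddHom.coe_mk, if_true, inner_sub_left, inner_smul_left,
        inner_e₁_e₁, conj_trivial]
      module
    · simp [L, h1]
  have hL : MeasurePreserving L := measurePreserving_involution (LinearMap.ext hLL)
  -- On positions, L followed by this translation is the mirror symmetry of the particle l across
  -- the plane x·e₁ = ε / 2. The step at the wall is the free flow during δ followed by this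
  -- symmetry.
  set a : Fin N → Euc d := Pi.single l (ε • e₁ d)
  have hR : MeasurePreserving (fun Z : Config d N => (L Z.1 + a, L Z.2)) :=
    ((measurePreserving_add_right volume a).comp hL).prod hL
  have hstep : ∀ Z ∈ wallHit ε δ l, hitStep ε δ (.inr l) Z =
      (fun Z : Config d N => (L Z.1 + a, L Z.2)) (freeFlow δ Z) := by
    intro Z hZ
    have h1 := inner_wallTime hδ hZ
    have h2 : inner ℝ (Z.1 l) (e₁ d) = ε / 2 - wallTime ε l Z * inner ℝ (Z.2 l) (e₁ d) := by
      linarith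
    ext1
    · funext m
      by_cases hm : m = l
      · subst hm
        simp only [hitStep, contactTime, freeFlow, collide, wallReflection_fst,
          wallReflection_snd_self, L,
          LinearMap.coe_mk, AddHom.coe_mk, if_true, a, Pi.add_apply, Pi.single_eq_same,
          inner_add_left, inner_smul_left, conj_trivial, h2]
        module
      · simp only [hitStep, contactTime, freeFlow, collide, wallReflection, L,
          LinearMap.coe_mk, AddHom.coe_mk, if_neg hm, a, Pi.add_apply, Pi.single_eq_of_ne hm]
        module
    · funext m
      simp [hitStep, collide, wallReflection, L]
  have hmem : ∀ Z, Z ∈ wallHit ε δ l ↔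
      (fun Z : Config d N => (L Z.1 + a, L Z.2)) (freeFlow δ Z) ∈ rev ⁻¹' wallHit ε δ l := by
    intro Z
    simp only [Set.mem_preimage, wallHit, Set.mem_ofPred_eq, rev_fst, rev_snd, Pi.neg_apply, L,
      LinearMap.coe_mk, AddHom.coe_mk, if_true, a, Pi.add_apply, Pi.single_eq_same,
      inner_add_left, inner_sub_left, inner_neg_left, inner_smul_left, conj_trivial, inner_e₁_e₁,
      freeFlow]
    constructor
    · rintro ⟨h1, h2⟩; constructor <;> linarith
    · rintro ⟨h1, h2⟩; constructor <;> linarith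
  have hm := measurableSet_hit (d := d) ε δ (.inr l)
  have hP := (hR.comp (measurePreserving_freeFlow (d := d) (N := N) δ)).setLIntegral_comp_preimage
    (measurable_rev hm) hF
  simp only [hit] at hm hP ⊢
  rw [setLIntegral_congr_fun hm (fun Z hZ => by rw [hstep Z hZ]), ← hP]
  congr 2
  ext Z
  exact hmem Z

end Contacts

/-! ### Trajectories: uniqueness, concatenation and reversal -/

section Trajectories

variable {d : ℕ} {N : ℕ} {ε : ℝ}

/-- The motion is free just after the time `t`. -/
def RightFree (γ : ℝ → Config d N) (t : ℝ) : Prop :=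
  ∀ᶠ t' in 𝓝[>] t, γ t' = freeFlow (t' - t) (γ t)

/-- The motion is free just before the time `t`, at which the configuration tends to `Z`. -/
def LeftLim (γ : ℝ → Config d N) (t : ℝ) (Z : Config d N) : Prop :=
  ∀ᶠ t' in 𝓝[<] t, γ t' = freeFlow (t' - t) Z

lemma LeftLim.unique {γ : ℝ → Config d N} {t : ℝ} {Z Z' : Config d N} (h : LeftLim γ t Z)
    (h' : LeftLim γ t Z') : Z = Z' := by
  obtain ⟨t', h1, h2⟩ := (h.and h').exists
  exact freeFlow_injective _ (h1.symm.trans h2)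

lemma LeftLim.congr {γ γ' : ℝ → Config d N} {t : ℝ} {Z : Config d N} (h : LeftLim γ t Z)
    (hγ : ∀ᶠ u in 𝓝[<] t, γ' u = γ u) : LeftLim γ' t Z := by
  filter_upwards [h, hγ] with u h1 h2
  rw [h2, h1]

lemma RightFree.congr {γ γ' : ℝ → Config d N} {t : ℝ} (h : RightFree γ t)
    (hγ : ∀ᶠ u in 𝓝[>] t, γ' u = γ u) (ht : γ' t = γ t) : RightFree γ' t := by
  filter_upwards [h, hγ] with u h1 h2
  rw [h2, h1, ht]

lemma RightFree.shift {γ : ℝ → Config d N} {t : ℝ} (a : ℝ) (h : RightFree γ (t + a)) :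
    RightFree (fun u => γ (u + a)) t := by
  have h1 : Tendsto (fun u => u + a) (𝓝[>] t) (𝓝[>] (t + a)) :=
    tendsto_nhdsWithin_of_tendsto_nhds_of_eventually_within _
      ((continuous_id.add continuous_const).tendsto' t _ rfl |>.mono_left nhdsWithin_le_nhds)
      (by filter_upwards [self_mem_nhdsWithin] with u hu using add_lt_add_left hu a)
  filter_upwards [h1.eventually h] with u hu
  rw [hu]
  congr 1
  ring

lemma LeftLim.shift {γ : ℝ → Config d N} {t : ℝ} (a : ℝ) {Z : Config d N}
    (h : LeftLim γ (t + a) Z) : LeftLim (fun u => γ (u + a)) t Z := by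
  have h1 : Tendsto (fun u => u + a) (𝓝[<] t) (𝓝[<] (t + a)) :=
    tendsto_nhdsWithin_of_tendsto_nhds_of_eventually_within _
      ((continuous_id.add continuous_const).tendsto' t _ rfl |>.mono_left nhdsWithin_le_nhds)
      (by filter_upwards [self_mem_nhdsWithin] with u hu using add_lt_add_left hu a)
  filter_upwards [h1.eventually h] with u hu
  rw [hu]
  congr 1
  ring

lemma leftLim_of_freeFlow {γ : ℝ → Config d N} {a b : ℝ} {t₀ : ℝ} {Z : Config d N}
    (h : ∀ u ∈ Set.Ioo a b, γ u = freeFlow (u - t₀) Z) {u : ℝ} (hu : u ∈ Set.Ioo a b) :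
    LeftLim γ u (γ u) := by
  have : Set.Ioo a b ∈ 𝓝[<] u := mem_nhdsWithin_of_mem_nhds (Ioo_mem_nhds hu.1 hu.2)
  filter_upwards [this] with v hv
  rw [h v hv, h u hu, freeFlow_add]
  congr 1
  ring

lemma RightFree.eventually_leftLim {γ : ℝ → Config d N} {t : ℝ} (h : RightFree γ t) :
    ∀ᶠ u in 𝓝[>] t, LeftLim γ u (γ u) := by
  obtain ⟨b, hb, h⟩ := mem_nhdsGT_iff_exists_Ioo_subset.1 h
  filter_upwards [Ioo_mem_nhdsGT hb] with u hu
  exact leftLim_of_freeFlow h hu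

lemma LeftLim.eventually_leftLim {γ : ℝ → Config d N} {t : ℝ} {Z : Config d N}
    (h : LeftLim γ t Z) : ∀ᶠ u in 𝓝[<] t, LeftLim γ u (γ u) := by
  obtain ⟨b, hb, h⟩ := mem_nhdsLT_iff_exists_Ioo_subset.1 h
  filter_upwards [Ioo_mem_nhdsLT hb] with u hu
  exact leftLim_of_freeFlow h hu

variable [NeZero d]

/-- The motion is free just before the time `t`, at which the event rule holds. -/
def LeftEvent (ε : ℝ) (γ : ℝ → Config d N) (t : ℝ) : Prop :=
  ∃ Z, EventRule ε Z (γ t) ∧ LeftLim γ t Z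

/-- Hard sphere trajectories during `[0, b]`. -/
structure IsForward (ε : ℝ) (γ : ℝ → Config d N) (b : ℝ) : Prop where
  right : ∀ t, 0 ≤ t → t < b → RightFree γ t
  left : ∀ t, 0 < t → t ≤ b → LeftEvent ε γ t

lemma OnlyContact.unique {c c' : Contact N} {Z : Config d N} (h : OnlyContact ε c Z)
    (h' : OnlyContact ε c' Z) : c = c' := by
  by_contra hne
  exact (h'.2 c hne).ne' h.1

lemma OnlyContact.not_noContact {c : Contact N} {Z : Config d N} (h : OnlyContact ε c Z) :
    ¬ NoContact ε Z := fun h' => (noContact_iff.1 h' c).ne' h.1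

lemma eventRule_eq_of_noContact {Z Z' : Config d N} (h : EventRule ε Z Z') (hZ : NoContact ε Z) :
    Z' = Z := by
  rcases eventRule_iff.1 h with h | ⟨c, h, -⟩
  · exact h.2
  · exact absurd hZ h.not_noContact

lemma eventRule_unique {Z Z' Z'' : Config d N} (h : EventRule ε Z Z') (h' : EventRule ε Z Z'') :
    Z' = Z'' := by
  rcases eventRule_iff.1 h with h | ⟨c, h, h2⟩
  · rw [h.2, eventRule_eq_of_noContact h' h.1]
  · rcases eventRule_iff.1 h' with h' | ⟨c', h', h2'⟩
    · exact absurd h'.1 h.not_noContact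
    · rw [h2, h2', h.unique h']

lemma eventRule_reverse (hε : 0 < ε) {Z Z' : Config d N} (h : EventRule ε Z Z') :
    EventRule ε (rev Z') (rev Z) := by
  rcases eventRule_iff.1 h with ⟨h1, rfl⟩ | ⟨c, h1, rfl⟩
  · exact .inl ⟨h1, rfl⟩
  · refine eventRule_iff.2 (.inr ⟨c, ?_, (collide_rev_collide hε c h1.1).symm⟩)
    rwa [OnlyContact, rev_fst, collide_fst]

lemma LeftEvent.congr {γ γ' : ℝ → Config d N} {t : ℝ} (h : LeftEvent ε γ t)
    (hγ : ∀ᶠ u in 𝓝[<] t, γ' u = γ u) (ht : γ' t = γ t) : LeftEvent ε γ' t := by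
  obtain ⟨Z, h1, h2⟩ := h
  exact ⟨Z, ht ▸ h1, h2.congr hγ⟩

lemma LeftEvent.shift {γ : ℝ → Config d N} {t : ℝ} (a : ℝ) (h : LeftEvent ε γ (t + a)) :
    LeftEvent ε (fun u => γ (u + a)) t := by
  obtain ⟨Z, h1, h2⟩ := h
  exact ⟨Z, h1, h2.shift a⟩

/-- Local form of the reversibility of the dynamics. -/
lemma reverse_local (hε : 0 < ε) {γ Zb : ℝ → Config d N} {t : ℝ}
    (hr : RightFree γ t) (hl : LeftLim γ t (Zb t)) (he : EventRule ε (Zb t) (γ t))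
    (hZb : ∀ᶠ u in 𝓝 t, LeftLim γ u (Zb u)) :
    RightFree (fun u => rev (Zb (-u))) (-t) ∧ LeftEvent ε (fun u => rev (Zb (-u))) (-t) := by
  have h1 : Tendsto (fun u : ℝ => -u) (𝓝[>] (-t)) (𝓝[<] t) := by
    simpa using tendsto_neg_nhdsGT (a := -t)
  have h2 : Tendsto (fun u : ℝ => -u) (𝓝[<] (-t)) (𝓝[>] t) := by
    simpa using tendsto_neg_nhdsLT (a := -t)
  constructor
  · filter_upwards [h1.eventually hl, h1.eventually hl.eventually_leftLim,
      h1.eventually (hZb.filter_mono nhdsWithin_le_nhds)] with u hu hu1 hu2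
    rw [hu2.unique hu1, hu, rev_freeFlow, neg_neg]
    congr 1
    ring
  · refine ⟨rev (γ t), by simpa using eventRule_reverse hε he, ?_⟩
    filter_upwards [h2.eventually hr, h2.eventually hr.eventually_leftLim,
      h2.eventually (hZb.filter_mono nhdsWithin_le_nhds)] with u hu hu1 hu2
    rw [hu2.unique hu1, hu, rev_freeFlow]
    congr 1
    ring

lemma IsHardSphereTrajectory.right {γ : ℝ → Config d N} (h : IsHardSphereTrajectory ε γ) (t : ℝ) :
    RightFree γ t := (h t).1

lemma IsHardSphereTrajectory.left {γ : ℝ → Config d N} (h : IsHardSphereTrajectory ε γ) (t : ℝ) :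
    LeftEvent ε γ t := (h t).2

lemma IsHardSphereTrajectory.isForward {γ : ℝ → Config d N} (h : IsHardSphereTrajectory ε γ)
    (b : ℝ) : IsForward ε γ b :=
  ⟨fun t _ _ => IsHardSphereTrajectory.right h t, fun t _ _ => IsHardSphereTrajectory.left h t⟩

lemma IsHardSphereTrajectory.shift {γ : ℝ → Config d N} (h : IsHardSphereTrajectory ε γ) (a : ℝ) :
    IsHardSphereTrajectory ε fun t => γ (t + a) := fun t =>
  ⟨(IsHardSphereTrajectory.right h (t + a)).shift a,
    (IsHardSphereTrajectory.left h (t + a)).shift a⟩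

/-- Trajectories are right-continuous, so the reversed one must take the reversed left limits as
values. At a collision these differ from the reversed values by the event rule, whence the form of
the conclusion. -/
lemma IsHardSphereTrajectory.reverse (hε : 0 < ε) {γ : ℝ → Config d N}
    (h : IsHardSphereTrajectory ε γ) :
    ∃ γ', IsHardSphereTrajectory ε γ' ∧ ∀ t, EventRule ε (rev (γ t)) (γ' (-t)) := by
  choose Zb h1 h2 using fun t => IsHardSphereTrajectory.left h t
  refine ⟨fun u => rev (Zb (-u)), fun t => ?_, fun t => by simpa using eventRule_reverse hε (h1 t)⟩
  have := reverse_local hε (IsHardSphereTrajectory.right h (-t)) (h2 (-t)) (h1 (-t))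
    (Eventually.of_forall h2)
  rwa [neg_neg] at this

/-- Continuous induction. The set of times up to which the trajectories agree is closed, because a
common left limit determines the value through the event rule, and it extends to the right, because
the motion is free just after each time. -/
lemma IsForward.unique {γ γ' : ℝ → Config d N} {b : ℝ} (h : IsForward ε γ b)
    (h' : IsForward ε γ' b) (h0 : γ 0 = γ' 0) : ∀ t ∈ Set.Icc 0 b, γ t = γ' t := by
  rcases lt_or_ge b 0 with hb | hb
  · intro t ht; linarith [ht.1, ht.2]
  set S : Set ℝ := {t | ∀ u ∈ Set.Icc 0 t, γ u = γ' u} with hS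
  have hSdown : ∀ t ∈ S, ∀ u ≤ t, u ∈ S := fun t ht u hu v hv => ht v ⟨hv.1, hv.2.trans hu⟩
  suffices hmain : Set.Icc 0 b ⊆ S from fun t ht => hmain ht t ⟨ht.1, le_rfl⟩
  have hclosed : IsClosed (S ∩ Set.Icc 0 b) := by
    refine isClosed_of_closure_subset fun t ht => ?_
    have htI : t ∈ Set.Icc 0 b := by
      have := closure_mono Set.inter_subset_right ht
      rwa [isClosed_Icc.closure_eq] at this
    refine ⟨?_, htI⟩
    have hlt : ∀ u, 0 ≤ u → u < t → γ u = γ' u := by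
      intro u hu0 hut
      obtain ⟨v, hv1, hv2⟩ := mem_closure_iff.1 ht (Set.Ioi u) isOpen_Ioi hut
      exact hv2.1 u ⟨hu0, hv1.le⟩
    intro u hu
    rcases hu.2.lt_or_eq with h1 | rfl
    · exact hlt u hu.1 h1
    rcases hu.1.eq_or_lt with h1 | h1
    · rw [← h1, h0]
    obtain ⟨Z, hZ1, hZ2⟩ := h.left u h1 htI.2
    obtain ⟨Z', hZ1', hZ2'⟩ := h'.left u h1 htI.2
    have hev : ∀ᶠ v in 𝓝[<] u, γ v = γ' v := by
      filter_upwards [Ioo_mem_nhdsLT h1] with v hv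
      exact hlt v hv.1.le hv.2
    have : Z = Z' := hZ2.unique (hZ2'.congr hev)
    subst this
    exact eventRule_unique hZ1 hZ1'
  refine hclosed.Icc_subset_of_forall_exists_gt ?_ ?_
  · intro u hu
    have : u = 0 := le_antisymm hu.2 hu.1
    rw [this, h0]
  · rintro t ⟨htS, ht⟩ y hy
    obtain ⟨b1, hb1, h1⟩ := mem_nhdsGT_iff_exists_Ioo_subset.1 (h.right t ht.1 ht.2)
    obtain ⟨b2, hb2, h2⟩ := mem_nhdsGT_iff_exists_Ioo_subset.1 (h'.right t ht.1 ht.2)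
    have hm : t < min (min b1 b2) y := lt_min (lt_min hb1 hb2) hy
    refine ⟨(t + min (min b1 b2) y) / 2, fun u hu => ?_, by linarith, ?_⟩
    · rcases le_or_gt u t with h3 | h3
      · exact htS u ⟨hu.1, h3⟩
      · have h4 : u < min (min b1 b2) y := by linarith [hu.2]
        have h5 := lt_min_iff.1 (lt_min_iff.1 h4).1
        have e1 : γ u = freeFlow (u - t) (γ t) := h1 ⟨h3, h5.1⟩
        have e2 : γ' u = freeFlow (u - t) (γ' t) := h2 ⟨h3, h5.2⟩
        rw [e1, e2, htS t ⟨ht.1, le_rfl⟩]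
    · have := min_le_right (min b1 b2) y
      linarith

/-- The past is the future of the reversed trajectories. The event rule is deterministic and
reversible, so equality passes from one to the other. -/
lemma IsHardSphereTrajectory.unique (hε : 0 < ε) {γ γ' : ℝ → Config d N}
    (h : IsHardSphereTrajectory ε γ) (h' : IsHardSphereTrajectory ε γ') (h0 : γ 0 = γ' 0) :
    γ = γ' := by
  funext t
  rcases le_total 0 t with ht | ht
  · exact (IsHardSphereTrajectory.isForward h t).unique
      (IsHardSphereTrajectory.isForward h' t) h0 t ⟨ht, le_rfl⟩
  · obtain ⟨β, hβ, hβ'⟩ := IsHardSphereTrajectory.reverse hε h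
    obtain ⟨β', hβ2, hβ2'⟩ := IsHardSphereTrajectory.reverse hε h'
    have e0 : β 0 = β' 0 := by
      have h1 := hβ' 0
      have h2 := hβ2' 0
      rw [neg_zero] at h1 h2
      rw [h0] at h1
      exact eventRule_unique h1 h2
    have e1 := (IsHardSphereTrajectory.isForward hβ (-t)).unique
      (IsHardSphereTrajectory.isForward hβ2 (-t)) e0 (-t) ⟨by linarith, le_rfl⟩
    have h1 := eventRule_reverse hε (hβ' t)
    have h2 := eventRule_reverse hε (hβ2' t)
    rw [rev_rev] at h1 h2
    rw [e1] at h1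
    exact eventRule_unique h1 h2

/-- The configurations through which a global trajectory passes. -/
def Alive (ε : ℝ) (Z : Config d N) : Prop :=
  ∃ γ : ℝ → Config d N, IsHardSphereTrajectory ε γ ∧ γ 0 = Z

lemma hardSphereFlow_eq (hε : 0 < ε) {γ : ℝ → Config d N} (h : IsHardSphereTrajectory ε γ) (t : ℝ) :
    hardSphereFlow ε t (γ 0) = γ t := by
  have H : ∃ γ' : ℝ → Config d N, IsHardSphereTrajectory ε γ' ∧ γ' 0 = γ 0 := ⟨γ, h, rfl⟩
  rw [hardSphereFlow, dif_pos H]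
  exact congrFun (IsHardSphereTrajectory.unique hε H.choose_spec.1 h H.choose_spec.2) t

/-- The configuration `Z'` is reached at the time `t` from `Z`. -/
def Reach (ε t : ℝ) (Z Z' : Config d N) : Prop := ∃ γ, IsForward ε γ t ∧ γ 0 = Z ∧ γ t = Z'

lemma Reach.trans {s t : ℝ} (hs : 0 ≤ s) {Z Z' Z'' : Config d N} (h : Reach ε s Z Z')
    (h' : Reach ε t Z' Z'') (ht : 0 ≤ t) : Reach ε (s + t) Z Z'' := by
  obtain ⟨γ, hγ, rfl, rfl⟩ := h
  obtain ⟨β, hβ, hβ0, rfl⟩ := h'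
  have hβs : ∀ u, s ≤ u → (if u ≤ s then γ u else β (u - s)) = β (u - s) := by
    intro u hu
    rcases hu.eq_or_lt with rfl | hu
    · rw [if_pos le_rfl, sub_self, hβ0]
    · rw [if_neg hu.not_ge]
  refine ⟨fun u => if u ≤ s then γ u else β (u - s), ⟨?_, ?_⟩, by simp [hs], ?_⟩
  · intro u hu0 hu
    rcases lt_or_ge u s with h1 | h1
    · refine (hγ.right u hu0 h1).congr ?_ (if_pos h1.le)
      filter_upwards [Ioo_mem_nhdsGT h1] with v hv using if_pos hv.2.le
    · have h2 := (hβ.right (u + -s) (by linarith) (by linarith)).shift (-s)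
      refine h2.congr ?_ (hβs u h1)
      filter_upwards [self_mem_nhdsWithin] with v hv
      exact hβs v (h1.trans (le_of_lt hv))
  · intro u hu0 hu
    rcases le_or_gt u s with h1 | h1
    · refine (hγ.left u hu0 h1).congr ?_ (if_pos h1)
      filter_upwards [self_mem_nhdsWithin] with v hv using if_pos ((le_of_lt hv).trans h1)
    · have h2 := (hβ.left (u + -s) (by linarith) (by linarith)).shift (-s)
      refine h2.congr ?_ (hβs u h1.le)
      filter_upwards [Ioo_mem_nhdsLT h1] with v hv
      exact hβs v hv.1.le
  · simp only
    rw [hβs _ (by linarith), add_sub_cancel_left]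

lemma Reach.eq_flow (hε : 0 < ε) {t : ℝ} (ht : 0 ≤ t) {Z Z' : Config d N} (h : Reach ε t Z Z')
    (hZ : Alive ε Z) : Z' = hardSphereFlow ε t Z := by
  obtain ⟨γ, hγ, rfl, rfl⟩ := h
  obtain ⟨β, hβ, h0⟩ := hZ
  rw [← h0, hardSphereFlow_eq hε hβ]
  exact hγ.unique (IsHardSphereTrajectory.isForward hβ t) h0.symm t ⟨ht, le_rfl⟩

lemma IsForward.mono {γ : ℝ → Config d N} {a b : ℝ} (h : IsForward ε γ b) (hab : a ≤ b) :
    IsForward ε γ a :=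
  ⟨fun t h0 ht => h.right t h0 (ht.trans_le hab), fun t h0 ht => h.left t h0 (ht.trans hab)⟩

lemma exists_forward {Z : Config d N} (h : ∀ n : ℕ, ∃ Z', Reach ε n Z Z') :
    ∃ γ : ℝ → Config d N, γ 0 = Z ∧ ∀ b, IsForward ε γ b := by
  choose Z' β hβ h0 _ using h
  have hag : ∀ (t : ℝ) (m n : ℕ), 0 ≤ t → t ≤ m → t ≤ n → β m t = β n t := by
    intro t m n h1 h2 h3
    exact ((hβ m).mono h2).unique ((hβ n).mono h3) (by rw [h0, h0]) t ⟨h1, le_rfl⟩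
  refine ⟨fun t => β (⌈t⌉₊) t, h0 _, fun b => ?_⟩
  have key : ∀ (n : ℕ) (t : ℝ), 0 ≤ t → t ≤ n → β (⌈t⌉₊) t = β n t := fun n t h1 h2 =>
    hag t _ _ h1 (Nat.le_ceil t) h2
  constructor
  · intro t h1 _
    obtain ⟨n, hn⟩ := exists_nat_gt t
    refine ((hβ n).right t h1 hn).congr ?_ (key n t h1 hn.le)
    filter_upwards [Ioo_mem_nhdsGT hn] with u hu
    exact key n u (h1.trans hu.1.le) hu.2.le
  · intro t h1 _
    obtain ⟨n, hn⟩ := exists_nat_gt t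
    refine ((hβ n).left t h1 hn.le).congr ?_ (key n t h1.le hn.le)
    filter_upwards [Ioo_mem_nhdsLT h1] with u hu
    exact key n u hu.1.le (hu.2.le.trans hn.le)

/-- The future of Z is glued at time 0 to the reversed future of `rev Z`, the latter through its
left limits. Without contact at time 0 the two free motions join there. -/
lemma alive_of_reach (hε : 0 < ε) {Z : Config d N} (hZ : NoContact ε Z)
    (h : ∀ n : ℕ, ∃ Z', Reach ε n Z Z') (h' : ∀ n : ℕ, ∃ Z', Reach ε n (rev Z) Z') :
    Alive ε Z := by
  obtain ⟨γ, hγ0, hγ⟩ := exists_forward h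
  obtain ⟨β, hβ0, hβ⟩ := exists_forward h'
  have hex : ∀ t, ∃ Zb, 0 < t → EventRule ε Zb (β t) ∧ LeftLim β t Zb := by
    intro t
    by_cases ht : 0 < t
    · obtain ⟨Zb, h⟩ := (hβ t).left t ht le_rfl
      exact ⟨Zb, fun _ => h⟩
    · exact ⟨Z, fun h => absurd h ht⟩
  choose Zb hZb using hex
  refine ⟨fun t => if 0 ≤ t then γ t else rev (Zb (-t)), fun t => ?_, by simp [hγ0]⟩
  rcases lt_trichotomy t 0 with ht | rfl | ht
  · have ht' : 0 < -t := by linarith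
    have h1 := reverse_local hε ((hβ (-t + 1)).right (-t) ht'.le (by linarith))
      (hZb (-t) ht').2 (hZb (-t) ht').1 (by
        filter_upwards [lt_mem_nhds ht'] with u hu using (hZb u hu).2)
    rw [neg_neg] at h1
    have ev : ∀ᶠ u in 𝓝 t, (if 0 ≤ u then γ u else rev (Zb (-u))) = rev (Zb (-u)) := by
      filter_upwards [gt_mem_nhds ht] with u hu using if_neg hu.not_ge
    exact ⟨h1.1.congr (ev.filter_mono nhdsWithin_le_nhds) (if_neg ht.not_ge),
      h1.2.congr (ev.filter_mono nhdsWithin_le_nhds) (if_neg ht.not_ge)⟩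
  · refine ⟨((hγ 1).right 0 le_rfl one_pos).congr ?_ (by simp), Z, ?_, ?_⟩
    · filter_upwards [self_mem_nhdsWithin] with u hu using if_pos (le_of_lt hu)
    · exact .inl ⟨hZ, by simp [hγ0]⟩
    · have h2 : Tendsto (fun u : ℝ => -u) (𝓝[<] 0) (𝓝[>] 0) := by
        simpa using tendsto_neg_nhdsLT (a := (0 : ℝ))
      have hr := (hβ 1).right 0 le_rfl one_pos
      filter_upwards [h2.eventually hr, h2.eventually hr.eventually_leftLim,
        self_mem_nhdsWithin] with u hu hu1 hu2
      have hu2 : u < 0 := hu2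
      rw [if_neg hu2.not_ge, ((hZb (-u) (by linarith)).2).unique hu1, hu, rev_freeFlow, hβ0,
        rev_rev]
      congr 1
      ring
  · have ev : ∀ᶠ u in 𝓝 t, (if 0 ≤ u then γ u else rev (Zb (-u))) = γ u := by
      filter_upwards [lt_mem_nhds ht] with u hu using if_pos hu.le
    exact ⟨((hγ (t + 1)).right t ht.le (by linarith)).congr
        (ev.filter_mono nhdsWithin_le_nhds) (if_pos ht.le),
      ((hγ t).left t ht le_rfl).congr (ev.filter_mono nhdsWithin_le_nhds) (if_pos ht.le)⟩

lemma Alive.flow_add (hε : 0 < ε) {Z : Config d N} (h : Alive ε Z) (s t : ℝ) :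
    hardSphereFlow ε s (hardSphereFlow ε t Z) = hardSphereFlow ε (s + t) Z := by
  obtain ⟨γ, hγ, rfl⟩ := h
  have := hardSphereFlow_eq hε (IsHardSphereTrajectory.shift hγ t) s
  rw [zero_add] at this
  rw [hardSphereFlow_eq hε hγ, hardSphereFlow_eq hε hγ, this]

/-- Reversibility of the flow, away from the contacts. -/
lemma flow_neg_eq (hε : 0 < ε) {t : ℝ} {Z : Config d N} (h : Alive ε (rev Z)) (hZ : NoContact ε Z)
    (hZ' : NoContact ε (hardSphereFlow ε t (rev Z))) :
    hardSphereFlow ε (-t) Z = rev (hardSphereFlow ε t (rev Z)) := by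
  obtain ⟨γ, hγ, h0⟩ := h
  obtain ⟨β, hβ, hβ'⟩ := IsHardSphereTrajectory.reverse hε hγ
  have e0 : β 0 = Z := by
    have h1 := hβ' 0
    rw [h0, rev_rev, neg_zero] at h1
    exact eventRule_eq_of_noContact h1 hZ
  rw [← h0, hardSphereFlow_eq hε hγ] at hZ'
  have h2 := eventRule_eq_of_noContact (Z := rev (γ t)) (hβ' t) hZ'
  rw [← e0, hardSphereFlow_eq hε hβ, h2, e0, ← h0, hardSphereFlow_eq hε hγ]

end Trajectories

/-! ### The motion during a short time -/

section Step

variable {d : ℕ} {N : ℕ}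

lemma famNorm_nonneg (V : Fin N → Euc d) : 0 ≤ famNorm V := Real.sqrt_nonneg _

lemma norm_le_famNorm (V : Fin N → Euc d) (l : Fin N) : ‖V l‖ ≤ famNorm V := by
  refine Real.le_sqrt_of_sq_le ?_
  exact Finset.single_le_sum (f := fun j => ‖V j‖ ^ 2) (fun j _ => sq_nonneg _) (Finset.mem_univ l)

lemma continuous_famNorm : Continuous (famNorm (d := d) (n := N)) := by
  unfold famNorm
  fun_prop

lemma famNorm_neg (V : Fin N → Euc d) : famNorm (-V) = famNorm V := by simp [famNorm]

variable {ε δ r : ℝ} {Z : Config d N}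

lemma norm_freeFlow_sub_le {u : ℝ} (hu : 0 ≤ u) (huδ : u ≤ δ) (hZ : famNorm Z.2 ≤ r) (l : Fin N) :
    ‖(freeFlow u Z).1 l - Z.1 l‖ ≤ r * δ := by
  have h1 : (freeFlow u Z).1 l - Z.1 l = u • Z.2 l := by simp [freeFlow]
  rw [h1, norm_smul, Real.norm_eq_abs, abs_of_nonneg hu, mul_comm]
  have := (norm_le_famNorm Z.2 l).trans hZ
  have := norm_nonneg (Z.2 l)
  gcongr
  linarith

lemma mul_nonneg_of_speed_le (hδ : 0 < δ) (hZ : famNorm Z.2 ≤ r) : 0 ≤ r * δ :=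
  mul_nonneg ((famNorm_nonneg _).trans hZ) hδ.le

variable [NeZero d]

lemma measurableSet_phaseSpace (ε : ℝ) : MeasurableSet (phaseSpace d N ε) := by
  have : phaseSpace d N ε = ⋂ c, {Z | 0 ≤ gap ε c Z.1} := by
    ext Z
    simp only [mem_phaseSpace_iff, Set.mem_iInter, Set.mem_ofPred_eq]
  rw [this]
  exact MeasurableSet.iInter fun c => measurableSet_le measurable_const
    ((continuous_gap ε c).measurable.comp measurable_fst)

/-- At most one contact is nearer than `η`. -/
def Isolated (ε η : ℝ) (X : Fin N → Euc d) : Prop :=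
  ∀ c c' : Contact N, c ≠ c' → gap ε c X ≤ η → η < gap ε c' X

/-- Configurations without contact, with velocities bounded by `r`, and such that at most one
contact may occur before the time `δ`. -/
structure Regular (ε δ r : ℝ) (Z : Config d N) : Prop where
  gap_pos : ∀ c, 0 < gap ε c Z.1
  speed : famNorm Z.2 ≤ r
  isolated : Isolated ε (4 * (r * δ)) Z.1

lemma measurableSet_regular (ε δ r : ℝ) :
    MeasurableSet {Z : Config d N | Regular ε δ r Z} := by
  have hg : ∀ c : Contact N, Measurable fun Z : Config d N => gap ε c Z.1 := fun c =>
    (continuous_gap ε c).measurable.comp measurable_fst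
  have : {Z : Config d N | Regular ε δ r Z} = (⋂ c, {Z | 0 < gap ε c Z.1}) ∩
      {Z | famNorm Z.2 ≤ r} ∩ ⋂ c, ⋂ c', {Z | c ≠ c' →
        gap ε c Z.1 ≤ 4 * (r * δ) → 4 * (r * δ) < gap ε c' Z.1} := by
    ext Z
    simp only [Set.mem_inter_iff, Set.mem_iInter, Set.mem_ofPred_eq]
    exact ⟨fun h => ⟨⟨h.1, h.2⟩, h.3⟩, fun h => ⟨h.1.1, h.1.2, h.2⟩⟩
  rw [this]
  refine ((MeasurableSet.iInter fun c => measurableSet_lt measurable_const (hg c)).inter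
    (measurableSet_le (continuous_famNorm.measurable.comp measurable_snd) measurable_const)).inter
    (MeasurableSet.iInter fun c => MeasurableSet.iInter fun c' => ?_)
  refine MeasurableSet.imp (MeasurableSet.const _) (MeasurableSet.imp ?_ ?_)
  · exact measurableSet_le (hg c) measurable_const
  · exact measurableSet_lt measurable_const (hg c')

/-- The motion during the time `δ`, on the regular configurations. -/
def stepMap (ε δ : ℝ) (Z : Config d N) : Config d N :=
  freeFlow δ Z + ∑ c, (hit ε δ c).indicator (fun Z => hitStep ε δ c Z - freeFlow δ Z) Z

lemma measurable_stepMap (ε δ : ℝ) : Measurable (stepMap (d := d) (N := N) ε δ) := by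
  unfold stepMap
  refine Measurable.add (by fun_prop) (Finset.measurable_sum _ fun c _ => ?_)
  exact ((measurable_hitStep ε δ c).sub (by fun_prop)).indicator (measurableSet_hit ε δ c)

/-- The trajectory during a short time when a contact takes place. -/
def hitPath (ε : ℝ) (c : Contact N) (Z : Config d N) (u : ℝ) : Config d N :=
  if u < contactTime ε c Z then freeFlow u Z
  else freeFlow (u - contactTime ε c Z) (collide ε c (freeFlow (contactTime ε c Z) Z))

lemma norm_hitPath_sub_le (hε : 0 < ε) (hδ : 0 < δ) {c : Contact N} (hc : Z ∈ hit ε δ c)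
    (hZ : famNorm Z.2 ≤ r) {u : ℝ} (hu : 0 ≤ u) (huδ : u ≤ δ) (l : Fin N) :
    ‖(hitPath ε c Z u).1 l - Z.1 l‖ ≤ r * δ := by
  have ht := contactTime_mem hδ hc
  have h0 := gap_contactTime hε hδ hc
  rw [hitPath]
  split_ifs with h
  · exact norm_freeFlow_sub_le hu huδ hZ l
  · push Not at h
    set τ := contactTime ε c Z
    set V' := (collide ε c (freeFlow τ Z)).2 with hV'
    have h1 : famNorm V' ≤ r := by
      rw [hV', famNorm_collide hε c h0]
      exact hZ
    have h2 : (freeFlow (u - τ) (collide ε c (freeFlow τ Z))).1 l - Z.1 l =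
        τ • Z.2 l + (u - τ) • V' l := by
      simp only [freeFlow, collide_fst, hV']
      abel
    rw [h2]
    refine (norm_add_le _ _).trans ?_
    rw [norm_smul, norm_smul, Real.norm_eq_abs, Real.norm_eq_abs, abs_of_pos ht.1,
      abs_of_nonneg (by linarith)]
    have h3 := (norm_le_famNorm V' l).trans h1
    have h4 := (norm_le_famNorm Z.2 l).trans hZ
    have hr : 0 ≤ r := (norm_nonneg _).trans h4
    nlinarith [mul_le_mul_of_nonneg_left h3 (by linarith : 0 ≤ u - τ),
      mul_le_mul_of_nonneg_left h4 ht.1.le, mul_le_mul_of_nonneg_left huδ hr]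

lemma hitPath_zero (hδ : 0 < δ) {c : Contact N} (hc : Z ∈ hit ε δ c) : hitPath ε c Z 0 = Z := by
  rw [hitPath, if_pos (contactTime_mem hδ hc).1, freeFlow_zero]

lemma hitPath_end (hδ : 0 < δ) {c : Contact N} (hc : Z ∈ hit ε δ c) :
    hitPath ε c Z δ = hitStep ε δ c Z := by
  rw [hitPath, if_neg (contactTime_mem hδ hc).2.not_gt, hitStep]

lemma famNorm_hitStep (hε : 0 < ε) (hδ : 0 < δ) {c : Contact N} (hc : Z ∈ hit ε δ c) :
    famNorm (hitStep ε δ c Z).2 = famNorm Z.2 :=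
  famNorm_collide hε c (gap_contactTime hε hδ hc)

/-- Positions move by at most rδ, so a gap varies by at most 2rδ; one that closes before δ starts
below 2rδ. This explains the threshold 4rδ in `Regular`: every other gap starts above 4rδ and
remains above 2rδ. -/
lemma gap_le_of_hit (hε : 0 < ε) (hδ : 0 < δ) {c : Contact N} (hc : Z ∈ hit ε δ c)
    (hZ : famNorm Z.2 ≤ r) : gap ε c Z.1 ≤ 2 * (r * δ) := by
  have ht := contactTime_mem hδ hc
  have h1 := abs_gap_sub_le ε c (fun l => norm_freeFlow_sub_le ht.1.le ht.2.le hZ l)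
  rw [gap_contactTime hε hδ hc, zero_sub, abs_neg] at h1
  exact (le_abs_self _).trans h1

/-- While a contact takes place, all others stay away. -/
lemma gap_pos_of_ne (hε : 0 < ε) (hδ : 0 < δ) (hZ : Regular ε δ r Z) {c c' : Contact N}
    (hc : Z ∈ hit ε δ c) (hne : c' ≠ c) {X : Fin N → Euc d} (hX : ∀ l, ‖X l - Z.1 l‖ ≤ r * δ) :
    2 * (r * δ) < gap ε c' X := by
  have h1 := gap_le_of_hit hε hδ hc hZ.speed
  have h2 := hZ.isolated c c' hne.symm (by linarith [mul_nonneg_of_speed_le hδ hZ.speed])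
  have h3 := (abs_le.1 (abs_gap_sub_le ε c' hX)).1
  linarith

lemma hit_unique (hε : 0 < ε) (hδ : 0 < δ) (hZ : Regular ε δ r Z) {c c' : Contact N}
    (hc : Z ∈ hit ε δ c) (hne : c' ≠ c) : Z ∉ hit ε δ c' := by
  intro hc'
  have h0 := mul_nonneg_of_speed_le hδ hZ.speed
  have h1 := gap_le_of_hit hε hδ hc' hZ.speed
  have h2 := gap_pos_of_ne hε hδ hZ hc hne (X := Z.1) (fun l => by simpa using h0)
  linarith

lemma stepMap_of_hit (hε : 0 < ε) (hδ : 0 < δ) (hZ : Regular ε δ r Z) {c : Contact N}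
    (hc : Z ∈ hit ε δ c) : stepMap ε δ Z = hitStep ε δ c Z := by
  rw [stepMap, Finset.sum_eq_single c, Set.indicator_of_mem hc, add_sub_cancel]
  · intro c' _ hne
    exact Set.indicator_of_notMem (hit_unique hε hδ hZ hc hne) _
  · simp

lemma stepMap_of_notMem_hit (h : ∀ c, Z ∉ hit ε δ c) : stepMap ε δ Z = freeFlow δ Z := by
  rw [stepMap, Finset.sum_eq_zero, add_zero]
  intro c _
  exact Set.indicator_of_notMem (h c) _

lemma famNorm_stepMap (hε : 0 < ε) (hδ : 0 < δ) (hZ : Regular ε δ r Z) :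
    famNorm (stepMap ε δ Z).2 = famNorm Z.2 := by
  by_cases h : ∃ c, Z ∈ hit ε δ c
  · obtain ⟨c, hc⟩ := h
    rw [stepMap_of_hit hε hδ hZ hc, famNorm_hitStep hε hδ hc]
  · push Not at h
    rw [stepMap_of_notMem_hit h, freeFlow_snd]

lemma norm_stepMap_sub_le (hε : 0 < ε) (hδ : 0 < δ) (hZ : Regular ε δ r Z) (l : Fin N) :
    ‖(stepMap ε δ Z).1 l - Z.1 l‖ ≤ r * δ := by
  by_cases h : ∃ c, Z ∈ hit ε δ c
  · obtain ⟨c, hc⟩ := h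
    rw [stepMap_of_hit hε hδ hZ hc, ← hitPath_end hδ hc]
    exact norm_hitPath_sub_le hε hδ hc hZ.speed hδ.le le_rfl l
  · push Not at h
    rw [stepMap_of_notMem_hit h]
    exact norm_freeFlow_sub_le hδ.le le_rfl hZ.speed l

lemma noContact_hitPath (hε : 0 < ε) (hδ : 0 < δ) (hZ : Regular ε δ r Z) {c : Contact N}
    (hc : Z ∈ hit ε δ c) {u : ℝ} (hu : 0 ≤ u) (huδ : u ≤ δ) (hne : u ≠ contactTime ε c Z) :
    NoContact ε (hitPath ε c Z u) := by
  refine noContact_iff.2 fun c' => ?_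
  have h0 := mul_nonneg_of_speed_le hδ hZ.speed
  by_cases hcc : c' = c
  · subst hcc
    rw [hitPath]
    split_ifs with h
    · exact gap_pos_of_lt_contactTime hε hδ hc h
    · exact gap_pos_after hε hδ hc (sub_pos.2 (lt_of_le_of_ne (not_lt.1 h) hne.symm))
  · linarith [gap_pos_of_ne hε hδ hZ hc hcc
      (fun l => norm_hitPath_sub_le hε hδ hc hZ.speed hu huδ l)]

lemma noContact_stepMap_of_hit (hε : 0 < ε) (hδ : 0 < δ) (hZ : Regular ε δ r Z) {c : Contact N}
    (hc : Z ∈ hit ε δ c) : NoContact ε (stepMap ε δ Z) := by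
  rw [stepMap_of_hit hε hδ hZ hc, ← hitPath_end hδ hc]
  exact noContact_hitPath hε hδ hZ hc hδ.le le_rfl (contactTime_mem hδ hc).2.ne'

lemma stepMap_mem_phaseSpace (hε : 0 < ε) (hδ : 0 < δ) (hZ : Regular ε δ r Z) :
    stepMap ε δ Z ∈ phaseSpace d N ε := by
  refine mem_phaseSpace_iff.2 fun c => ?_
  by_cases h : ∃ c, Z ∈ hit ε δ c
  · obtain ⟨c', hc⟩ := h
    exact (noContact_iff.1 (noContact_stepMap_of_hit hε hδ hZ hc) c).le
  · push Not at h
    rw [stepMap_of_notMem_hit h]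
    exact gap_nonneg_of_notMem_hit hε (hZ.gap_pos c) (h c) hδ.le le_rfl

lemma isForward_hitPath (hε : 0 < ε) (hδ : 0 < δ) (hZ : Regular ε δ r Z) {c : Contact N}
    (hc : Z ∈ hit ε δ c) : IsForward ε (hitPath ε c Z) δ := by
  have ht := contactTime_mem hδ hc
  have hpost : ∀ u, contactTime ε c Z ≤ u → hitPath ε c Z u =
      freeFlow (u - contactTime ε c Z) (collide ε c (freeFlow (contactTime ε c Z) Z)) :=
    fun u hu => if_neg hu.not_gt
  have hpre : ∀ u, u < contactTime ε c Z → hitPath ε c Z u = freeFlow u Z := fun u hu => if_pos hu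
  constructor
  · intro t h0 htδ
    rcases lt_or_ge t (contactTime ε c Z) with h | h
    · filter_upwards [Ioo_mem_nhdsGT h] with u hu
      rw [hpre u hu.2, hpre t h, freeFlow_add]
      congr 1
      ring
    · filter_upwards [self_mem_nhdsWithin] with u hu
      rw [hpost u (h.trans (le_of_lt hu)), hpost t h, freeFlow_add]
      congr 1
      ring
  · intro t h0 htδ
    rcases lt_trichotomy t (contactTime ε c Z) with h | h | h
    · refine ⟨_, .inl ⟨noContact_hitPath hε hδ hZ hc h0.le htδ h.ne, rfl⟩, ?_⟩
      filter_upwards [self_mem_nhdsWithin] with u hu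
      rw [hpre u (lt_trans hu h), hpre t h, freeFlow_add]
      congr 1
      ring
    · refine ⟨freeFlow t Z, eventRule_iff.2 (.inr ⟨c, ⟨?_, fun c' hne => ?_⟩, ?_⟩), ?_⟩
      · rw [h]; exact gap_contactTime hε hδ hc
      · linarith [gap_pos_of_ne hε hδ hZ hc hne
          (fun l => norm_freeFlow_sub_le h0.le htδ hZ.speed l), mul_nonneg_of_speed_le hδ hZ.speed]
      · rw [hpost t h.ge, h, sub_self, freeFlow_zero]
      · filter_upwards [self_mem_nhdsWithin] with u hu
        rw [hpre u (h ▸ hu), freeFlow_add, sub_add_cancel]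
    · refine ⟨_, .inl ⟨noContact_hitPath hε hδ hZ hc h0.le htδ h.ne', rfl⟩, ?_⟩
      filter_upwards [Ioo_mem_nhdsLT h] with u hu
      rw [hpost u hu.1.le, hpost t h.le, freeFlow_add]
      congr 1
      ring

/-- Contacts along a free motion without transversal contact have no effect. -/
lemma isForward_freeFlow (hε : 0 < ε) (hδ : 0 < δ) (hZ : Regular ε δ r Z)
    (hc : ∀ c, Z ∉ hit ε δ c) (hend : NoContact ε (freeFlow δ Z)) :
    IsForward ε (fun u => freeFlow u Z) δ := by
  constructor
  · intro t h0 htδ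
    refine Eventually.of_forall fun u => ?_
    rw [freeFlow_add, sub_add_cancel]
  · intro t h0 htδ
    refine ⟨freeFlow t Z, ?_, Eventually.of_forall fun u => by rw [freeFlow_add, sub_add_cancel]⟩
    -- The final time is treated apart: a transversal contact exactly at time δ does not belong to
    -- `hit`, hence the hypothesis `hend`.
    rcases htδ.eq_or_lt with rfl | htδ
    · exact .inl ⟨hend, rfl⟩
    by_cases h : ∃ c, gap ε c (freeFlow t Z).1 = 0
    · obtain ⟨c, hct⟩ := h
      refine eventRule_iff.2 (.inr ⟨c, ⟨hct, fun c' hne => ?_⟩,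
        (collide_eq_self_of_notMem_hit hε (hZ.gap_pos c) (hc c) h0 htδ hct).symm⟩)
      have hl := fun l => norm_freeFlow_sub_le h0.le htδ.le hZ.speed l
      have h1 := (abs_le.1 (abs_gap_sub_le ε c hl)).1
      have h2 := (abs_le.1 (abs_gap_sub_le ε c' hl)).1
      have h3 := mul_nonneg_of_speed_le hδ hZ.speed
      have h4 := hZ.isolated c c' hne.symm (by linarith)
      linarith
    · push Not at h
      exact .inl ⟨noContact_iff.2 fun c => lt_of_le_of_ne
        (gap_nonneg_of_notMem_hit hε (hZ.gap_pos c) (hc c) h0.le htδ.le) (h c).symm, rfl⟩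

lemma reach_stepMap (hε : 0 < ε) (hδ : 0 < δ) (hZ : Regular ε δ r Z)
    (hend : NoContact ε (stepMap ε δ Z)) : Reach ε δ Z (stepMap ε δ Z) := by
  by_cases h : ∃ c, Z ∈ hit ε δ c
  · obtain ⟨c, hc⟩ := h
    exact ⟨_, isForward_hitPath hε hδ hZ hc, hitPath_zero hδ hc, by
      rw [hitPath_end hδ hc, stepMap_of_hit hε hδ hZ hc]⟩
  · push Not at h
    rw [stepMap_of_notMem_hit h] at hend ⊢
    exact ⟨_, isForward_freeFlow hε hδ hZ h hend, freeFlow_zero Z, rfl⟩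

/-- On the regular configurations the motion during a short time does not increase volumes. -/
theorem volume_regular_inter_stepMap_le (hε : 0 < ε) (hδ : 0 < δ) {S : Set (Config d N)}
    (hS : MeasurableSet S) :
    volume ({Z | Regular ε δ r Z} ∩ stepMap ε δ ⁻¹' S) ≤ phaseMeasure d N ε S := by
  let A : Option (Contact N) → Set (Config d N) := fun o => o.elim (⋂ c, (hit ε δ c)ᶜ) (hit ε δ)
  let f : Option (Contact N) → Config d N → Config d N :=
    fun o => o.elim (freeFlow δ) (hitStep ε δ)
  -- `B o` contains the image of the regular part of `A o`: it prescribes which contact, if any, the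
  -- reversed motion undergoes. These sets are disjoint, so the volume bounds on the pieces add up
  -- to a bound by the volume of S in the phase space.
  let B : Option (Contact N) → Set (Config d N) := fun o => o.elim
    (⋂ c, rev ⁻¹' (hit ε δ c)ᶜ)
    (fun c => rev ⁻¹' hit ε δ c ∩ ⋂ c', {Z | c' ≠ c → Z ∈ rev ⁻¹' (hit ε δ c')ᶜ})
  have hhit := fun c => measurableSet_hit (d := d) (N := N) ε δ c
  have hBm : ∀ o, MeasurableSet (B o) := by
    rintro (_ | c)
    · exact MeasurableSet.iInter fun c => measurable_rev (hhit c).compl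
    · exact (measurable_rev (hhit c)).inter (MeasurableSet.iInter fun c' =>
        MeasurableSet.imp (MeasurableSet.const _) (measurable_rev (hhit c').compl))
  have hD := measurableSet_phaseSpace (d := d) (N := N) ε
  have hTm : ∀ o, MeasurableSet (S ∩ phaseSpace d N ε ∩ B o) := fun o => (hS.inter hD).inter (hBm o)
  have hmem : ∀ o Z, Regular ε δ r Z → Z ∈ A o → stepMap ε δ Z = f o Z ∧ f o Z ∈ B o := by
    rintro (_ | c) Z hZ hA
    · have hA : ∀ c, Z ∉ hit ε δ c := fun c => Set.mem_iInter.1 hA c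
      refine ⟨stepMap_of_notMem_hit hA, Set.mem_iInter.2 fun c hc => ?_⟩
      -- A hit in the reversed motion would make the reversed free flow penetrate; but this flow
      -- retraces the forward free motion, whose gaps are nonnegative.
      obtain ⟨u, h1, h2, h3⟩ := exists_gap_neg hε hδ hc
      have h4 := gap_nonneg_of_notMem_hit hε (hZ.gap_pos c) (hA c) (u := δ - u)
        (by linarith) (by linarith)
      have h5 : freeFlow u (rev (freeFlow δ Z)) = rev (freeFlow (δ - u) Z) := by
        rw [rev_freeFlow, rev_freeFlow, freeFlow_add]
        congr 1
        ring
      have h3 : gap ε c (freeFlow u (rev (freeFlow δ Z))).1 < 0 := h3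
      rw [h5, rev_fst] at h3
      linarith
    · refine ⟨stepMap_of_hit hε hδ hZ hA, rev_hitStep_mem hε hδ hA, Set.mem_iInter.2 ?_⟩
      intro c' hne hc'
      -- At the end of the step the other gaps still exceed 2rδ, which is too much to be closed by
      -- the reversed motion before δ.
      have hl := norm_stepMap_sub_le hε hδ hZ
      rw [stepMap_of_hit hε hδ hZ hA] at hl
      have h1 := gap_pos_of_ne hε hδ hZ hA hne hl
      have h2 := gap_le_of_hit hε hδ hc' (r := r) (by
        rw [rev_snd, famNorm_neg]
        exact (famNorm_hitStep hε hδ hA).le.trans hZ.speed)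
      rw [rev_fst] at h2
      exact absurd h1 (not_lt.2 h2)
  have hvol : ∀ o, volume (A o ∩ f o ⁻¹' (S ∩ phaseSpace d N ε ∩ B o)) ≤
      volume (S ∩ phaseSpace d N ε ∩ B o) := by
    rintro (_ | c)
    · refine (measure_mono Set.inter_subset_right).trans_eq ?_
      exact (measurePreserving_freeFlow δ).measure_preimage (hTm none).nullMeasurableSet
    · have h1 := lintegral_hitStep hε hδ c
        ((measurable_one : Measurable (1 : Config d N → ℝ≥0∞)).indicator (hTm (some c)))
      rw [lintegral_indicator_one (hTm _), Measure.restrict_apply (hTm _)] at h1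
      have h2 : ∀ Z, (S ∩ phaseSpace d N ε ∩ B (some c)).indicator (1 : Config d N → ℝ≥0∞)
          (hitStep ε δ c Z) = (hitStep ε δ c ⁻¹' (S ∩ phaseSpace d N ε ∩ B (some c))).indicator
          (1 : Config d N → ℝ≥0∞) Z := fun Z => rfl
      simp_rw [h2] at h1
      have h3 := measurable_hitStep ε δ c (hTm (some c))
      rw [lintegral_indicator_one h3, Measure.restrict_apply h3, Set.inter_comm] at h1
      exact h1.le.trans (measure_mono Set.inter_subset_left)
  have hdisj : Pairwise (Function.onFun Disjoint fun o => S ∩ phaseSpace d N ε ∩ B o) := by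
    intro o o' hne
    refine Set.disjoint_left.2 fun Z hZ hZ' => ?_
    replace hZ := hZ.2
    replace hZ' := hZ'.2
    rcases o with _ | c <;> rcases o' with _ | c'
    · exact hne rfl
    · exact Set.mem_iInter.1 hZ c' hZ'.1
    · exact Set.mem_iInter.1 hZ' c hZ.1
    · exact Set.mem_iInter.1 hZ.2 c' (fun h => hne (by rw [h])) hZ'.1
  have hcover : {Z | Regular ε δ r Z} ∩ stepMap ε δ ⁻¹' S ⊆
      ⋃ o, A o ∩ f o ⁻¹' (S ∩ phaseSpace d N ε ∩ B o) := by
    rintro Z ⟨hZ, hZS⟩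
    obtain ⟨o, ho⟩ : ∃ o, Z ∈ A o := by
      by_cases h : ∃ c, Z ∈ hit ε δ c
      · obtain ⟨c, hc⟩ := h
        exact ⟨some c, hc⟩
      · push Not at h
        exact ⟨none, Set.mem_iInter.2 h⟩
    obtain ⟨h1, h2⟩ := hmem o Z hZ ho
    have h3 := stepMap_mem_phaseSpace hε hδ hZ
    refine Set.mem_iUnion.2 ⟨o, ho, ⟨?_, ?_⟩, h2⟩
    · rw [← h1]; exact hZS
    · rw [← h1]; exact h3
  calc _ ≤ volume (⋃ o, A o ∩ f o ⁻¹' (S ∩ phaseSpace d N ε ∩ B o)) := measure_mono hcover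
    _ ≤ ∑' o, volume (A o ∩ f o ⁻¹' (S ∩ phaseSpace d N ε ∩ B o)) := measure_iUnion_le _
    _ ≤ ∑' o, volume (S ∩ phaseSpace d N ε ∩ B o) := ENNReal.tsum_le_tsum hvol
    _ = volume (⋃ o, S ∩ phaseSpace d N ε ∩ B o) := (measure_iUnion hdisj hTm).symm
    _ ≤ volume (S ∩ phaseSpace d N ε) :=
        measure_mono (Set.iUnion_subset fun o => Set.inter_subset_left)
    _ = _ := (Measure.restrict_apply hS).symm

end Step

/-! ### Configurations close to two contacts are rare -/

section Near

variable {d : ℕ}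

lemma volume_shell_le [NeZero d] {ε : ℝ} (hε : 0 < ε) : ∃ K : ℝ≥0∞, K ≠ ∞ ∧
    ∀ η, 0 < η → η ≤ 1 → ∀ p : Euc d,
      volume {x : Euc d | ε ≤ ‖x - p‖ ∧ ‖x - p‖ ≤ ε + η} ≤ K * ENNReal.ofReal η := by
  refine ⟨ENNReal.ofReal ((ε + 1) ^ d - ε ^ d) * volume (Metric.ball (0 : Euc d) 1),
    ENNReal.mul_ne_top ENNReal.ofReal_ne_top measure_ball_lt_top.ne, fun η h0 h1 p => ?_⟩
  have hdim : Module.finrank ℝ (Euc d) = d := by simp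
  have e : {x : Euc d | ε ≤ ‖x - p‖ ∧ ‖x - p‖ ≤ ε + η} =
      Metric.closedBall p (ε + η) \ Metric.ball p ε := by
    ext x
    simp only [Set.mem_ofPred_eq, Set.mem_sdiff, Metric.mem_closedBall, Metric.mem_ball,
      dist_eq_norm, not_lt]
    exact and_comm
  have hsub : Metric.ball p ε ⊆ Metric.closedBall p (ε + η) :=
    Metric.ball_subset_closedBall.trans (Metric.closedBall_subset_closedBall (by linarith))
  rw [e, measure_sdiff hsub measurableSet_ball.nullMeasurableSet measure_ball_lt_top.ne,
    Measure.addHaar_closedBall _ _ (by linarith), Measure.addHaar_ball _ _ hε.le, hdim,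
    ← ENNReal.sub_mul (fun _ _ => measure_ball_lt_top.ne), mul_right_comm,
    ← ENNReal.ofReal_sub _ (by positivity)]
  gcongr
  have hm : ε ^ d ≤ (ε + 1) ^ d := pow_le_pow_left₀ hε.le (by linarith) _
  rw [← ENNReal.ofReal_mul (by linarith)]
  refine ENNReal.ofReal_le_ofReal ?_
  -- On [ε, ε + 1] the convex function x ↦ x ^ d lies below its chord, so the volume of the shell is
  -- at most linear in η.
  have hc := (convexOn_pow (𝕜 := ℝ) d).2 (Set.mem_Ici.2 hε.le)
    (Set.mem_Ici.2 (by linarith : (0 : ℝ) ≤ ε + 1)) (by linarith : (0 : ℝ) ≤ 1 - η) h0.le (by ring)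
  simp only [smul_eq_mul] at hc
  have : (1 - η) * ε + η * (ε + 1) = ε + η := by ring
  rw [this] at hc
  nlinarith

lemma volume_slab_le [NeZero d] (ε R : ℝ) : ∃ K : ℝ≥0∞, K ≠ ∞ ∧ ∀ η : ℝ,
    volume {x : Euc d | ‖x‖ ≤ R ∧ ε / 2 ≤ inner ℝ x (e₁ d) ∧ inner ℝ x (e₁ d) ≤ ε / 2 + η} ≤
      K * ENNReal.ofReal η := by
  refine ⟨∏ _i ∈ (Finset.univ : Finset (Fin d)).erase 0, ENNReal.ofReal (2 * R),
    ENNReal.prod_ne_top fun _ _ => ENNReal.ofReal_ne_top, fun η => ?_⟩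
  set a : Fin d → ℝ := fun i => if i = 0 then ε / 2 else -R
  set b : Fin d → ℝ := fun i => if i = 0 then ε / 2 + η else R
  have hsub : {x : Euc d | ‖x‖ ≤ R ∧ ε / 2 ≤ inner ℝ x (e₁ d) ∧ inner ℝ x (e₁ d) ≤ ε / 2 + η} ⊆
      (WithLp.ofLp : Euc d → (Fin d → ℝ)) ⁻¹' Set.univ.pi fun i => Set.Icc (a i) (b i) := by
    rintro x ⟨h1, h2, h3⟩
    have hx : inner ℝ x (e₁ d) = x 0 := by simp [e₁, EuclideanSpace.inner_single_right]
    rw [hx] at h2 h3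
    intro i _
    by_cases hi : i = 0
    · subst hi
      simp only [a, b, if_true]
      exact ⟨h2, h3⟩
    · simp only [a, b, if_neg hi]
      have := (EuclideanSpace.norm_eq x ▸ Real.abs_le_sqrt (Finset.single_le_sum
        (f := fun j => ‖x j‖ ^ 2) (fun j _ => sq_nonneg _) (Finset.mem_univ i)) :
          |‖x i‖| ≤ ‖x‖)
      rw [abs_norm] at this
      exact abs_le.1 (this.trans h1)
  have hm : MeasurableSet (Set.univ.pi fun i => Set.Icc (a i) (b i)) :=
    MeasurableSet.univ_pi fun i => measurableSet_Icc
  refine (measure_mono hsub).trans ?_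
  rw [(PiLp.volume_preserving_ofLp (Fin d)).measure_preimage hm.nullMeasurableSet, volume_pi_pi,
    ← Finset.mul_prod_erase _ _ (Finset.mem_univ (0 : Fin d)), mul_comm]
  simp only [Real.volume_Icc]
  gcongr with i hi
  · simp only [a, b, if_neg (Finset.ne_of_mem_erase hi)]
    ring_nf
    rfl
  · simp [a, b]

/-- Positions in a ball. -/
def posBox (d N : ℕ) (R : ℝ) : Set (Fin N → Euc d) := {X | ∀ l, ‖X l‖ ≤ R}

lemma measurableSet_posBox (N : ℕ) (R : ℝ) : MeasurableSet (posBox d N R) := by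
  have : posBox d N R = ⋂ l, {X | ‖X l‖ ≤ R} := by
    ext X
    simp [posBox]
  rw [this]
  exact MeasurableSet.iInter fun l => measurableSet_le (by fun_prop) measurable_const

lemma volume_posBox_lt_top (N : ℕ) (R : ℝ) : volume (posBox d N R) < ∞ := by
  have hsub : posBox d N R ⊆ Metric.closedBall (0 : Fin N → Euc d) (max R 0) := by
    intro X hX
    rw [mem_closedBall_zero_iff, pi_norm_le_iff_of_nonneg (le_max_right _ _)]
    exact fun l => (hX l).trans (le_max_left _ _)
  exact (measure_mono hsub).trans_lt measure_closedBall_lt_top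

/-- Fubini in the position of the particle a. The condition T ignores this position, so `posBox ∩ T`
is a product with a ball, whereas S leaves at most a volume K of the ball. The product with the
volume of the ball avoids a division. -/
lemma volume_inter_mul_le {N : ℕ} (a : Fin N) {R : ℝ} {K : ℝ≥0∞} {S T : Set (Fin N → Euc d)}
    (hSm : MeasurableSet S) (hTm : MeasurableSet T)
    (hT : ∀ X x, X ∈ T ↔ Function.update X a x ∈ T)
    (hS : ∀ X, volume {x : Euc d | ‖x‖ ≤ R ∧ Function.update X a x ∈ S} ≤ K) :
    volume (posBox d N R ∩ T ∩ S) * volume (Metric.closedBall (0 : Euc d) R) ≤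
      K * volume (posBox d N R ∩ T) := by
  obtain ⟨n, rfl⟩ : ∃ n, N = n + 1 := Nat.exists_eq_succ_of_ne_zero (by
    rintro rfl; exact a.elim0)
  have hBm := measurableSet_posBox (d := d) (n + 1) R
  set T' : Set (Fin n → Euc d) :=
    posBox d n R ∩ (fun X => (a.insertNth 0 X : Fin (n + 1) → Euc d)) ⁻¹' T with hT'
  have hT'm : MeasurableSet T' := (measurableSet_posBox n R).inter
    ((by fun_prop : Measurable fun X : Fin n → Euc d => (a.insertNth 0 X : Fin (n + 1) → Euc d))
      hTm)
  have hbox : ∀ x X, (a.insertNth x X : Fin (n + 1) → Euc d) ∈ posBox d (n + 1) R ↔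
      ‖x‖ ≤ R ∧ X ∈ posBox d n R := by
    intro x X
    simp [posBox, Fin.forall_iff_succAbove a]
  have hcyl : ∀ x X, (a.insertNth x X : Fin (n + 1) → Euc d) ∈ T ↔
      (a.insertNth 0 X : Fin (n + 1) → Euc d) ∈ T := by
    intro x X
    rw [hT (a.insertNth 0 X) x, Fin.update_insertNth]
  have hball : MeasurableSet {x : Euc d | ‖x‖ ≤ R} :=
    measurableSet_le (by fun_prop) measurable_const
  have e1 : volume (posBox d (n + 1) R ∩ T) =
      volume (Metric.closedBall (0 : Euc d) R) * volume T' := by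
    rw [← lintegral_indicator_one (hBm.inter hTm), lintegral_insertNth a
      (measurable_one.indicator (hBm.inter hTm)), ← lintegral_indicator_one hT'm,
      ← lintegral_const_mul _ (measurable_one.indicator hT'm)]
    refine lintegral_congr fun X => ?_
    have : ∀ x, (posBox d (n + 1) R ∩ T).indicator (1 : (Fin (n + 1) → Euc d) → ℝ≥0∞)
        (a.insertNth x X) = T'.indicator 1 X * {x : Euc d | ‖x‖ ≤ R}.indicator 1 x := by
      intro x
      have hiff : (a.insertNth x X : Fin (n + 1) → Euc d) ∈ posBox d (n + 1) R ∩ T ↔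
          X ∈ T' ∧ x ∈ {x : Euc d | ‖x‖ ≤ R} := by
        simp only [Set.mem_inter_iff, hbox, hcyl x X, hT', Set.mem_preimage, Set.mem_ofPred_eq]
        tauto
      by_cases h1 : X ∈ T'
      · by_cases h2 : x ∈ {x : Euc d | ‖x‖ ≤ R}
        · rw [Set.indicator_of_mem (hiff.2 ⟨h1, h2⟩), Set.indicator_of_mem h1,
            Set.indicator_of_mem h2, Pi.one_apply, Pi.one_apply, Pi.one_apply, mul_one]
        · rw [Set.indicator_of_notMem (fun h => h2 (hiff.1 h).2), Set.indicator_of_notMem h2,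
            mul_zero]
      · rw [Set.indicator_of_notMem (fun h => h1 (hiff.1 h).1), Set.indicator_of_notMem h1,
          zero_mul]
    simp_rw [this]
    rw [lintegral_const_mul _ (measurable_one.indicator hball), lintegral_indicator_one hball,
      mul_comm]
    congr 2
    ext x
    exact mem_closedBall_zero_iff.symm
  have e2 : volume (posBox d (n + 1) R ∩ T ∩ S) ≤ K * volume T' := by
    rw [← lintegral_indicator_one ((hBm.inter hTm).inter hSm), lintegral_insertNth a
      (measurable_one.indicator ((hBm.inter hTm).inter hSm)), ← lintegral_indicator_one hT'm,
      ← lintegral_const_mul _ (measurable_one.indicator hT'm)]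
    refine lintegral_mono fun X => ?_
    by_cases h1 : X ∈ T'
    · rw [Set.indicator_of_mem h1, Pi.one_apply, mul_one]
      have h2 : MeasurableSet {x : Euc d | ‖x‖ ≤ R ∧ Function.update (a.insertNth 0 X) a x ∈ S} := by
        refine hball.inter ?_
        have h3 : Measurable fun x : Euc d => Function.update
            (a.insertNth 0 X : Fin (n + 1) → Euc d) a x := measurable_update _
        exact h3 hSm
      refine le_trans ?_ (hS (a.insertNth 0 X))
      rw [← lintegral_indicator_one h2]
      refine lintegral_mono fun x => ?_
      by_cases h4 : (a.insertNth x X : Fin (n + 1) → Euc d) ∈ posBox d (n + 1) R ∩ T ∩ S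
      · rw [Set.indicator_of_mem h4, Set.indicator_of_mem]
        · rfl
        · exact ⟨((hbox x X).1 h4.1.1).1, by rw [Fin.update_insertNth]; exact h4.2⟩
      · rw [Set.indicator_of_notMem h4]
        exact zero_le
    · rw [Set.indicator_of_notMem h1, mul_zero]
      refine le_of_eq (lintegral_eq_zero_of_ae_eq_zero (Eventually.of_forall fun x => ?_))
      refine Set.indicator_of_notMem (fun h => h1 ?_) _
      exact ⟨((hbox x X).1 h.1.1).2, (hcyl x X).1 h.1.2⟩
  rw [e1]
  calc _ ≤ K * volume T' * volume (Metric.closedBall (0 : Euc d) R) := by gcongr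
    _ = _ := by ring

end Near

/-! ### Smallness of the set of positions near one or two contacts -/

section NearContacts

variable {d : ℕ} {N : ℕ}

/-- The particles involved in a contact. -/
def Involves : Contact N → Fin N → Prop
  | .inl p, a => a = p.1.1 ∨ a = p.1.2
  | .inr l, a => a = l

/-- A contact is determined by the set of its particles: a pair has two, a contact with the wall has
one. Moving a particle that belongs to only one of two contacts leaves the other gap unchanged. -/
lemma exists_involves_of_ne {c c' : Contact N} (h : c ≠ c') :
    ∃ a, (Involves c a ∧ ¬ Involves c' a) ∨ (Involves c' a ∧ ¬ Involves c a) := by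
  by_contra! hc
  apply h
  have hc : ∀ a, Involves c a ↔ Involves c' a := fun a => ⟨(hc a).1, (hc a).2⟩
  rcases c with ⟨⟨j, k⟩, hjk⟩ | l <;> rcases c' with ⟨⟨j', k'⟩, hjk'⟩ | l'
  · have h1 := (hc j).1 (.inl rfl)
    have h2 := (hc k).1 (.inr rfl)
    simp only [Involves] at h1 h2
    have hjk : j < k := hjk
    have hjk' : j' < k' := hjk'
    obtain rfl : j = j' := by omega
    obtain rfl : k = k' := by omega
    rfl
  · have h1 := (hc j).1 (.inl rfl)
    have h2 := (hc k).1 (.inr rfl)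
    simp only [Involves] at h1 h2
    exact absurd (h1.trans h2.symm) (ne_of_lt hjk)
  · have h1 := (hc j').2 (.inl rfl)
    have h2 := (hc k').2 (.inr rfl)
    simp only [Involves] at h1 h2
    exact absurd (h1.trans h2.symm) (ne_of_lt hjk')
  · have h1 := (hc l).1 rfl
    simp only [Involves] at h1
    rw [h1]

variable [NeZero d] {ε : ℝ}

lemma gap_update {c : Contact N} {a : Fin N} (h : ¬ Involves c a) (X : Fin N → Euc d) (x : Euc d) :
    gap ε c (Function.update X a x) = gap ε c X := by
  rcases c with ⟨⟨j, k⟩, hjk⟩ | l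
  · simp only [Involves, not_or] at h
    simp only [gap, Function.update_of_ne (Ne.symm h.1), Function.update_of_ne (Ne.symm h.2)]
  · simp only [Involves] at h
    simp only [gap, Function.update_of_ne (Ne.symm h)]

/-- Positions for which the contact `c` is at distance at most `η`. -/
def near (ε η : ℝ) (c : Contact N) : Set (Fin N → Euc d) := {X | 0 ≤ gap ε c X ∧ gap ε c X ≤ η}

lemma measurableSet_near (η : ℝ) (c : Contact N) : MeasurableSet (near (d := d) ε η c) :=
  (measurableSet_le measurable_const (continuous_gap ε c).measurable).inter
    (measurableSet_le (continuous_gap ε c).measurable measurable_const)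

lemma exists_volume_update_near_le (hε : 0 < ε) (R : ℝ) : ∃ K : ℝ≥0∞, K ≠ ∞ ∧
    ∀ η, 0 < η → η ≤ 1 → ∀ (c : Contact N) (a : Fin N), Involves c a → ∀ X : Fin N → Euc d,
      volume {x : Euc d | ‖x‖ ≤ R ∧ Function.update X a x ∈ near ε η c} ≤
        K * ENNReal.ofReal η := by
  obtain ⟨K₁, h1, hK₁⟩ := volume_shell_le (d := d) hε
  obtain ⟨K₂, h2, hK₂⟩ := volume_slab_le (d := d) ε R
  refine ⟨K₁ + K₂, ENNReal.add_ne_top.2 ⟨h1, h2⟩, fun η h0 hη c a hca X => ?_⟩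
  rw [add_mul]
  rcases c with ⟨⟨j, k⟩, hjk⟩ | l
  · refine le_add_right ?_
    have hjk : j < k := hjk
    rcases hca with rfl | rfl
    · refine (measure_mono fun x hx => ?_).trans (hK₁ η h0 hη (X k))
      obtain ⟨-, h3, h4⟩ := hx
      simp only [gap, Function.update_self, Function.update_of_ne hjk.ne'] at h3 h4
      exact ⟨by linarith, by linarith⟩
    · refine (measure_mono fun x hx => ?_).trans (hK₁ η h0 hη (X j))
      obtain ⟨-, h3, h4⟩ := hx
      simp only [gap, Function.update_self, Function.update_of_ne hjk.ne] at h3 h4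
      rw [norm_sub_rev] at h3 h4
      exact ⟨by linarith, by linarith⟩
  · refine le_add_left ?_
    obtain rfl : a = l := hca
    refine (measure_mono fun x hx => ?_).trans (hK₂ η)
    obtain ⟨h5, h3, h4⟩ := hx
    simp only [gap, Function.update_self] at h3 h4
    exact ⟨h5, by linarith, by linarith⟩

lemma exists_involves (c : Contact N) : ∃ a, Involves c a := by
  rcases c with p | l
  · exact ⟨_, .inl rfl⟩
  · exact ⟨_, rfl⟩

/-- Integration over one particle of a contact gains a factor η. For two contacts the particle is
chosen in exactly one of them, so the other condition is unaffected and gains a second factor η when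
integrated in turn. The square is essential: it beats the number of time steps, of order 1/η. -/
lemma exists_volume_near_le (hε : 0 < ε) {R : ℝ} (hR : 0 < R) : ∃ K : ℝ≥0∞, K ≠ ∞ ∧
    ∀ η, 0 < η → η ≤ 1 →
      (∀ c : Contact N, volume (posBox d N R ∩ near ε η c) ≤ K * ENNReal.ofReal η) ∧
      ∀ c c' : Contact N, c ≠ c' → volume (posBox d N R ∩ (near ε η c ∩ near ε η c')) ≤
        K * ENNReal.ofReal η ^ 2 := by
  obtain ⟨K, hK, h⟩ := exists_volume_update_near_le (d := d) (N := N) hε R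
  set b := volume (Metric.closedBall (0 : Euc d) R) with hb
  have hb0 : b ≠ 0 := (Metric.measure_closedBall_pos volume _ hR).ne'
  have hbt : b ≠ ∞ := measure_closedBall_lt_top.ne
  set v := volume (posBox d N R) with hv
  have hvt : v ≠ ∞ := (volume_posBox_lt_top N R).ne
  have hKb : K / b ≠ ∞ := ENNReal.div_ne_top hK hb0
  refine ⟨max (K / b * v) (K / b * (K / b * v)), ?_, fun η h0 h1 => ?_⟩
  · have h2 := ENNReal.mul_ne_top hKb hvt
    exact (max_lt h2.lt_top (ENNReal.mul_lt_top hKb.lt_top h2.lt_top)).ne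
  have key : ∀ (c : Contact N) (a : Fin N), Involves c a → ∀ T : Set (Fin N → Euc d),
      MeasurableSet T → (∀ X x, X ∈ T ↔ Function.update X a x ∈ T) →
      volume (posBox d N R ∩ T ∩ near ε η c) ≤
        K / b * ENNReal.ofReal η * volume (posBox d N R ∩ T) := by
    intro c a hca T hTm hT
    have h2 := volume_inter_mul_le a (R := R) (measurableSet_near η c) hTm hT
      (h η h0 h1 c a hca)
    rw [← ENNReal.le_div_iff_mul_le (.inl hb0) (.inl hbt)] at h2
    refine h2.trans_eq ?_
    simp only [div_eq_mul_inv]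
    ring
  have hone : ∀ c : Contact N, volume (posBox d N R ∩ near ε η c) ≤
      K / b * v * ENNReal.ofReal η := by
    intro c
    obtain ⟨a, ha⟩ := exists_involves c
    have h2 := key c a ha Set.univ MeasurableSet.univ (by simp)
    rw [Set.inter_univ] at h2
    exact h2.trans_eq (by ring)
  have htwo : ∀ (c c' : Contact N) (a : Fin N), Involves c a → ¬ Involves c' a →
      volume (posBox d N R ∩ (near ε η c ∩ near ε η c')) ≤
        K / b * (K / b * v) * ENNReal.ofReal η ^ 2 := by
    intro c c' a hca hca'
    have h2 := key c a hca (near ε η c') (measurableSet_near η c')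
      (fun X x => by simp only [near, Set.mem_ofPred_eq, gap_update hca'])
    have h3 : posBox d N R ∩ (near ε η c ∩ near ε η c') =
        posBox d N R ∩ near ε η c' ∩ near ε η c := by
      rw [Set.inter_assoc, Set.inter_comm (near ε η c)]
    rw [h3]
    refine h2.trans ?_
    calc _ ≤ K / b * ENNReal.ofReal η * (K / b * v * ENNReal.ofReal η) := by
          gcongr
          exact hone c'
      _ = _ := by ring
  refine ⟨fun c => (hone c).trans ?_, fun c c' hne => ?_⟩
  · gcongr
    exact le_max_left _ _
  · obtain ⟨a, ⟨h2, h3⟩ | ⟨h2, h3⟩⟩ := exists_involves_of_ne hne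
    · refine (htwo c c' a h2 h3).trans ?_
      gcongr
      exact le_max_right _ _
    · rw [Set.inter_comm (near ε η c)]
      refine (htwo c' c a h2 h3).trans ?_
      gcongr
      exact le_max_right _ _

lemma volume_gap_eq_zero (hε : 0 < ε) (c : Contact N) :
    volume {X : Fin N → Euc d | gap ε c X = 0} = 0 := by
  have hbox : ∀ R : ℝ, 0 < R → volume (posBox d N R ∩ {X | gap ε c X = 0}) = 0 := by
    intro R hR
    obtain ⟨K, hK, h⟩ := exists_volume_near_le (d := d) (N := N) hε hR
    refine le_antisymm (ge_of_tendsto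
      (show Tendsto (fun η => K * ENNReal.ofReal η) (𝓝[>] 0) (𝓝 0) from ?_) ?_) zero_le
    · have h1 : Tendsto (fun η : ℝ => K * ENNReal.ofReal η) (𝓝 0) (𝓝 (K * ENNReal.ofReal 0)) :=
        ENNReal.Tendsto.const_mul (ENNReal.continuous_ofReal.tendsto 0) (.inr hK)
      rw [ENNReal.ofReal_zero, mul_zero] at h1
      exact h1.mono_left nhdsWithin_le_nhds
    · filter_upwards [Ioo_mem_nhdsGT (zero_lt_one' ℝ)] with η hη
      refine (measure_mono fun X hX => ?_).trans ((h η hη.1 hη.2.le).1 c)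
      have h2 : gap ε c X = 0 := hX.2
      exact ⟨hX.1, h2.ge, h2.le.trans hη.1.le⟩
  have hsub : {X : Fin N → Euc d | gap ε c X = 0} ⊆
      ⋃ n : ℕ, posBox d N (n + 1) ∩ {X | gap ε c X = 0} := by
    intro X hX
    obtain ⟨n, hn⟩ := exists_nat_ge ‖X‖
    exact Set.mem_iUnion.2 ⟨n, fun l => (norm_le_pi_norm X l).trans (by linarith), hX⟩
  exact measure_mono_null hsub (measure_iUnion_null fun n => hbox _ (by positivity))

/-- Almost all configurations have no contact. -/
lemma ae_noContact (hε : 0 < ε) : ∀ᵐ Z ∂phaseMeasure d N ε, NoContact ε Z := by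
  have h1 : ∀ c : Contact N, ∀ᵐ Z : Config d N, gap ε c Z.1 ≠ 0 := fun c =>
    
    Measure.quasiMeasurePreserving_fst.ae (compl_mem_ae_iff.2 (volume_gap_eq_zero hε c))
  filter_upwards [ae_restrict_mem (measurableSet_phaseSpace ε),
    ae_restrict_of_ae (ae_all_iff.2 h1)] with Z hZ h2
  exact noContact_iff.2 fun c => lt_of_le_of_ne (mem_phaseSpace_iff.1 hZ c) (h2 c).symm

/-- Configurations close to two contacts, with bounded positions and velocities. -/
def doubleNear (d N : ℕ) [NeZero d] (ε η r R : ℝ) : Set (Config d N) :=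
  {Z | (∀ c, 0 ≤ gap ε c Z.1) ∧ famNorm Z.2 ≤ r ∧ (∀ l, ‖Z.1 l‖ ≤ R) ∧ ¬ Isolated ε η Z.1}

lemma exists_volume_doubleNear_le (hε : 0 < ε) (r : ℝ) {R : ℝ} (hR : 0 < R) :
    ∃ K : ℝ≥0∞, K ≠ ∞ ∧ ∀ η, 0 < η → η ≤ 1 →
      volume (doubleNear d N ε η r R) ≤ K * ENNReal.ofReal η ^ 2 := by
  obtain ⟨K, hK, h⟩ := exists_volume_near_le (d := d) (N := N) hε hR
  set v := volume (posBox d N r) with hv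
  have hvt : v ≠ ∞ := (volume_posBox_lt_top N r).ne
  refine ⟨∑ _c : Contact N, ∑ _c' : Contact N, K * v, ?_, fun η h0 h1 => ?_⟩
  · simp only [Finset.sum_const, nsmul_eq_mul]
    exact ENNReal.mul_ne_top (by simp) (ENNReal.mul_ne_top (by simp) (ENNReal.mul_ne_top hK hvt))
  have hsub : doubleNear d N ε η r R ⊆ ⋃ c : Contact N, ⋃ c' : Contact N, {Z | c ≠ c' ∧
      Z ∈ (posBox d N R ∩ (near ε η c ∩ near ε η c')) ×ˢ posBox d N r} := by
    rintro Z ⟨h2, h3, h4, h5⟩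
    simp only [Isolated, not_forall, not_lt] at h5
    obtain ⟨c, c', hne, h6, h7⟩ := h5
    exact Set.mem_iUnion.2 ⟨c, Set.mem_iUnion.2 ⟨c', hne, ⟨h4, ⟨h2 c, h6⟩, h2 c', h7⟩,
      fun l => (norm_le_famNorm _ l).trans h3⟩⟩
  refine (measure_mono hsub).trans ((measure_iUnion_fintype_le _ _).trans ?_)
  rw [Finset.sum_mul]
  refine Finset.sum_le_sum fun c _ => (measure_iUnion_fintype_le _ _).trans ?_
  rw [Finset.sum_mul]
  refine Finset.sum_le_sum fun c' _ => ?_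
  by_cases hne : c = c'
  · simp [hne]
  · refine (measure_mono fun Z hZ => hZ.2).trans ?_
    rw [Measure.volume_eq_prod, Measure.prod_prod, mul_right_comm]
    gcongr
    exact (h η h0 h1).2 c c' hne

end NearContacts

/-! ### Alexander's theorem: almost everywhere existence, measurability and nonsingularity of the
flow -/

section Alexander

variable {d N : ℕ} [NeZero d] {ε : ℝ}

/-- The configurations whose first `n` images by the step map are regular. -/
def goodSet (d N : ℕ) [NeZero d] (ε δ r : ℝ) : ℕ → Set (Config d N)
  | 0 => {Z | Regular ε δ r Z}
  | n + 1 => {Z | Regular ε δ r Z} ∩ stepMap ε δ ⁻¹' goodSet d N ε δ r n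

lemma measurableSet_goodSet (δ r : ℝ) (n : ℕ) : MeasurableSet (goodSet d N ε δ r n) := by
  induction n with
  | zero => exact measurableSet_regular ε δ r
  | succ n ih => exact (measurableSet_regular ε δ r).inter (measurable_stepMap ε δ ih)

lemma Regular.noContact {δ r : ℝ} {Z : Config d N} (h : Regular ε δ r Z) : NoContact ε Z :=
  noContact_iff.2 h.gap_pos

lemma Regular.mem_phaseSpace {δ r : ℝ} {Z : Config d N} (h : Regular ε δ r Z) :
    Z ∈ phaseSpace d N ε := mem_phaseSpace_iff.2 fun c => (h.gap_pos c).le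

lemma regular_of_mem_goodSet {δ r : ℝ} {n : ℕ} {Z : Config d N} (h : Z ∈ goodSet d N ε δ r n) :
    Regular ε δ r Z := by
  cases n with
  | zero => exact h
  | succ n => exact h.1

lemma reach_of_mem_goodSet (hε : 0 < ε) {δ r : ℝ} (hδ : 0 < δ) {n : ℕ} {Z : Config d N}
    (h : Z ∈ goodSet d N ε δ r n) :
    Reach ε (n * δ) Z ((stepMap ε δ)^[n] Z) ∧ NoContact ε ((stepMap ε δ)^[n] Z) ∧
      famNorm ((stepMap ε δ)^[n] Z).2 = famNorm Z.2 := by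
  induction n generalizing Z with
  | zero =>
    refine ⟨⟨fun _ => Z, ⟨fun t h0 h1 => ?_, fun t h0 h1 => ?_⟩, rfl, rfl⟩, h.noContact, rfl⟩
    · simp at h1; linarith
    · simp at h1; linarith
  | succ n ih =>
    obtain ⟨h1, h2⟩ := h
    have h1 : Regular ε δ r Z := h1
    have h3 := ih h2
    rw [Function.iterate_succ_apply]
    refine ⟨?_, h3.2.1, h3.2.2.trans (famNorm_stepMap hε hδ h1)⟩
    have h4 := reach_stepMap hε hδ h1 (regular_of_mem_goodSet h2).noContact
    have h5 := h4.trans hδ.le h3.1 (by positivity)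
    rwa [show δ + n * δ = ((n + 1 : ℕ) : ℝ) * δ by push_cast; ring] at h5

/-- Iterates of the step map inherit the volume bound, with a constant that does not grow with n. In
particular preimages of null sets are null. -/
lemma volume_goodSet_inter_le (hε : 0 < ε) {δ r : ℝ} (hδ : 0 < δ) (n : ℕ) {A : Set (Config d N)}
    (hA : MeasurableSet A) :
    volume (goodSet d N ε δ r n ∩ (stepMap ε δ)^[n] ⁻¹' A) ≤ phaseMeasure d N ε A := by
  induction n with
  | zero =>
    rw [phaseMeasure, Measure.restrict_apply hA]
    refine measure_mono fun Z hZ => ⟨hZ.2, ?_⟩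
    exact (regular_of_mem_goodSet hZ.1).mem_phaseSpace
  | succ n ih =>
    have hm : MeasurableSet (goodSet d N ε δ r n ∩ (stepMap ε δ)^[n] ⁻¹' A) :=
      (measurableSet_goodSet δ r n).inter (((measurable_stepMap ε δ).iterate n) hA)
    refine (measure_mono ?_).trans ((volume_regular_inter_stepMap_le hε hδ (r := r) hm).trans
      ((Measure.restrict_apply_le _ _).trans ih))
    rintro Z ⟨⟨h1, h2⟩, h3⟩
    exact ⟨h1, h2, h3⟩

/-- Configurations of the phase space with bounded positions and velocities. -/
def phaseBox (d N : ℕ) [NeZero d] (ε r R : ℝ) : Set (Config d N) :=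
  {Z | Z ∈ phaseSpace d N ε ∧ famNorm Z.2 ≤ r ∧ ∀ l, ‖Z.1 l‖ ≤ R}

/-- A configuration fails either now or after one regular step, and the step does not increase
volumes; so the failures of the successive steps add up. The box grows by rδ at each step, which is
why R' replaces R. -/
lemma volume_phaseBox_diff_goodSet_le (hε : 0 < ε) {δ r : ℝ} (hδ : 0 < δ) (n : ℕ) {R R' : ℝ}
    (hR : R + n * (r * δ) ≤ R') (hr : 0 ≤ r) :
    volume (phaseBox d N ε r R \ goodSet d N ε δ r n) ≤
      (n + 1) * volume (phaseBox d N ε r R' \ {Z | Regular ε δ r Z}) := by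
  induction n generalizing R with
  | zero =>
    simp only [Nat.cast_zero, zero_mul, add_zero] at hR
    simp only [Nat.cast_zero, zero_add, one_mul]
    exact measure_mono fun Z hZ => ⟨⟨hZ.1.1, hZ.1.2.1, fun l => (hZ.1.2.2 l).trans hR⟩, hZ.2⟩
  | succ n ih =>
    have hrδ : 0 ≤ r * δ := by positivity
    have hbox : MeasurableSet (phaseBox d N ε r (R + r * δ)) := by
      refine (measurableSet_phaseSpace ε).inter (MeasurableSet.inter ?_ ?_)
      · exact measurableSet_le (continuous_famNorm.measurable.comp measurable_snd) measurable_const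
      · exact measurable_fst (measurableSet_posBox N (R + r * δ))
    have hm : MeasurableSet (phaseBox d N ε r (R + r * δ) \ goodSet d N ε δ r n) :=
      hbox.diff (measurableSet_goodSet δ r n)
    have hsub : phaseBox d N ε r R \ goodSet d N ε δ r (n + 1) ⊆
        (phaseBox d N ε r R' \ {Z | Regular ε δ r Z}) ∪ ({Z | Regular ε δ r Z} ∩ stepMap ε δ ⁻¹'
          (phaseBox d N ε r (R + r * δ) \ goodSet d N ε δ r n)) := by
      rintro Z ⟨⟨h1, h2, h3⟩, h4⟩
      by_cases hZ : Regular ε δ r Z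
      · refine .inr ⟨hZ, ⟨stepMap_mem_phaseSpace hε hδ hZ, ?_, fun l => ?_⟩, fun h => h4 ⟨hZ, h⟩⟩
        · exact (famNorm_stepMap hε hδ hZ).trans_le h2
        · have h5 := norm_stepMap_sub_le hε hδ hZ l
          have h6 := norm_le_norm_add_norm_sub' ((stepMap ε δ Z).1 l) (Z.1 l)
          have h7 := h3 l
          linarith
      · refine .inl ⟨⟨h1, h2, fun l => (h3 l).trans ?_⟩, hZ⟩
        have : 0 ≤ ((n + 1 : ℕ) : ℝ) * (r * δ) := by positivity
        linarith
    refine (measure_mono hsub).trans ((measure_union_le _ _).trans ?_)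
    calc _ ≤ volume (phaseBox d N ε r R' \ {Z | Regular ε δ r Z}) + (n + 1) *
          volume (phaseBox d N ε r R' \ {Z | Regular ε δ r Z}) := by
          gcongr
          refine (volume_regular_inter_stepMap_le hε hδ hm).trans
            ((Measure.restrict_apply_le _ _).trans (ih ?_))
          push_cast at hR
          linarith
      _ = _ := by push_cast; ring

/-- With n + 1 steps of length t / (n + 1), the bad set is covered by n + 2 pieces of volume at most
K (4rt / (n + 1))², and the total tends to 0. -/
lemma volume_phaseBox_diff_iUnion_goodSet (hε : 0 < ε) {t r R : ℝ} (ht : 0 < t) (hr : 0 < r)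
    (hR : 0 < R) :
    volume (phaseBox d N ε r R \ ⋃ n : ℕ, goodSet d N ε (t / (n + 1 : ℕ)) r (n + 1)) = 0 := by
  obtain ⟨K, hK, h⟩ := exists_volume_doubleNear_le (d := d) (N := N) hε r
    (R := R + r * t) (by positivity)
  have hlim : Tendsto (fun n : ℕ => ((n + 1 : ℕ) + 1) *
      (K * ENNReal.ofReal (4 * (r * (t / (n + 1 : ℕ)))) ^ 2)) atTop (𝓝 0) := by
    have h1 : Tendsto (fun n : ℕ => K * ENNReal.ofReal ((((n + 1 : ℕ) : ℝ) + 1) *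
        (4 * (r * (t / (n + 1 : ℕ)))) ^ 2)) atTop (𝓝 (K * ENNReal.ofReal 0)) := by
      refine ENNReal.Tendsto.const_mul ((ENNReal.continuous_ofReal.tendsto 0).comp ?_) (.inr hK)
      have h2 : Tendsto (fun n : ℕ => (4 * r * t) ^ 2 * (((n + 1 : ℕ) : ℝ)⁻¹ +
          ((n + 1 : ℕ) : ℝ)⁻¹ * ((n + 1 : ℕ) : ℝ)⁻¹)) atTop (𝓝 ((4 * r * t) ^ 2 * (0 + 0 * 0))) := by
        have h3 : Tendsto (fun n : ℕ => ((n + 1 : ℕ) : ℝ)⁻¹) atTop (𝓝 0) :=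
          tendsto_inv_atTop_nhds_zero_nat.comp (tendsto_add_atTop_nat 1)
        exact (h3.add (h3.mul h3)).const_mul _
      simp only [mul_zero, add_zero] at h2
      refine h2.congr fun n => ?_
      have : ((n + 1 : ℕ) : ℝ) ≠ 0 := by positivity
      field_simp
    rw [ENNReal.ofReal_zero, mul_zero] at h1
    refine h1.congr fun n => ?_
    rw [ENNReal.ofReal_mul (by positivity), ENNReal.ofReal_pow (by positivity),
      ENNReal.ofReal_add (by positivity) zero_le_one, ENNReal.ofReal_natCast, ENNReal.ofReal_one]
    ring
  refine le_antisymm (ge_of_tendsto hlim ?_) zero_le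
  have hsmall : ∀ᶠ n : ℕ in atTop, 4 * (r * (t / (n + 1 : ℕ))) ≤ 1 := by
    obtain ⟨m, hm⟩ := exists_nat_ge (4 * (r * t))
    filter_upwards [eventually_ge_atTop m] with n hn
    have : (m : ℝ) ≤ n := by exact_mod_cast hn
    have h1 : 4 * (r * (t / (n + 1 : ℕ))) = 4 * (r * t) / (n + 1 : ℕ) := by ring
    rw [h1, div_le_one (by positivity)]
    push_cast
    linarith
  filter_upwards [hsmall] with n hn
  set δ := t / (n + 1 : ℕ) with hδ
  have hδ0 : 0 < δ := by positivity
  have hnd : ((n + 1 : ℕ) : ℝ) * δ = t := by rw [hδ]; field_simp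
  have hsub : phaseBox d N ε r R \ ⋃ n : ℕ, goodSet d N ε (t / (n + 1 : ℕ)) r (n + 1) ⊆
      phaseBox d N ε r R \ goodSet d N ε δ r (n + 1) :=
    Set.sdiff_subset_sdiff_right (Set.subset_iUnion_of_subset n subset_rfl)
  refine (measure_mono hsub).trans ((volume_phaseBox_diff_goodSet_le hε hδ0 (n + 1)
    (R' := R + r * t) ?_ hr.le).trans ?_)
  · rw [← hnd]; apply le_of_eq; ring
  gcongr
  refine le_trans ?_ (h _ (by positivity) hn)
  have hnull : volume {Z : Config d N | Z ∈ phaseSpace d N ε ∧ ¬ NoContact ε Z} = 0 := by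
    have h1 := ae_noContact (d := d) (N := N) hε
    rw [phaseMeasure, ae_restrict_iff' (measurableSet_phaseSpace ε)] at h1
    simpa [ae_iff] using h1
  have hsub2 : phaseBox d N ε r (R + r * t) \ {Z | Regular ε δ r Z} ⊆
      doubleNear d N ε (4 * (r * δ)) r (R + r * t) ∪
        {Z | Z ∈ phaseSpace d N ε ∧ ¬ NoContact ε Z} := by
    rintro Z ⟨⟨h1, h2, h3⟩, h4⟩
    by_cases h5 : NoContact ε Z
    · refine .inl ⟨mem_phaseSpace_iff.1 h1, h2, h3, fun h6 => h4 ?_⟩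
      exact ⟨noContact_iff.1 h5, h2, h6⟩
    · exact .inr ⟨h1, h5⟩
  refine (measure_mono hsub2).trans ((measure_union_le _ _).trans ?_)
  rw [hnull, add_zero]

lemma ae_exists_mem_goodSet (hε : 0 < ε) {t : ℝ} (ht : 0 < t) :
    ∀ᵐ Z ∂phaseMeasure d N ε, ∃ p : ℕ × ℕ,
      Z ∈ goodSet d N ε (t / (p.1 + 1 : ℕ)) (p.2 + 1 : ℕ) (p.1 + 1) := by
  have h1 : ∀ m : ℕ, ∀ᵐ Z : Config d N, Z ∈ phaseBox d N ε (m + 1 : ℕ) (m + 1 : ℕ) →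
      ∃ n : ℕ, Z ∈ goodSet d N ε (t / (n + 1 : ℕ)) (m + 1 : ℕ) (n + 1) := by
    intro m
    have := volume_phaseBox_diff_iUnion_goodSet (d := d) (N := N) hε ht
      (r := (m + 1 : ℕ)) (R := (m + 1 : ℕ)) (by positivity) (by positivity)
    rw [← compl_mem_ae_iff] at this
    filter_upwards [this] with Z hZ hZ'
    by_contra hc
    exact hZ ⟨hZ', fun h => hc (Set.mem_iUnion.1 h)⟩
  filter_upwards [ae_restrict_mem (measurableSet_phaseSpace ε),
    ae_restrict_of_ae (ae_all_iff.2 h1)] with Z hZ h2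
  obtain ⟨m, hm⟩ := exists_nat_ge (max (famNorm Z.2) ‖Z.1‖)
  have hbox : Z ∈ phaseBox d N ε (m + 1 : ℕ) (m + 1 : ℕ) := by
    refine ⟨hZ, ?_, fun l => ?_⟩
    · push_cast
      linarith [le_max_left (famNorm Z.2) ‖Z.1‖]
    · push_cast
      linarith [le_max_right (famNorm Z.2) ‖Z.1‖, norm_le_pi_norm Z.1 l]
  obtain ⟨n, hn⟩ := h2 m hbox
  exact ⟨(n, m), hn⟩

lemma measurePreserving_rev_phaseMeasure :
    MeasurePreserving rev (phaseMeasure d N ε) (phaseMeasure d N ε) := by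
  have h := (measurePreserving_rev (d := d) (N := N)).restrict_preimage
    (measurableSet_phaseSpace (d := d) (N := N) ε)
  exact h

/-- Alexander's theorem: almost all configurations belong to a global trajectory. -/
theorem ae_alive (hε : 0 < ε) : ∀ᵐ Z ∂phaseMeasure d N ε, Alive ε Z := by
  have h1 : ∀ n : ℕ, ∀ᵐ Z ∂phaseMeasure d N ε, ∃ Z', Reach ε n Z Z' := by
    intro n
    rcases n.eq_zero_or_pos with rfl | hn
    · refine Eventually.of_forall fun Z => ⟨Z, fun _ => Z, ⟨fun t h0 h1 => ?_, fun t h0 h1 => ?_⟩,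
        rfl, rfl⟩
      · simp at h1; linarith
      · simp at h1; linarith
    · have hn' : (0 : ℝ) < n := by exact_mod_cast hn
      filter_upwards [ae_exists_mem_goodSet hε hn'] with Z ⟨p, hp⟩
      have := (reach_of_mem_goodSet hε (by positivity) hp).1
      rw [mul_div_cancel₀ _ (by positivity)] at this
      exact ⟨_, this⟩
  filter_upwards [ae_noContact hε, ae_all_iff.2 h1,
    -- Reversal preserves the phase measure, so almost every reversed configuration also has a
    -- future, which serves as the past.
    measurePreserving_rev_phaseMeasure.quasiMeasurePreserving.ae (ae_all_iff.2 h1)]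
    with Z h2 h3 h4
  exact alive_of_reach hε h2 h3 h4

lemma hardSphereFlow_zero (Z : Config d N) : hardSphereFlow ε 0 Z = Z := by
  rw [hardSphereFlow]
  split_ifs with H
  · exact H.choose_spec.2
  · rfl

lemma ae_flow_eq (hε : 0 < ε) {t : ℝ} (ht : 0 < t) :
    ∀ᵐ Z ∂phaseMeasure d N ε, ∀ p : ℕ × ℕ,
      Z ∈ goodSet d N ε (t / (p.1 + 1 : ℕ)) (p.2 + 1 : ℕ) (p.1 + 1) →
      hardSphereFlow ε t Z = (stepMap ε (t / (p.1 + 1 : ℕ)))^[p.1 + 1] Z := by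
  filter_upwards [ae_alive hε] with Z hZ p hp
  have := (reach_of_mem_goodSet hε (by positivity) hp).1
  rw [mul_div_cancel₀ _ (by positivity)] at this
  exact (this.eq_flow hε ht.le hZ).symm

/-- The flow is measurable, nonsingular, and preserves the energy, almost everywhere. -/
structure IsNonsingularFlow (d N : ℕ) [NeZero d] (ε t : ℝ) : Prop where
  aemeasurable : AEMeasurable (hardSphereFlow (d := d) (N := N) ε t) (phaseMeasure d N ε)
  tendsto : Tendsto (hardSphereFlow (d := d) (N := N) ε t) (ae (phaseMeasure d N ε))
    (ae (phaseMeasure d N ε))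
  energy : ∀ᵐ Z ∂phaseMeasure d N ε, famNorm (hardSphereFlow ε t Z).2 = famNorm Z.2

/-- Up to a null set the phase space is covered by countably many good sets, on each of which the
flow at time t coincides almost everywhere with an iterate of a step map. The three properties are
inherited from these iterates. -/
lemma isNonsingularFlow_of_pos (hε : 0 < ε) {t : ℝ} (ht : 0 < t) : IsNonsingularFlow d N ε t := by
  let G : ℕ × ℕ → Set (Config d N) := fun p =>
    goodSet d N ε (t / (p.1 + 1 : ℕ)) (p.2 + 1 : ℕ) (p.1 + 1)
  have hG : ∀ᵐ Z ∂phaseMeasure d N ε, Z ∈ ⋃ p, G p := by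
    filter_upwards [ae_exists_mem_goodSet hε ht] with Z hZ using Set.mem_iUnion.2 hZ
  have heq := ae_flow_eq (d := d) (N := N) hε ht
  refine ⟨?_, ?_, ?_⟩
  · rw [← Measure.restrict_eq_self_of_ae_mem hG, aemeasurable_iUnion_iff]
    intro p
    refine ((measurable_stepMap ε (t / (p.1 + 1 : ℕ))).iterate (p.1 + 1)).aemeasurable.congr ?_
    filter_upwards [ae_restrict_mem (measurableSet_goodSet _ _ _),
      ae_restrict_of_ae heq] with Z h1 h2
    exact (h2 p h1).symm
  · intro A hA
    rw [mem_ae_iff] at hA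
    set B := toMeasurable (phaseMeasure d N ε) Aᶜ with hB
    have hB0 : phaseMeasure d N ε B = 0 := by rw [hB, measure_toMeasurable, hA]
    have h1 : ∀ p : ℕ × ℕ, ∀ᵐ Z ∂phaseMeasure d N ε, ¬ (Z ∈ G p ∧
        (stepMap ε (t / (p.1 + 1 : ℕ)))^[p.1 + 1] Z ∈ B) := by
      intro p
      refine ae_restrict_of_ae ?_
      refine compl_mem_ae_iff.2 (le_antisymm ?_ zero_le)
      have := volume_goodSet_inter_le (d := d) (N := N) hε (δ := t / (p.1 + 1 : ℕ))
        (r := (p.2 + 1 : ℕ)) (by positivity) (p.1 + 1)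
        (measurableSet_toMeasurable (phaseMeasure d N ε) Aᶜ)
      rwa [← hB, hB0] at this
    show ∀ᵐ Z ∂phaseMeasure d N ε, hardSphereFlow ε t Z ∈ A
    filter_upwards [hG, heq, ae_all_iff.2 h1] with Z h2 h3 h4
    obtain ⟨p, hp⟩ := Set.mem_iUnion.1 h2
    by_contra hc
    refine h4 p ⟨hp, ?_⟩
    rw [← h3 p hp]
    exact subset_toMeasurable _ _ hc
  · filter_upwards [hG, heq] with Z h2 h3
    obtain ⟨p, hp⟩ := Set.mem_iUnion.1 h2
    rw [h3 p hp]
    exact (reach_of_mem_goodSet hε (by positivity) hp).2.2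

/-- The hard sphere flow is nonsingular. -/
theorem isNonsingularFlow (hε : 0 < ε) (t : ℝ) : IsNonsingularFlow d N ε t := by
  rcases lt_trichotomy t 0 with ht | rfl | ht
  · have hp := isNonsingularFlow_of_pos (d := d) (N := N) hε (neg_pos.2 ht)
    have hr := measurePreserving_rev_phaseMeasure (d := d) (N := N) (ε := ε)
    have hrt := hr.quasiMeasurePreserving.tendsto_ae
    -- Reversibility is exact away from contacts. That the final configuration has none holds almost
    -- surely by nonsingularity at the positive time -t.
    have heq : ∀ᵐ Z ∂phaseMeasure d N ε,
        hardSphereFlow ε t Z = rev (hardSphereFlow ε (-t) (rev Z)) := by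
      filter_upwards [hrt.eventually (ae_alive hε), ae_noContact hε,
        hrt.eventually (hp.tendsto.eventually (ae_noContact hε))] with Z h1 h2 h3
      have := flow_neg_eq hε h1 h2 h3
      rwa [neg_neg] at this
    refine ⟨?_, ?_, ?_⟩
    · refine AEMeasurable.congr ?_ (EventuallyEq.symm heq)
      exact measurable_rev.comp_aemeasurable
        (hp.aemeasurable.comp_quasiMeasurePreserving hr.quasiMeasurePreserving)
    · exact (hrt.comp (hp.tendsto.comp hrt)).congr' (EventuallyEq.symm heq)
    · filter_upwards [heq, hrt.eventually hp.energy] with Z h1 h2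
      rw [h1, rev_snd, famNorm_neg, h2, rev_snd, famNorm_neg]
  · have : hardSphereFlow (d := d) (N := N) ε 0 = id := funext hardSphereFlow_zero
    refine ⟨?_, ?_, ?_⟩
    · rw [this]; exact aemeasurable_id
    · rw [this]; exact tendsto_id
    · simp [this]
  · exact isNonsingularFlow_of_pos hε ht

end Alexander

/-! ### Adjoining a colliding particle: null sets under the maps S^± -/

section Adjunction

variable {d s : ℕ} {ε : ℝ}

instance : SigmaFinite ((volume : Measure (Fin s → Euc d)).prod
    (volume : Measure (Fin s → Euc d))) := Measure.prod.instSigmaFinite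

instance : SigmaFinite (volume : Measure (Config d s)) := Measure.prod.instSigmaFinite

instance [NeZero d] : SigmaFinite (phaseMeasure d s ε) := by
  unfold phaseMeasure
  infer_instance

instance [NeZero d] (T : ℝ) : SigmaFinite (timePhaseMeasure d s ε T) := by
  unfold timePhaseMeasure
  infer_instance

/-- The pre-collisional velocities, for the impact direction `ω`. -/
def preVel (sg : CollisionSign) (i : Fin s) (ω : Euc d) (V : Fin (s + 1) → Euc d) :
    Fin (s + 1) → Euc d :=
  match sg with
  | .plus => scatter i.castSucc (Fin.last s) ω V
  | .minus => V

lemma castSucc_ne_last (i : Fin s) : i.castSucc ≠ Fin.last s := (Fin.castSucc_lt_last i).ne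

/-- Scattering reverses the normal relative velocity, so in pre-collisional form both signs become
an incoming pair, and the same flux formula serves for both. -/
lemma part_preVel (sg : CollisionSign) (i : Fin s) {ω : Euc d} (hω : ‖ω‖ = 1)
    (V : Fin (s + 1) → Euc d) :
    max (-inner ℝ ω (preVel sg i ω V (Fin.last s) - preVel sg i ω V i.castSucc)) 0 =
      sg.part (inner ℝ ω (V (Fin.last s) - V i.castSucc)) := by
  cases sg with
  | minus => rfl
  | plus =>
    have h := inner_scatter (castSucc_ne_last i) hω V
    simp only [preVel, CollisionSign.part]
    rw [real_inner_comm, ← neg_sub, inner_neg_left, h, neg_neg, ← inner_neg_left, neg_sub,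
      real_inner_comm]

@[fun_prop]
lemma measurable_preVel {α : Type*} [MeasurableSpace α] (sg : CollisionSign) (i : Fin s)
    {ω : α → Euc d} {V : α → Fin (s + 1) → Euc d} (hω : Measurable ω) (hV : Measurable V) :
    Measurable fun a => preVel sg i (ω a) (V a) := by
  cases sg with
  | minus => exact hV
  | plus => exact measurable_scatter _ _ hω hV

lemma measurePreserving_preVel (sg : CollisionSign) (i : Fin s) {ω : Euc d} (hω : ‖ω‖ = 1) :
    MeasurePreserving (preVel sg i ω) := by
  cases sg with
  | minus => exact MeasurePreserving.id _
  | plus => exact measurePreserving_scatter (castSucc_ne_last i) hω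

lemma adjoin_eq (ε : ℝ) (i : Fin s) (Z : Config d s) (ω : USphere d) (v : Euc d) :
    adjoin ε i Z ω v = (contactPos ε (Fin.last s) i (ω : Euc d) Z.1,
      (Fin.last s).insertNth (α := fun _ => Euc d) v Z.2) := by
  simp only [adjoin, contactPos, Fin.insertNth_last']

lemma pairCollision_contactPos_last (hε : 0 < ε) (i : Fin s) (ω : Euc d) (X : Fin s → Euc d)
    (V : Fin (s + 1) → Euc d) :
    pairCollision ε i.castSucc (Fin.last s) (contactPos ε (Fin.last s) i ω X, V) =
      (contactPos ε (Fin.last s) i ω X, scatter i.castSucc (Fin.last s) ω V) := by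
  have h := pairCollision_contactPos hε (Fin.last s) i ω X V
  rwa [Fin.succAbove_last_apply] at h

lemma adjoinPre_eq (hε : 0 < ε) (sg : CollisionSign) (i : Fin s) (Z : Config d s)
    (ω : USphere d) (v : Euc d) :
    adjoinPre sg ε i Z ω v = (contactPos ε (Fin.last s) i (ω : Euc d) Z.1,
      preVel sg i (ω : Euc d) ((Fin.last s).insertNth (α := fun _ => Euc d) v Z.2)) := by
  cases sg with
  | minus => simp only [adjoinPre, adjoin_eq, preVel]
  | plus => simp only [adjoinPre, adjoin_eq, preVel, pairCollision_contactPos_last hε]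

@[fun_prop]
lemma measurable_adjoinPre {α : Type*} [MeasurableSpace α] (hε : 0 < ε) (sg : CollisionSign)
    (i : Fin s) {Z : α → Config d s} {ω : α → USphere d} {v : α → Euc d}
    (hZ : Measurable Z) (hω : Measurable ω) (hv : Measurable v) :
    Measurable fun a => adjoinPre sg ε i (Z a) (ω a) (v a) := by
  simp only [adjoinPre_eq hε]
  exact Measurable.prodMk (by fun_prop) (measurable_preVel sg i (by fun_prop) (by fun_prop))

/-- The relative velocity in the direction of the impact. -/
def impact (sg : CollisionSign) (i : Fin s) (V : Fin s → Euc d) (p : USphere d × Euc d) : ℝ :=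
  sg.part (inner ℝ (p.1 : Euc d) (p.2 - V i))

lemma part_nonneg (sg : CollisionSign) (a : ℝ) : 0 ≤ sg.part a := by
  cases sg <;> exact le_max_right _ _

lemma continuous_part (sg : CollisionSign) : Continuous sg.part := by
  cases sg
  · exact continuous_id.max continuous_const
  · exact continuous_neg.max continuous_const

lemma impact_nonneg (sg : CollisionSign) (i : Fin s) (V : Fin s → Euc d) (p : USphere d × Euc d) :
    0 ≤ impact sg i V p := part_nonneg _ _

@[fun_prop]
lemma measurable_impact {α : Type*} [MeasurableSpace α] (sg : CollisionSign) (i : Fin s)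
    {V : α → Fin s → Euc d} {p : α → USphere d × Euc d} (hV : Measurable V) (hp : Measurable p) :
    Measurable fun a => impact sg i (V a) (p a) := by
  unfold impact
  refine (continuous_part sg).measurable.comp ?_
  fun_prop

/-- The map that reorders time, positions, velocities, impact direction and added velocity. -/
lemma measurePreserving_reorder (a : ℝ) :
    MeasurePreserving (fun w : (ℝ × Config d s) × (USphere d × Euc d) =>
        ((w.2.1, (w.1.1 - a, ((Fin.last s).insertNth (α := fun _ => Euc d) w.2.2 w.1.2.2,
          w.1.2.1))) : USphere d × (ℝ × ((Fin (s + 1) → Euc d) × (Fin s → Euc d)))))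
      (((volume.restrict (Set.Ioi a)).prod volume).prod ((sphereMeasure d).prod volume))
      ((sphereMeasure d).prod ((volume.restrict (Set.Ioi 0)).prod (volume.prod volume))) := by
  have hins : MeasurePreserving (fun q : (Fin s → Euc d) × Euc d =>
      ((Fin.last s).insertNth (α := fun _ => Euc d) q.2 q.1 : Fin (s + 1) → Euc d))
      (volume.prod volume) volume :=
    (volume_preserving_piFinSuccAbove (fun _ : Fin (s + 1) => Euc d) (Fin.last s)).symm.comp
      Measure.measurePreserving_swap
  have htime : MeasurePreserving (fun t : ℝ => t - a) (volume.restrict (Set.Ioi a))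
      (volume.restrict (Set.Ioi 0)) := by
    have := (measurePreserving_sub_right volume a).restrict_preimage
      (measurableSet_Ioi (a := (0 : ℝ)))
    simpa using this
  have h3 : MeasurePreserving (fun q : ((Fin s → Euc d) × (Fin s → Euc d)) × Euc d =>
      (((Fin.last s).insertNth (α := fun _ => Euc d) q.2 q.1.2, q.1.1) :
        (Fin (s + 1) → Euc d) × (Fin s → Euc d)))
      (((volume : Measure (Fin s → Euc d)).prod (volume : Measure (Fin s → Euc d))).prod
        (volume : Measure (Euc d)))
      ((volume : Measure (Fin (s + 1) → Euc d)).prod (volume : Measure (Fin s → Euc d))) :=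
    (hins.prod (MeasurePreserving.id (volume : Measure (Fin s → Euc d)))).comp
      (Measure.measurePreserving_swap.comp (measurePreserving_prodAssoc
        (volume : Measure (Fin s → Euc d)) (volume : Measure (Fin s → Euc d))
        (volume : Measure (Euc d))))
  have h4 := (htime.prod h3).comp ((measurePreserving_prodAssoc (volume.restrict (Set.Ioi a))
    ((volume : Measure (Fin s → Euc d)).prod (volume : Measure (Fin s → Euc d)))
      (volume : Measure (Euc d))).comp Measure.measurePreserving_swap)
  exact ((MeasurePreserving.id (sphereMeasure d)).prod h4).comp
    ((measurePreserving_prodAssoc (sphereMeasure d) volume _).comp Measure.measurePreserving_swap)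

/-- The maps `preFree` are nonsingular on the set of collisional velocities. -/
lemma ae_preFree [NeZero d] (hε : 0 < ε) (sg : CollisionSign) (i : Fin s) (a : ℝ)
    {p : Config d (s + 1) → Prop} (hp : ∀ᵐ Z, p Z) :
    ∀ᵐ w ∂((volume.restrict (Set.Ioi a)).prod volume).prod ((sphereMeasure d).prod volume),
      0 < impact sg i w.1.2.2 w.2 → p (preFree sg ε i (w.1.1 - a) w.1.2 w.2.1 w.2.2) := by
  obtain ⟨A, hpA, hA, hA0⟩ := exists_measurable_superset_of_null (ae_iff.1 hp)
  set F : Config d (s + 1) → ℝ≥0∞ := A.indicator 1 with hF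
  have hFm : Measurable F := measurable_one.indicator hA
  have hflux := lintegral_config_flux hε (Fin.last s) i hFm
  have hzero : ∫⁻ Z in {Z : Config d (s + 1) | Z.1 (Fin.last s) - Z.1 ((Fin.last s).succAbove i) ∈
      hitSet ε (Z.2 (Fin.last s) - Z.2 ((Fin.last s).succAbove i))}, F Z = 0 := by
    refine le_antisymm ((setLIntegral_le_lintegral _ _).trans ?_) zero_le
    rw [hF, lintegral_indicator_one hA, hA0]
  rw [hzero, eq_comm, mul_eq_zero, or_iff_right (by simpa using pow_pos hε _),
    Fin.succAbove_last_apply] at hflux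
  let G : USphere d × (ℝ × ((Fin (s + 1) → Euc d) × (Fin s → Euc d))) → ℝ≥0∞ := fun w =>
    ENNReal.ofReal (max (-inner ℝ (w.1 : Euc d) (preVel sg i (w.1 : Euc d) w.2.2.1 (Fin.last s) -
      preVel sg i (w.1 : Euc d) w.2.2.1 i.castSucc)) 0) *
      F (freeFlow (-w.2.1) (contactPos ε (Fin.last s) i (w.1 : Euc d) w.2.2.2,
        preVel sg i (w.1 : Euc d) w.2.2.1))
  have hpv : Measurable fun w : USphere d × (ℝ × ((Fin (s + 1) → Euc d) × (Fin s → Euc d))) =>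
      preVel sg i (w.1 : Euc d) w.2.2.1 := measurable_preVel sg i (by fun_prop) (by fun_prop)
  have hGm : Measurable G := by
    have h1 : Measurable fun w : USphere d × (ℝ × ((Fin (s + 1) → Euc d) × (Fin s → Euc d))) =>
        freeFlow (-w.2.1) (contactPos ε (Fin.last s) i (w.1 : Euc d) w.2.2.2,
          preVel sg i (w.1 : Euc d) w.2.2.1) := by fun_prop
    have h2 : Measurable fun w : USphere d × (ℝ × ((Fin (s + 1) → Euc d) × (Fin s → Euc d))) =>
        inner ℝ (w.1 : Euc d) (preVel sg i (w.1 : Euc d) w.2.2.1 (Fin.last s) -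
          preVel sg i (w.1 : Euc d) w.2.2.1 i.castSucc) :=
      Measurable.inner (by fun_prop)
        (((measurable_pi_apply _).comp hpv).sub ((measurable_pi_apply _).comp hpv))
    exact (ENNReal.measurable_ofReal.comp (h2.neg.max measurable_const)).mul (hFm.comp h1)
  -- For fixed ω the map `preVel` preserves dV; this turns the flux integral of the null set, which
  -- vanishes, into an integral in the variables of the collision operator.
  have hG : ∫⁻ w, G w ∂(sphereMeasure d).prod
      ((volume.restrict (Set.Ioi 0)).prod (volume.prod volume)) = 0 := by
    rw [lintegral_prod _ hGm.aemeasurable, ← hflux]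
    refine lintegral_congr fun ω => ?_
    rw [lintegral_prod _ (by fun_prop)]
    refine lintegral_congr fun u => ?_
    rw [lintegral_prod _ (by fun_prop)]
    have hm : Measurable fun V : Fin (s + 1) → Euc d => ∫⁻ X : Fin s → Euc d,
        ENNReal.ofReal (max (-inner ℝ (ω : Euc d) (V (Fin.last s) - V i.castSucc)) 0) *
          F (freeFlow (-u) (contactPos ε (Fin.last s) i (ω : Euc d) X, V)) :=
      Measurable.lintegral_prod_right' (f := fun q : (Fin (s + 1) → Euc d) × (Fin s → Euc d) =>
        ENNReal.ofReal (max (-inner ℝ (ω : Euc d) (q.1 (Fin.last s) - q.1 i.castSucc)) 0) *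
          F (freeFlow (-u) (contactPos ε (Fin.last s) i (ω : Euc d) q.2, q.1)))
        (Measurable.mul (by fun_prop) (hFm.comp (by fun_prop)))
    exact (measurePreserving_preVel sg i (norm_eq_of_mem_sphere ω)).lintegral_comp hm
  rw [lintegral_eq_zero_iff hGm] at hG
  have hG' := (measurePreserving_reorder (d := d) (s := s) a).quasiMeasurePreserving.ae hG
  filter_upwards [hG'] with w hw hpos
  by_contra hc
  have hmem := hpA hc
  simp only [G, Pi.zero_apply, mul_eq_zero, part_preVel sg i (norm_eq_of_mem_sphere w.2.1)] at hw
  rcases hw with hw | hw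
  · rw [ENNReal.ofReal_eq_zero] at hw
    refine absurd hpos (not_lt.2 ?_)
    rw [impact]
    rw [← Fin.succAbove_last_apply i, Fin.insertNth_apply_same,
      Fin.insertNth_apply_succAbove] at hw
    exact hw
  · rw [← adjoinPre_eq hε] at hw
    rw [preFree] at hmem
    rw [hF, Set.indicator_of_mem hmem] at hw
    simp at hw

end Adjunction

/-! ### The backward transport of the adjoined configuration, independent of the cut-offs -/

section Backward

variable {d s : ℕ} {ε : ℝ}

lemma norm_sub_le_famNorm {N : ℕ} (V : Fin N → Euc d) {j k : Fin N} (hjk : j ≠ k) :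
    ‖V j - V k‖ ≤ Real.sqrt 2 * famNorm V := by
  rw [famNorm, ← Real.sqrt_mul zero_le_two]
  refine Real.le_sqrt_of_sq_le ?_
  have h1 : ‖V j‖ ^ 2 + ‖V k‖ ^ 2 ≤ ∑ l, ‖V l‖ ^ 2 := by
    rw [← Finset.sum_pair hjk (f := fun l => ‖V l‖ ^ 2)]
    exact Finset.sum_le_sum_of_subset_of_nonneg (Finset.subset_univ _) fun _ _ _ => sq_nonneg _
  have h2 := parallelogram_law_with_norm ℝ (V j) (V k)
  nlinarith [mul_self_nonneg ‖V j + V k‖]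

lemma adjoinPre_fst (sg : CollisionSign) (i : Fin s) (Z : Config d s) (ω : USphere d) (v : Euc d) :
    (adjoinPre sg ε i Z ω v).1 = (adjoin ε i Z ω v).1 := by cases sg <;> rfl

lemma adjoin_sub (i : Fin s) (Z : Config d s) (ω : USphere d) (v : Euc d) :
    (adjoin ε i Z ω v).1 (Fin.last s) - (adjoin ε i Z ω v).1 i.castSucc = ε • (ω : Euc d) := by
  have := contactPos_sub ε (Fin.last s) i (ω : Euc d) Z.1
  rw [Fin.succAbove_last_apply] at this
  rw [adjoin_eq]
  exact this

@[fun_prop]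
lemma measurable_adjoin {α : Type*} [MeasurableSpace α] (i : Fin s)
    {Z : α → Config d s} {ω : α → USphere d} {v : α → Euc d}
    (hZ : Measurable Z) (hω : Measurable ω) (hv : Measurable v) :
    Measurable fun a => adjoin ε i (Z a) (ω a) (v a) := by
  simp only [adjoin_eq]
  fun_prop

lemma norm_adjoin_sub (hε : 0 < ε) (i : Fin s) (Z : Config d s) (ω : USphere d) (v : Euc d) :
    ‖(adjoin ε i Z ω v).1 i.castSucc - (adjoin ε i Z ω v).1 (Fin.last s)‖ = ε := by
  rw [norm_sub_rev, adjoin_sub, norm_smul, norm_eq_of_mem_sphere, mul_one, Real.norm_of_nonneg hε.le]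

lemma inner_adjoinPre (hε : 0 < ε) {sg : CollisionSign} {i : Fin s} {Z : Config d s}
    {p : USphere d × Euc d} (hp : 0 < impact sg i Z.2 p) :
    inner ℝ (p.1 : Euc d) ((adjoinPre sg ε i Z p.1 p.2).2 (Fin.last s) -
      (adjoinPre sg ε i Z p.1 p.2).2 i.castSucc) < 0 := by
  have h := part_preVel sg i (norm_eq_of_mem_sphere p.1)
    ((Fin.last s).insertNth (α := fun _ => Euc d) p.2 Z.2)
  have e : (Fin.last s).insertNth (α := fun _ => Euc d) p.2 Z.2 i.castSucc = Z.2 i := by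
    have := Fin.insertNth_apply_succAbove (α := fun _ => Euc d) (Fin.last s) p.2 Z.2 i
    rwa [Fin.succAbove_last_apply] at this
  rw [Fin.insertNth_apply_same, e] at h
  rw [impact, ← h, lt_max_iff, or_iff_left (lt_irrefl _)] at hp
  rw [adjoinPre_eq hε]
  linarith

variable [NeZero d]

/-- Velocities are right-continuous, so the value at the instant of the collision is the
post-collisional configuration. This is why `backward` starts from `adjoinPost`. -/
lemma reach_pairCollision {N : ℕ} {Z : Config d N} {j k : Fin N} {u : ℝ} (hu : 0 < u)
    (hZ : PairContact ε j k Z) (h : ∀ v, 0 < v → v ≤ u → NoContact ε (freeFlow (-v) Z)) :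
    Reach ε u (freeFlow (-u) Z) (pairCollision ε j k Z) := by
  have hpre : ∀ τ, τ < u → (if τ < u then freeFlow (τ - u) Z else pairCollision ε j k Z) =
      freeFlow (τ - u) Z := fun τ hτ => if_pos hτ
  refine ⟨fun τ => if τ < u then freeFlow (τ - u) Z else pairCollision ε j k Z, ⟨?_, ?_⟩, ?_, ?_⟩
  · intro t h0 htu
    show ∀ᶠ t' in 𝓝[>] t, _
    filter_upwards [Ioo_mem_nhdsGT htu] with t' ht'
    rw [if_pos ht'.2, if_pos htu, freeFlow_add]
    congr 1
    ring
  · intro t h0 htu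
    rcases htu.lt_or_eq with htu | rfl
    · refine ⟨freeFlow (t - u) Z, .inl ⟨?_, if_pos htu⟩, ?_⟩
      · rw [← neg_sub]
        exact h _ (by linarith) (by linarith)
      · show ∀ᶠ t' in 𝓝[<] t, _
        filter_upwards [self_mem_nhdsWithin] with t' ht'
        have ht' : t' < t := ht'
        rw [if_pos (ht'.trans htu), freeFlow_add]
        congr 1
        ring
    · refine ⟨Z, .inr (.inl ⟨j, k, hZ, if_neg (lt_irrefl _)⟩), ?_⟩
      show ∀ᶠ t' in 𝓝[<] t, _
      filter_upwards [self_mem_nhdsWithin] with t' ht'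
      exact if_pos ht'
  · simp [hu]
  · simp

/-- The configuration just after the collision with the adjoined particle. -/
def adjoinPost (sg : CollisionSign) (ε : ℝ) (i : Fin s) (Z : Config d s) (p : USphere d × Euc d) :
    Config d (s + 1) :=
  pairCollision ε i.castSucc (Fin.last s) (adjoinPre sg ε i Z p.1 p.2)

/-- The backward transport, during the time `t`, of the adjoined configuration. -/
def backward (sg : CollisionSign) (ε : ℝ) (i : Fin s)
    (w : (ℝ × Config d s) × (USphere d × Euc d)) : Config d (s + 1) :=
  hardSphereFlow ε (-w.1.1) (adjoinPost sg ε i w.1.2 w.2)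

lemma famNorm_pairCollision (hε : 0 < ε) {N : ℕ} {j k : Fin N} (hjk : j < k) {Z : Config d N}
    (h : ‖Z.1 j - Z.1 k‖ = ε) : famNorm (pairCollision ε j k Z).2 = famNorm Z.2 :=
  famNorm_collide hε (.inl ⟨(j, k), hjk⟩) (Z := Z) (sub_eq_zero.2 h)

lemma famNorm_adjoinPre (hε : 0 < ε) (sg : CollisionSign) (i : Fin s) (Z : Config d s)
    (ω : USphere d) (v : Euc d) : famNorm (adjoinPre sg ε i Z ω v).2 = velNorm Z.2 v := by
  cases sg with
  | minus => rfl
  | plus => exact famNorm_pairCollision hε (Fin.castSucc_lt_last i) (norm_adjoin_sub hε i Z ω v)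

lemma pairContact_adjoinPre (hε : 0 < ε) {sg : CollisionSign} {i : Fin s} {δ R₁ R₂ : ℝ}
    {Z : Config d s} {p : USphere d × Euc d} (hδ : 0 ≤ δ) (hp : p ∈ cutoffDomain ε i δ R₁ R₂ Z) :
    PairContact ε i.castSucc (Fin.last s) (adjoinPre sg ε i Z p.1 p.2) := by
  obtain ⟨h1, h2, -, h3⟩ := hp
  have h4 : 0 ≤ δ * R₂ := mul_nonneg hδ ((famNorm_nonneg _).trans h3)
  refine ⟨Fin.castSucc_lt_last i, ?_, fun l => ?_, fun j k hjk hne => ?_⟩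
  · rw [adjoinPre_fst, norm_adjoin_sub hε]
  · rw [adjoinPre_fst]
    linarith [h2 l]
  · rw [adjoinPre_fst]
    have := h1 j k hjk hne
    have h5 : 0 ≤ Real.sqrt 2 * δ * R₂ := by rw [mul_assoc]; positivity
    linarith

/-- The margins of `cutoffDomain` are what a free motion during δ can consume when |V| ≤ R₂: a pair
approaches at speed at most √2 R₂, and the wall at speed at most R₂. The pair in contact has no
margin, but it is incoming, hence it separates backward in time. -/
lemma noContact_preFree (hε : 0 < ε) {sg : CollisionSign} {i : Fin s} {δ R₁ R₂ : ℝ}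
    {Z : Config d s} {p : USphere d × Euc d} (hp : p ∈ cutoffDomain ε i δ R₁ R₂ Z)
    (hpos : 0 < impact sg i Z.2 p) {u : ℝ} (hu : 0 < u) (huδ : u ≤ δ) :
    NoContact ε (preFree sg ε i u Z p.1 p.2) := by
  obtain ⟨h1, h2, -, h3⟩ := hp
  set P := adjoinPre sg ε i Z p.1 p.2 with hP
  have hP1 : P.1 = (adjoin ε i Z p.1 p.2).1 := adjoinPre_fst _ _ _ _ _
  have hV : famNorm P.2 ≤ R₂ := by
    rw [hP, famNorm_adjoinPre hε]
    exact h3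
  rw [← hP1] at h1 h2
  have hR : 0 ≤ R₂ := (famNorm_nonneg _).trans hV
  refine ⟨fun l => ?_, fun j k hjk => ?_⟩
  · have h4 : inner ℝ ((preFree sg ε i u Z p.1 p.2).1 l) (e₁ d) =
        inner ℝ (P.1 l) (e₁ d) + -u * inner ℝ (P.2 l) (e₁ d) := by
      rw [preFree, inner_freeFlow_e₁]
    have h5 : |inner ℝ (P.2 l) (e₁ d)| ≤ R₂ := by
      refine (abs_real_inner_le_norm _ _).trans ?_
      rw [norm_e₁, mul_one]
      exact (norm_le_famNorm _ l).trans hV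
    have h6 := h2 l
    have h7 := (abs_le.1 h5).2
    have h8 : u * inner ℝ (P.2 l) (e₁ d) ≤ δ * R₂ :=
      (mul_le_mul_of_nonneg_left h7 hu.le).trans (mul_le_mul_of_nonneg_right huδ hR)
    rw [h4]
    linarith
  · have h4 : (preFree sg ε i u Z p.1 p.2).1 j - (preFree sg ε i u Z p.1 p.2).1 k =
        P.1 j - P.1 k - u • (P.2 j - P.2 k) := by
      simp only [preFree, freeFlow, ← hP]
      module
    rw [h4]
    by_cases hne : (j, k) = (i.castSucc, Fin.last s)
    · obtain ⟨rfl, rfl⟩ := Prod.mk.inj hne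
      have h5 : P.1 i.castSucc - P.1 (Fin.last s) = -(ε • (p.1 : Euc d)) := by
        rw [hP1, ← adjoin_sub (ε := ε) i Z p.1 p.2, neg_sub]
      have h6 := inner_adjoinPre hε hpos
      rw [← hP] at h6
      set r := P.2 (Fin.last s) - P.2 i.castSucc with hr
      have h7 : P.1 i.castSucc - P.1 (Fin.last s) - u • (P.2 i.castSucc - P.2 (Fin.last s)) =
          -(ε • (p.1 : Euc d) - u • r) := by
        rw [h5, hr]
        module
      rw [h7, norm_neg]
      refine lt_of_pow_lt_pow_left₀ 2 (norm_nonneg _) ?_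
      rw [norm_sub_sq_real, norm_smul, norm_eq_of_mem_sphere, Real.norm_of_nonneg hε.le,
        inner_smul_left, inner_smul_right, conj_trivial]
      have h8 : 0 < ε * (u * -inner ℝ (p.1 : Euc d) r) :=
        mul_pos hε (mul_pos hu (neg_pos.2 h6))
      nlinarith [sq_nonneg ‖u • r‖]
    · have h5 := h1 j k hjk hne
      have h6 := (norm_sub_le_famNorm P.2 hjk.ne).trans
        (mul_le_mul_of_nonneg_left hV (Real.sqrt_nonneg 2))
      have hδ : 0 ≤ δ := hu.le.trans huδ
      have h7 : ‖u • (P.2 j - P.2 k)‖ ≤ Real.sqrt 2 * δ * R₂ := by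
        rw [norm_smul, Real.norm_of_nonneg hu.le]
        calc u * ‖P.2 j - P.2 k‖ ≤ δ * (Real.sqrt 2 * R₂) := by gcongr
          _ = _ := by ring
      have h8 := norm_sub_norm_le (P.1 j - P.1 k) (u • (P.2 j - P.2 k))
      linarith

/-- On the cut-off domain the backward transport starts with a free motion. -/
lemma flow_preFree_eq_backward (hε : 0 < ε) {sg : CollisionSign} {i : Fin s} {δ R₁ R₂ : ℝ}
    {t a : ℝ} {Z : Config d s} {p : USphere d × Euc d} (hp : p ∈ cutoffDomain ε i δ R₁ R₂ Z)
    (hpos : 0 < impact sg i Z.2 p) (hat : a < t) (htδ : t ≤ a + δ)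
    (hal : Alive ε (preFree sg ε i (t - a) Z p.1 p.2)) :
    hardSphereFlow ε (-a) (preFree sg ε i (t - a) Z p.1 p.2) = backward sg ε i ((t, Z), p) := by
  have hu : 0 < t - a := by linarith
  have h1 : Reach ε (t - a) (preFree sg ε i (t - a) Z p.1 p.2) (adjoinPost sg ε i Z p) :=
    reach_pairCollision hu (pairContact_adjoinPre hε (by linarith) hp) fun v hv hv' =>
      noContact_preFree hε hp hpos hv (by linarith)
  -- The post-collisional configuration is the image under T_{t-a} of the incoming one, and T_{-t}
  -- T_{t-a} = T_{-a}.
  rw [backward, h1.eq_flow hε hu.le hal, hal.flow_add hε]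
  congr 1
  ring

/-- The measure space in which the collisions take place. -/
abbrev collisionMeasure (d s : ℕ) [NeZero d] (ε T : ℝ) :
    Measure ((ℝ × Config d s) × (USphere d × Euc d)) :=
  (timePhaseMeasure d s ε T).prod ((sphereMeasure d).prod volume)

lemma collisionMeasure_restrict_absolutelyContinuous (ε T a : ℝ) :
    ((collisionMeasure d s ε T).restrict {w | a < w.1.1}) ≪
      ((volume.restrict (Set.Ioi a)).prod volume).prod ((sphereMeasure d).prod volume) := by
  have h1 : {w : (ℝ × Config d s) × (USphere d × Euc d) | a < w.1.1} =
      (Set.Ioi a ×ˢ Set.univ) ×ˢ Set.univ := by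
    ext w; simp
  rw [h1, collisionMeasure, ← Measure.prod_restrict, Measure.restrict_univ, timePhaseMeasure,
    ← Measure.prod_restrict, Measure.restrict_univ]
  refine Measure.AbsolutelyContinuous.prod (Measure.AbsolutelyContinuous.prod ?_ ?_)
    Measure.AbsolutelyContinuous.rfl
  · exact (Measure.restrict_mono_measure Measure.restrict_le_self _).absolutelyContinuous
  · exact Measure.restrict_le_self.absolutelyContinuous

/-- At a grid time the elapsed time t - kδ vanishes and `preFree` is still in contact, so the
results on free motion do not apply there. Such times are negligible. -/
lemma ae_ne_mul (ε T δ : ℝ) :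
    ∀ᵐ w ∂collisionMeasure d s ε T, ∀ k : ℤ, (k : ℝ) * δ ≠ w.1.1 := by
  refine ae_all_iff.2 fun k => ?_
  have h1 : ∀ᵐ t ∂volume.restrict (Set.Icc 0 T), (k : ℝ) * δ ≠ t :=
    ae_restrict_of_ae (by
      filter_upwards [compl_mem_ae_iff.2 (measure_singleton (μ := volume) ((k : ℝ) * δ))]
        with t ht h using ht h.symm)
  exact Measure.quasiMeasurePreserving_fst.ae (Measure.quasiMeasurePreserving_fst.ae h1)

variable {T : ℝ}

/-- The elapsed time is measured from a grid point kδ depending on t. For each integer k,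
`ae_preFree` with origin kδ applies, and there are countably many k. -/
lemma ae_preFree_of_cutoff (hε : 0 < ε) (sg : CollisionSign) (i : Fin s) {δ : ℝ} (hδ : 0 < δ)
    (R₁ R₂ : ℝ) {p : Config d (s + 1) → Prop} (hp : ∀ᵐ Z ∂phaseMeasure d (s + 1) ε, p Z) :
    ∀ᵐ w ∂collisionMeasure d s ε T, w.2 ∈ cutoffDomain ε i δ R₁ R₂ w.1.2 →
      0 < impact sg i w.1.2.2 w.2 →
      gridTime δ w.1.1 < w.1.1 ∧ w.1.1 ≤ gridTime δ w.1.1 + δ ∧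
      p (preFree sg ε i (w.1.1 - gridTime δ w.1.1) w.1.2 w.2.1 w.2.2) := by
  rw [phaseMeasure, ae_restrict_iff' (measurableSet_phaseSpace ε)] at hp
  have h1 : ∀ k : ℤ, ∀ᵐ w ∂collisionMeasure d s ε T, k * δ < w.1.1 → 0 < impact sg i w.1.2.2 w.2 →
      preFree sg ε i (w.1.1 - k * δ) w.1.2 w.2.1 w.2.2 ∈ phaseSpace d (s + 1) ε →
      p (preFree sg ε i (w.1.1 - k * δ) w.1.2 w.2.1 w.2.2) := by
    intro k
    exact (ae_restrict_iff' (measurableSet_lt measurable_const (by fun_prop))).1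
      ((collisionMeasure_restrict_absolutelyContinuous (d := d) (s := s) ε T
        (k * δ)).ae_le (ae_preFree hε sg i (k * δ) hp))
  filter_upwards [ae_all_iff.2 h1, ae_ne_mul ε T δ] with w h2 h3 hw hpos
  have h4 : gridTime δ w.1.1 ≤ w.1.1 := by
    rw [gridTime, ← le_div_iff₀ hδ]
    exact Int.floor_le _
  have h5 : w.1.1 < gridTime δ w.1.1 + δ := by
    have := Int.lt_floor_add_one (w.1.1 / δ)
    rw [div_lt_iff₀ hδ] at this
    rw [gridTime]
    linarith
  have h6 : gridTime δ w.1.1 < w.1.1 := lt_of_le_of_ne h4 (h3 _)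
  refine ⟨h6, h5.le, h2 _ h6 hpos ?_⟩
  have h7 := noContact_preFree hε hw hpos (u := w.1.1 - gridTime δ w.1.1) (by linarith)
    (by linarith)
  exact mem_phaseSpace_iff.2 fun c => (noContact_iff.1 h7 c).le

/-- The property is first pulled back by the countably many nonsingular flows T_{-kδ}, then by
`preFree`. Each stage conserves |V|, the scattering included. -/
lemma ae_backward_of_cutoff (hε : 0 < ε) (sg : CollisionSign) (i : Fin s) {δ : ℝ} (hδ : 0 < δ)
    (R₁ R₂ : ℝ) {p : Config d (s + 1) → Prop} (hp : ∀ᵐ Z ∂phaseMeasure d (s + 1) ε, p Z) :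
    ∀ᵐ w ∂collisionMeasure d s ε T, w.2 ∈ cutoffDomain ε i δ R₁ R₂ w.1.2 →
      0 < impact sg i w.1.2.2 w.2 →
      hardSphereFlow ε (-gridTime δ w.1.1)
        (preFree sg ε i (w.1.1 - gridTime δ w.1.1) w.1.2 w.2.1 w.2.2) = backward sg ε i w ∧
      p (backward sg ε i w) ∧ famNorm (backward sg ε i w).2 = velNorm w.1.2.2 w.2.2 := by
  have h1 : ∀ᵐ Z ∂phaseMeasure d (s + 1) ε, Alive ε Z ∧
      ∀ k : ℤ, p (hardSphereFlow ε (-(k * δ)) Z) ∧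
        famNorm (hardSphereFlow ε (-(k * δ)) Z).2 = famNorm Z.2 := by
    refine (ae_alive hε).and (ae_all_iff.2 fun k => ?_)
    have h2 := isNonsingularFlow (d := d) (N := s + 1) hε (-(k * δ))
    exact (h2.tendsto.eventually hp).and h2.energy
  filter_upwards [ae_preFree_of_cutoff hε sg i hδ R₁ R₂ h1] with w h2 hw hpos
  obtain ⟨h3, h4, h5, h6⟩ := h2 hw hpos
  have h7 := flow_preFree_eq_backward hε hw hpos h3 h4 h5
  obtain ⟨h8, h9⟩ := h6 ⌊w.1.1 / δ⌋
  rw [← gridTime, h7] at h8 h9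
  refine ⟨h7, h8, h9.trans ?_⟩
  rw [preFree, freeFlow_snd, famNorm_adjoinPre hε]

/-- The truncated integrand, in terms of the backward transport. -/
lemma ae_cutoffIntegrand_eq (hε : 0 < ε) (sg : CollisionSign) (i : Fin s) {δ : ℝ} (hδ : 0 < δ)
    (R₁ R₂ : ℝ) : ∀ᵐ w ∂collisionMeasure d s ε T, ∀ φ : ℝ → Config d (s + 1) → ℝ,
      cutoffIntegrand sg ε i δ R₁ R₂ φ w.1 w.2 = (cutoffDomain ε i δ R₁ R₂ w.1.2).indicator
        (fun p => impact sg i w.1.2.2 p * φ w.1.1 (backward sg ε i (w.1, p))) w.2 := by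
  filter_upwards [ae_backward_of_cutoff hε sg i hδ R₁ R₂ (p := fun _ => True) (by simp)]
    with w hw φ
  rw [cutoffIntegrand]
  by_cases h1 : w.2 ∈ cutoffDomain ε i δ R₁ R₂ w.1.2
  · rw [Set.indicator_of_mem h1, Set.indicator_of_mem h1]
    rcases (impact_nonneg sg i w.1.2.2 w.2).eq_or_lt with h2 | h2
    · rw [← impact, ← h2, zero_mul, zero_mul]
    · rw [(hw h1 h2).1]
      rfl
  · rw [Set.indicator_of_notMem h1, Set.indicator_of_notMem h1]

/-- The configurations adjoined without any other contact and with a collisional velocity. -/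
def collisional (sg : CollisionSign) (ε : ℝ) (i : Fin s) :
    Set ((ℝ × Config d s) × (USphere d × Euc d)) :=
  {w | ((∀ j k, j < k → (j, k) ≠ (i.castSucc, Fin.last s) →
          ε < ‖(adjoin ε i w.1.2 w.2.1 w.2.2).1 j - (adjoin ε i w.1.2 w.2.1 w.2.2).1 k‖) ∧
       (∀ l, ε / 2 < inner ℝ ((adjoin ε i w.1.2 w.2.1 w.2.2).1 l) (e₁ d))) ∧
       0 < impact sg i w.1.2.2 w.2}

lemma eventually_mem_cutoffDomain {i : Fin s} {R₁ R₂ : ℝ} {Z : Config d s} {p : USphere d × Euc d}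
    (h1 : ∀ j k, j < k → (j, k) ≠ (i.castSucc, Fin.last s) →
      ε < ‖(adjoin ε i Z p.1 p.2).1 j - (adjoin ε i Z p.1 p.2).1 k‖)
    (h2 : ∀ l, ε / 2 < inner ℝ ((adjoin ε i Z p.1 p.2).1 l) (e₁ d))
    (h3 : famNorm (adjoin ε i Z p.1 p.2).1 ≤ R₁) (h4 : famNorm (adjoin ε i Z p.1 p.2).2 ≤ R₂) :
    ∀ᶠ δ in 𝓝[>] (0 : ℝ), p ∈ cutoffDomain ε i δ R₁ R₂ Z := by
  have h5 : ∀ᶠ δ in 𝓝[>] (0 : ℝ), ∀ j k, j < k → (j, k) ≠ (i.castSucc, Fin.last s) →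
      ε + Real.sqrt 2 * δ * R₂ < ‖(adjoin ε i Z p.1 p.2).1 j - (adjoin ε i Z p.1 p.2).1 k‖ := by
    simp only [eventually_all]
    intro j k hjk hne
    have : Tendsto (fun δ : ℝ => ε + Real.sqrt 2 * δ * R₂) (𝓝[>] 0) (𝓝 ε) := by
      have : Continuous fun δ : ℝ => ε + Real.sqrt 2 * δ * R₂ := by fun_prop
      have h := this.tendsto 0
      simp only [mul_zero, zero_mul, add_zero] at h
      exact h.mono_left nhdsWithin_le_nhds
    exact this.eventually (gt_mem_nhds (h1 j k hjk hne))
  have h6 : ∀ᶠ δ in 𝓝[>] (0 : ℝ), ∀ l,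
      ε / 2 + δ * R₂ < inner ℝ ((adjoin ε i Z p.1 p.2).1 l) (e₁ d) := by
    simp only [eventually_all]
    intro l
    have : Tendsto (fun δ : ℝ => ε / 2 + δ * R₂) (𝓝[>] 0) (𝓝 (ε / 2)) := by
      have : Continuous fun δ : ℝ => ε / 2 + δ * R₂ := by fun_prop
      have h := this.tendsto 0
      simp only [zero_mul, add_zero] at h
      exact h.mono_left nhdsWithin_le_nhds
    exact this.eventually (gt_mem_nhds (h2 l))
  filter_upwards [h5, h6] with δ h7 h8 using ⟨h7, h8, h3, h4⟩

/-- The open conditions leave some margin. Countably many cut-off domains thus exhaust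
`collisional`, and almost everywhere statements pass to it. -/
lemma exists_mem_cutoffDomain_of_collisional {sg : CollisionSign} {i : Fin s}
    {w : (ℝ × Config d s) × (USphere d × Euc d)} (hw : w ∈ collisional sg ε i) :
    ∃ n : ℕ × ℕ, w.2 ∈ cutoffDomain ε i (1 / ((n.1 : ℝ) + 1)) n.2 n.2 w.1.2 := by
  obtain ⟨m, hm⟩ := exists_nat_ge (max (famNorm (adjoin ε i w.1.2 w.2.1 w.2.2).1)
    (famNorm (adjoin ε i w.1.2 w.2.1 w.2.2).2))
  have h := eventually_mem_cutoffDomain hw.1.1 hw.1.2 ((le_max_left _ _).trans hm)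
    ((le_max_right _ _).trans hm)
  have h1 : Tendsto (fun n : ℕ => 1 / ((n : ℝ) + 1)) atTop (𝓝[>] 0) :=
    tendsto_nhdsWithin_iff.2 ⟨tendsto_one_div_add_atTop_nhds_zero_nat,
      Eventually.of_forall fun n => Set.mem_Ioi.2 (by positivity)⟩
  obtain ⟨n, hn⟩ := (h1.eventually h).exists
  exact ⟨(n, m), hn⟩

lemma ae_backward (hε : 0 < ε) (sg : CollisionSign) (i : Fin s) {p : Config d (s + 1) → Prop}
    (hp : ∀ᵐ Z ∂phaseMeasure d (s + 1) ε, p Z) :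
    ∀ᵐ w ∂collisionMeasure d s ε T, w ∈ collisional sg ε i →
      p (backward sg ε i w) ∧ famNorm (backward sg ε i w).2 = velNorm w.1.2.2 w.2.2 := by
  have h1 : ∀ n : ℕ × ℕ, _ := fun n => ae_backward_of_cutoff (T := T) hε sg i
    (δ := 1 / ((n.1 : ℝ) + 1)) (by positivity) n.2 n.2 hp
  filter_upwards [ae_all_iff.2 h1] with w hw hwc
  obtain ⟨n, hn⟩ := exists_mem_cutoffDomain_of_collisional hwc
  exact (hw n hn hwc.2).2

lemma measurableSet_cutoffDomain (i : Fin s) (δ R₁ R₂ : ℝ) :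
    MeasurableSet {w : (ℝ × Config d s) × (USphere d × Euc d) |
      w.2 ∈ cutoffDomain ε i δ R₁ R₂ w.1.2} := by
  have hA : Measurable fun w : (ℝ × Config d s) × (USphere d × Euc d) =>
      adjoin ε i w.1.2 w.2.1 w.2.2 := by fun_prop
  have hA1 : ∀ l, Measurable fun w : (ℝ × Config d s) × (USphere d × Euc d) =>
      (adjoin ε i w.1.2 w.2.1 w.2.2).1 l := fun l => (measurable_pi_apply l).comp hA.fst
  have h1 : MeasurableSet {w : (ℝ × Config d s) × (USphere d × Euc d) |
      ∀ j k, j < k → (j, k) ≠ (i.castSucc, Fin.last s) → ε + Real.sqrt 2 * δ * R₂ <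
        ‖(adjoin ε i w.1.2 w.2.1 w.2.2).1 j - (adjoin ε i w.1.2 w.2.1 w.2.2).1 k‖} := by
    simp only [Set.ofPred_forall]
    exact MeasurableSet.iInter fun j => MeasurableSet.iInter fun k => MeasurableSet.iInter fun _ =>
      MeasurableSet.iInter fun _ => measurableSet_lt measurable_const ((hA1 j).sub (hA1 k)).norm
  have h2 : MeasurableSet {w : (ℝ × Config d s) × (USphere d × Euc d) |
      ∀ l, ε / 2 + δ * R₂ < inner ℝ ((adjoin ε i w.1.2 w.2.1 w.2.2).1 l) (e₁ d)} := by
    simp only [Set.ofPred_forall]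
    exact MeasurableSet.iInter fun l => measurableSet_lt measurable_const
      ((hA1 l).inner measurable_const)
  exact h1.inter (h2.inter ((measurableSet_le (continuous_famNorm.measurable.comp hA.fst)
    measurable_const).inter (measurableSet_le (continuous_famNorm.measurable.comp hA.snd)
      measurable_const)))

lemma measurableSet_collisional (sg : CollisionSign) (i : Fin s) :
    MeasurableSet (collisional (d := d) sg ε i) := by
  have : collisional (d := d) sg ε i = (⋃ n : ℕ × ℕ,
      {w | w.2 ∈ cutoffDomain ε i (1 / ((n.1 : ℝ) + 1)) n.2 n.2 w.1.2}) ∩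
        {w | 0 < impact sg i w.1.2.2 w.2} := by
    ext w
    refine ⟨fun h => ⟨Set.mem_iUnion.2 (exists_mem_cutoffDomain_of_collisional h), h.2⟩, ?_⟩
    rintro ⟨h1, h2⟩
    obtain ⟨n, h3, h4, h5, h6⟩ := Set.mem_iUnion.1 h1
    refine ⟨⟨fun j k hjk hne => lt_of_le_of_lt ?_ (h3 j k hjk hne),
      fun l => lt_of_le_of_lt ?_ (h4 l)⟩, h2⟩
    · have : (0 : ℝ) ≤ Real.sqrt 2 * (1 / ((n.1 : ℝ) + 1)) * n.2 := by positivity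
      linarith
    · have : (0 : ℝ) ≤ (1 / ((n.1 : ℝ) + 1)) * n.2 := by positivity
      linarith
  rw [this]
  exact (MeasurableSet.iUnion fun n => measurableSet_cutoffDomain i _ _ _).inter
    (measurableSet_lt measurable_const (by fun_prop))

/-- On each cut-off domain the backward transport is T_{-kδ} after `preFree`, with k locally
constant in t; measurable versions of these countably many flows, chosen by the value of the floor,
give a measurable version. -/
lemma aemeasurable_backward (hε : 0 < ε) (sg : CollisionSign) (i : Fin s) :
    AEMeasurable (backward sg ε i) ((collisionMeasure d s ε T).restrict (collisional sg ε i)) := by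
  suffices h : ∀ n : ℕ × ℕ, AEMeasurable (backward sg ε i) ((collisionMeasure d s ε T).restrict
      ({w | w.2 ∈ cutoffDomain ε i (1 / ((n.1 : ℝ) + 1)) n.2 n.2 w.1.2} ∩
        {w | 0 < impact sg i w.1.2.2 w.2})) by
    refine (aemeasurable_iUnion_iff.2 h).mono_set fun w hw => ?_
    obtain ⟨n, hn⟩ := exists_mem_cutoffDomain_of_collisional hw
    exact Set.mem_iUnion.2 ⟨n, hn, hw.2⟩
  intro n
  set δ : ℝ := 1 / ((n.1 : ℝ) + 1) with hδ
  have hδ0 : 0 < δ := by positivity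
  choose g hgm hg using fun k : ℤ =>
    (isNonsingularFlow (d := d) (N := s + 1) hε (-(k * δ))).aemeasurable
  have hm : Measurable fun q : ℤ × Config d (s + 1) => g q.1 q.2 :=
    measurable_from_prod_countable_right hgm
  have hgrid : Measurable (gridTime δ) := by unfold gridTime; fun_prop
  refine ⟨fun w => g ⌊w.1.1 / δ⌋
    (preFree sg ε i (w.1.1 - gridTime δ w.1.1) w.1.2 w.2.1 w.2.2), ?_, ?_⟩
  · refine hm.comp (Measurable.prodMk (Int.measurable_floor.comp (by fun_prop)) ?_)
    have := hgrid.comp (measurable_fst.comp measurable_fst :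
      Measurable fun w : (ℝ × Config d s) × (USphere d × Euc d) => w.1.1)
    exact measurable_freeFlow (Measurable.neg (Measurable.sub (by fun_prop) this))
      (measurable_adjoinPre hε sg i (by fun_prop) (by fun_prop) (by fun_prop))
  · have hms : MeasurableSet ({w : (ℝ × Config d s) × (USphere d × Euc d) |
        w.2 ∈ cutoffDomain ε i δ n.2 n.2 w.1.2} ∩ {w | 0 < impact sg i w.1.2.2 w.2}) :=
      (measurableSet_cutoffDomain i _ _ _).inter (measurableSet_lt measurable_const (by fun_prop))
    refine (ae_restrict_iff' hms).2 ?_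
    filter_upwards [ae_backward_of_cutoff hε sg i hδ0 n.2 n.2 (p := fun _ => True) (by simp),
      ae_preFree_of_cutoff hε sg i hδ0 n.2 n.2 (ae_all_iff.2 hg)] with w h1 h2 hw
    rw [← (h1 hw.1 hw.2).1, gridTime]
    exact (h2 hw.1 hw.2).2.2 _

end Backward

/-! ### A jointly measurable representative, continuous in time, of a continuous L^∞-valued function
-/

section Representative

variable {α : Type*} [MeasurableSpace α] {μ : Measure α}

lemma ae_abs_le_norm (f : Lp ℝ ∞ μ) : ∀ᵐ x ∂μ, |f x| ≤ ‖f‖ := by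
  have h := ae_le_lpNorm_exponent_top (Lp.memLp f)
  rwa [← toReal_eLpNorm (Lp.aestronglyMeasurable f), ← Lp.norm_def] at h

lemma ae_abs_sub_le_norm (f g : Lp ℝ ∞ μ) : ∀ᵐ x ∂μ, |f x - g x| ≤ ‖f - g‖ := by
  filter_upwards [ae_abs_le_norm (f - g), Lp.coeFn_sub f g] with x h1 h2
  rwa [h2, Pi.sub_apply] at h1

lemma exists_mem_Ioo_of_ae {p : ℝ → Prop} {T a b : ℝ} (hp : ∀ᵐ t ∂volume.restrict (Set.Icc 0 T), p t)
    (hab : a < b) (ha : 0 ≤ a) (hb : b ≤ T) : ∃ c, a < c ∧ c < b ∧ p c := by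
  have h1 : ∀ᵐ t ∂volume.restrict (Set.Ioo a b), p t :=
    ae_restrict_of_ae_restrict_of_subset
      (show Set.Ioo a b ⊆ Set.Icc 0 T from fun t ht => ⟨ha.trans ht.1.le, ht.2.le.trans hb⟩) hp
  have : NeBot (ae (volume.restrict (Set.Ioo a b))) := by
    rw [ae_neBot, Ne, Measure.restrict_eq_zero, Real.volume_Ioo]
    simpa using hab
  obtain ⟨c, h2, h3⟩ := (h1.and (ae_restrict_mem measurableSet_Ioo)).exists
  exact ⟨c, h3.1, h3.2, h2⟩

/-- Sample times just before the cells of the regular grid, chosen in a set of full measure. -/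
lemma exists_sample {p : ℝ → Prop} {T : ℝ} (hT : 0 < T)
    (hp : ∀ᵐ t ∂volume.restrict (Set.Icc 0 T), p t) (n k : ℕ) :
    ∃ c ∈ Set.Icc 0 T, ∀ t ∈ Set.Icc 0 T, ⌊t * (n + 1) / T⌋₊ = k →
      c ≤ t ∧ t - c ≤ 2 * (T / (n + 1)) ∧ (T / (n + 1) ≤ t → p c) := by
  have hn : (0 : ℝ) < n + 1 := by positivity
  have hτ : 0 < T / (n + 1) := by positivity
  have hcell : ∀ t ∈ Set.Icc 0 T, ⌊t * (n + 1) / T⌋₊ = k →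
      k * (T / (n + 1)) ≤ t ∧ t < (k + 1) * (T / (n + 1)) := by
    intro t ht h
    have h0 : 0 ≤ t * (n + 1) / T := by have := ht.1; positivity
    have h1 := Nat.floor_le h0
    have h2 := Nat.lt_floor_add_one (t * (n + 1) / T)
    rw [h] at h1 h2
    have e : t * (n + 1) / T = t / (T / (n + 1)) := by field_simp
    rw [e] at h1 h2
    exact ⟨(le_div_iff₀ hτ).1 h1, (div_lt_iff₀ hτ).1 h2⟩
  by_cases hk : 1 ≤ k ∧ k * (T / (n + 1)) ≤ T
  · have hk1 : (1 : ℝ) ≤ k := by exact_mod_cast hk.1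
    obtain ⟨c, h1, h2, h3⟩ := exists_mem_Ioo_of_ae hp (a := (k - 1) * (T / (n + 1)))
      (b := k * (T / (n + 1))) (by nlinarith) (mul_nonneg (by linarith) hτ.le) hk.2
    have h4 : 0 ≤ ((k : ℝ) - 1) * (T / (n + 1)) := mul_nonneg (by linarith) hτ.le
    refine ⟨c, ⟨by linarith, by linarith [hk.2]⟩, fun t ht htk => ?_⟩
    have h5 := hcell t ht htk
    exact ⟨by linarith [h5.1], by linarith [h5.2], fun _ => h3⟩
  -- Only the cell k = 0 can contain a time t here. No earlier sample is available for it, so 0 is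
  -- taken and p is not claimed, since t < T / (n + 1).
  · refine ⟨0, ⟨le_rfl, hT.le⟩, fun t ht htk => ?_⟩
    have h5 := hcell t ht htk
    have hk0 : k = 0 := by
      by_contra h
      exact hk ⟨Nat.one_le_iff_ne_zero.2 h, h5.1.trans ht.2⟩
    rw [hk0] at h5
    norm_num at h5
    exact ⟨ht.1, by linarith [h5.2], fun h => absurd h5.2 (not_lt.2 h)⟩

/-- A continuous family of essentially bounded classes has a jointly measurable representative,
continuous in time at every point, to which almost everywhere bounds that increase in time pass. -/
theorem exists_continuous_representative {T : ℝ} (hT : 0 < T) {h : ℝ → Lp ℝ ∞ μ}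
    (hc : ContinuousOn h (Set.Icc 0 T)) {b : ℝ → α → ℝ} (hb0 : ∀ t ∈ Set.Icc 0 T, ∀ Z, 0 ≤ b t Z)
    (hbm : ∀ Z, MonotoneOn (fun t => b t Z) (Set.Icc 0 T))
    (hdom : ∀ᵐ t ∂volume.restrict (Set.Icc 0 T), ∀ᵐ Z ∂μ, |h t Z| ≤ b t Z) :
    ∃ H : ℝ → α → ℝ, Measurable (fun q : ℝ × α => H q.1 q.2) ∧
      (∀ t ∈ Set.Icc 0 T, H t =ᵐ[μ] h t) ∧
      (∀ t ∈ Set.Icc 0 T, ∀ t' ∈ Set.Icc 0 T, ∀ Z, |H t Z - H t' Z| ≤ ‖h t - h t'‖) ∧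
      (∀ t ∈ Set.Icc 0 T, ∀ Z, |H t Z| ≤ ‖h t‖) ∧
      ∀ t ∈ Set.Ioc 0 T, ∀ Z, |H t Z| ≤ b t Z := by
  choose c hcI hc' using exists_sample hT hdom
  choose f hfm hf using fun n k => (Lp.aestronglyMeasurable (h (c n k))).aemeasurable
  -- Only countably many sample times occur, so one null set N carries all failures; setting the
  -- samples to 0 on N makes the estimates hold for every Z.
  have hN : ∀ᵐ Z ∂μ, (∀ n k, f n k Z = h (c n k) Z) ∧
      (∀ n k m l, |h (c n k) Z - h (c m l) Z| ≤ ‖h (c n k) - h (c m l)‖) ∧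
      (∀ n k, |h (c n k) Z| ≤ ‖h (c n k)‖) ∧
      ∀ n k, (∀ᵐ Z ∂μ, |h (c n k) Z| ≤ b (c n k) Z) → |h (c n k) Z| ≤ b (c n k) Z := by
    simp only [eventually_and, ae_all_iff]
    exact ⟨fun n k => (hf n k).symm, fun n k m l => ae_abs_sub_le_norm _ _,
      fun n k => ae_abs_le_norm _, fun n k h => h⟩
  obtain ⟨N, hNsub, hNm, hN0⟩ := exists_measurable_superset_of_null (ae_iff.1 hN)
  have hNae : ∀ᵐ Z ∂μ, Z ∉ N := compl_mem_ae_iff.2 hN0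
  have hN1 : ∀ Z ∉ N, _ := fun Z hZ => not_not.1 fun h => hZ (hNsub h)
  let F : ℕ → ℕ → α → ℝ := fun n k => Nᶜ.indicator (f n k)
  have hFm : ∀ n k, Measurable (F n k) := fun n k => (hfm n k).indicator hNm.compl
  have hFsub : ∀ n k m l Z, |F n k Z - F m l Z| ≤ ‖h (c n k) - h (c m l)‖ := by
    intro n k m l Z
    by_cases hZ : Z ∈ N
    · simp [F, hZ]
    · simp only [F, Set.indicator_of_mem (Set.mem_compl hZ)]
      rw [(hN1 Z hZ).1, (hN1 Z hZ).1]
      exact (hN1 Z hZ).2.1 n k m l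
  have hFle : ∀ n k Z, |F n k Z| ≤ ‖h (c n k)‖ := by
    intro n k Z
    by_cases hZ : Z ∈ N
    · simp [F, hZ]
    · simp only [F, Set.indicator_of_mem (Set.mem_compl hZ)]
      rw [(hN1 Z hZ).1]
      exact (hN1 Z hZ).2.2.1 n k
  have hFb : ∀ n k Z, (∀ᵐ Z ∂μ, |h (c n k) Z| ≤ b (c n k) Z) → |F n k Z| ≤ b (c n k) Z := by
    intro n k Z hgood
    by_cases hZ : Z ∈ N
    · simpa [F, hZ] using hb0 _ (hcI n k) Z
    · simp only [F, Set.indicator_of_mem (Set.mem_compl hZ)]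
      rw [(hN1 Z hZ).1]
      exact (hN1 Z hZ).2.2.2 n k hgood
  let pr : ℝ → ℝ := fun t => max 0 (min t T)
  have hprI : ∀ t, pr t ∈ Set.Icc 0 T := fun t => ⟨le_max_left _ _, max_le hT.le (min_le_right _ _)⟩
  have hpr : ∀ t ∈ Set.Icc 0 T, pr t = t := fun t ht => by
    simp only [pr]; rw [min_eq_left ht.2, max_eq_right ht.1]
  let κ : ℕ → ℝ → ℕ := fun n t => ⌊pr t * (n + 1) / T⌋₊
  have hκm : ∀ n, Measurable (κ n) := fun n => Nat.measurable_floor.comp (by fun_prop)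
  have hcκ : ∀ n t, c n (κ n t) ≤ pr t ∧ pr t - c n (κ n t) ≤ 2 * (T / (n + 1)) ∧
      (T / (n + 1) ≤ pr t → ∀ᵐ Z ∂μ, |h (c n (κ n t)) Z| ≤ b (c n (κ n t)) Z) :=
    fun n t => hc' n _ (pr t) (hprI t) rfl
  have hτ : Tendsto (fun n : ℕ => T / ((n : ℝ) + 1)) atTop (𝓝 0) := by
    have := tendsto_one_div_add_atTop_nhds_zero_nat (𝕜 := ℝ).const_mul T
    simpa [div_eq_mul_inv] using this
  have hclim : ∀ t, Tendsto (fun n => h (c n (κ n t))) atTop (𝓝 (h (pr t))) := by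
    intro t
    refine (hc (pr t) (hprI t)).tendsto.comp (tendsto_nhdsWithin_iff.2
      ⟨?_, Eventually.of_forall fun n => hcI _ _⟩)
    have h1 : Tendsto (fun n : ℕ => pr t - 2 * (T / ((n : ℝ) + 1))) atTop (𝓝 (pr t)) := by
      simpa using (hτ.const_mul 2).const_sub (pr t)
    exact tendsto_of_tendsto_of_tendsto_of_le_of_le h1 tendsto_const_nhds
      (fun n => by have := (hcκ n t).2.1; simp only; linarith) (fun n => (hcκ n t).1)
  have hlim : ∀ t Z, ∃ y, Tendsto (fun n => F n (κ n t) Z) atTop (𝓝 y) := by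
    intro t Z
    -- The differences of the samples are bounded, for every Z, by norms of differences of the
    -- convergent sequence h (c n (κ n t)).
    refine cauchySeq_tendsto_of_complete (Metric.cauchySeq_iff.2 fun η hη => ?_)
    obtain ⟨n0, hn0⟩ := Metric.cauchySeq_iff.1 (hclim t).cauchySeq η hη
    refine ⟨n0, fun m hm n hn => ?_⟩
    rw [Real.dist_eq]
    refine (hFsub _ _ _ _ Z).trans_lt ?_
    rw [← dist_eq_norm]
    exact hn0 m hm n hn
  choose H hH using hlim
  refine ⟨H, ?_, ?_, ?_, ?_, ?_⟩
  · refine measurable_of_tendsto_metrizable (f := fun n (q : ℝ × α) => F n (κ n q.1) q.2)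
      (fun n => ?_) (tendsto_pi_nhds.2 fun q => hH q.1 q.2)
    exact (measurable_from_prod_countable_right (f := fun p : ℕ × α => F n p.1 p.2) (hFm n)).comp
      (Measurable.prodMk ((hκm n).comp measurable_fst) measurable_snd)
  · intro t ht
    have h1 : ∀ᵐ Z ∂μ, ∀ n, |h (c n (κ n t)) Z - h t Z| ≤ ‖h (c n (κ n t)) - h t‖ :=
      ae_all_iff.2 fun n => ae_abs_sub_le_norm _ _
    filter_upwards [hNae, h1] with Z hZ h2
    refine tendsto_nhds_unique (hH t Z) (tendsto_iff_norm_sub_tendsto_zero.2 ?_)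
    have h3 := tendsto_iff_norm_sub_tendsto_zero.1 (hclim t)
    rw [hpr t ht] at h3
    refine squeeze_zero (fun n => norm_nonneg _) (fun n => ?_) h3
    simp only [F, Set.indicator_of_mem (Set.mem_compl hZ)]
    rw [(hN1 Z hZ).1]
    exact h2 n
  · intro t ht t' ht' Z
    have h1 := ((hclim t).sub (hclim t')).norm
    rw [hpr t ht, hpr t' ht'] at h1
    exact le_of_tendsto_of_tendsto' ((hH t Z).sub (hH t' Z)).abs h1 fun n => hFsub _ _ _ _ Z
  · intro t ht Z
    have h1 := (hclim t).norm
    rw [hpr t ht] at h1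
    exact le_of_tendsto_of_tendsto' (hH t Z).abs h1 fun n => hFle _ _ Z
  · intro t ht Z
    have htI : t ∈ Set.Icc 0 T := ⟨ht.1.le, ht.2⟩
    refine le_of_tendsto (hH t Z).abs ?_
    filter_upwards [hτ.eventually (gt_mem_nhds ht.1)] with n hn
    have h1 := hcκ n t
    rw [hpr t htI] at h1
    -- The sample time precedes t, so the bound there is at most the bound at t. At t = 0 no such
    -- sample exists, which is why 0 is excluded.
    exact (hFb _ _ Z (h1.2.2 hn.le)).trans (hbm Z (hcI _ _) htI h1.1)

end Representative

/-! ### Integrals of (ω·x)_± over the sphere -/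

section SphereIntegral

variable {d : ℕ}

open Pointwise in
lemma measurePreserving_neg_sphere :
    MeasurePreserving (fun ω : USphere d => -ω) (sphereMeasure d) (sphereMeasure d) := by
  have hm : Measurable fun ω : USphere d => -ω :=
    (continuous_neg (G := USphere d)).measurable
  refine ⟨hm, Measure.ext fun S hS => ?_⟩
  rw [Measure.map_apply hm hS, sphereMeasure, Measure.toSphere_apply' _ hS,
    Measure.toSphere_apply' _ (hm hS)]
  congr 1
  have : Set.Ioo (0 : ℝ) 1 • ((↑) '' ((fun ω : USphere d => -ω) ⁻¹' S) : Set (Euc d)) =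
      -(Set.Ioo (0 : ℝ) 1 • ((↑) '' S : Set (Euc d))) := by
    ext x
    simp only [Set.mem_neg, Set.mem_smul, Set.mem_image, Set.mem_preimage]
    constructor
    · rintro ⟨r, hr, _, ⟨ω, hω, rfl⟩, rfl⟩
      exact ⟨r, hr, _, ⟨-ω, hω, rfl⟩, by simp⟩
    · rintro ⟨r, hr, _, ⟨ω, hω, rfl⟩, h⟩
      exact ⟨r, hr, _, ⟨-ω, by simpa using hω, rfl⟩, by simpa using congrArg Neg.neg h⟩
  rw [this, Measure.measure_neg]

lemma part_add_part_neg (sg : CollisionSign) (a : ℝ) : sg.part a + sg.part (-a) = |a| := by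
  cases sg <;> simp only [CollisionSign.part, neg_neg] <;>
    rcases le_total 0 a with h | h <;> simp [h, abs_of_nonneg, abs_of_nonpos]

lemma part_le_abs (sg : CollisionSign) (a : ℝ) : sg.part a ≤ |a| := by
  rw [← part_add_part_neg sg a]
  exact le_add_of_nonneg_right (part_nonneg sg _)

/-- By the symmetry ω ↦ -ω the positive and negative parts have the same integral, and their sum is
|ω·x| ≤ ‖x‖. This is the origin of the factor 1/2 in the theorem. -/
lemma integral_part_inner_le (sg : CollisionSign) (x : Euc d) :
    ∫ ω, sg.part (inner ℝ (ω : Euc d) x) ∂sphereMeasure d ≤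
      (sphereMeasure d).real Set.univ / 2 * ‖x‖ := by
  have hcont : Continuous fun ω : USphere d => sg.part (inner ℝ (ω : Euc d) x) :=
    (continuous_part sg).comp (by fun_prop)
  have hle : ∀ ω : USphere d, |inner ℝ (ω : Euc d) x| ≤ ‖x‖ := by
    intro ω
    have := abs_real_inner_le_norm (ω : Euc d) x
    rwa [norm_eq_of_mem_sphere, one_mul] at this
  have hint : Integrable (fun ω : USphere d => sg.part (inner ℝ (ω : Euc d) x))
      (sphereMeasure d) := by
    refine Integrable.of_bound hcont.aestronglyMeasurable ‖x‖ (Eventually.of_forall fun ω => ?_)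
    rw [Real.norm_of_nonneg (part_nonneg _ _)]
    exact (part_le_abs _ _).trans (hle ω)
  have hneg := measurePreserving_neg_sphere (d := d)
  have heq : ∫ ω, sg.part (-inner ℝ (ω : Euc d) x) ∂sphereMeasure d =
      ∫ ω, sg.part (inner ℝ (ω : Euc d) x) ∂sphereMeasure d := by
    rw [← hneg.integral_comp (Homeomorph.neg (USphere d)).measurableEmbedding]
    simp
  have hint' : Integrable (fun ω : USphere d => sg.part (-inner ℝ (ω : Euc d) x))
      (sphereMeasure d) := by
    have := hneg.integrable_comp_of_integrable hint
    simpa [Function.comp_def] using this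
  have h2 : ∫ ω, (sg.part (inner ℝ (ω : Euc d) x) + sg.part (-inner ℝ (ω : Euc d) x))
      ∂sphereMeasure d ≤ ∫ _ω : USphere d, ‖x‖ ∂sphereMeasure d := by
    refine integral_mono (hint.add hint') (integrable_const _) fun ω => ?_
    simp only [part_add_part_neg]
    exact hle ω
  rw [integral_add hint hint', heq, integral_const, smul_eq_mul] at h2
  linarith

end SphereIntegral

/-! ### Composition of the weight with the norm of the velocities -/

section Weights

variable {d s : ℕ}

lemma velNorm_eq (V : Fin s → Euc d) (v : Euc d) :
    velNorm V v = Real.sqrt (famNorm V ^ 2 + ‖v‖ ^ 2) := by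
  rw [velNorm, famNorm, famNorm, Real.sq_sqrt (Finset.sum_nonneg fun _ _ => sq_nonneg _),
    Fin.sum_univ_castSucc]
  simp

lemma velNorm_nonneg (V : Fin s → Euc d) (v : Euc d) : 0 ≤ velNorm V v := famNorm_nonneg _

lemma norm_le_velNorm (V : Fin s → Euc d) (v : Euc d) (i : Fin s) : ‖V i‖ ≤ velNorm V v := by
  have := norm_le_famNorm (Fin.snoc (α := fun _ => Euc d) V v) i.castSucc
  rwa [Fin.snoc_castSucc] at this

lemma norm_le_velNorm_last (V : Fin s → Euc d) (v : Euc d) : ‖v‖ ≤ velNorm V v := by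
  have := norm_le_famNorm (Fin.snoc (α := fun _ => Euc d) V v) (Fin.last s)
  rwa [Fin.snoc_last] at this

lemma norm_sub_le_velNorm (V : Fin s → Euc d) (v : Euc d) (i : Fin s) :
    ‖v - V i‖ ≤ Real.sqrt 2 * velNorm V v := by
  have := norm_sub_le_famNorm (Fin.snoc (α := fun _ => Euc d) V v) (castSucc_ne_last i).symm
  rwa [Fin.snoc_last, Fin.snoc_castSucc] at this

@[fun_prop]
lemma measurable_velNorm {α : Type*} [MeasurableSpace α] {V : α → Fin s → Euc d} {v : α → Euc d}
    (hV : Measurable V) (hv : Measurable v) : Measurable fun a => velNorm (V a) (v a) := by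
  simp only [velNorm_eq]
  have := continuous_famNorm.measurable.comp hV
  exact ((this.pow_const 2).add (hv.norm.pow_const 2)).sqrt

/-- The inverse map x ↦ √(x² - a²) is differentiable on (a, ∞), hence sends null sets to null sets.
The end point x = a corresponds to r = 0, which is left out. -/
lemma volume_sqrt_preimage_eq_zero {a : ℝ} (ha : 0 ≤ a) {A : Set ℝ} (hA : volume (A ∩ Set.Ici 0) = 0) :
    volume {r : ℝ | 0 < r ∧ Real.sqrt (a ^ 2 + r ^ 2) ∈ A} = 0 := by
  have h1 : volume ((fun x : ℝ => Real.sqrt (x ^ 2 - a ^ 2)) '' (A ∩ Set.Ioi a)) = 0 := by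
    refine addHaar_image_eq_zero_of_differentiableOn_of_addHaar_eq_zero volume ?_
      (measure_mono_null (Set.inter_subset_inter_right A
        (show Set.Ioi a ⊆ Set.Ici 0 from fun x hx => ha.trans (le_of_lt hx))) hA)
    intro x hx
    have hx : a < x := hx.2
    refine (DifferentiableAt.sqrt (by fun_prop) ?_).differentiableWithinAt
    nlinarith
  refine measure_mono_null ?_ h1
  rintro r ⟨hr, hrA⟩
  have h0 : 0 ≤ a ^ 2 + r ^ 2 := by positivity
  refine ⟨Real.sqrt (a ^ 2 + r ^ 2), ⟨hrA, ?_⟩, ?_⟩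
  · exact Real.lt_sqrt_of_sq_lt (by nlinarith)
  · simp only [Real.sq_sqrt h0, add_sub_cancel_left]
    exact Real.sqrt_sq hr.le

variable [NeZero d]

lemma volume_velNorm_preimage_eq_zero (V : Fin s → Euc d) {A : Set ℝ} (hA : MeasurableSet A)
    (hA0 : volume (A ∩ Set.Ici 0) = 0) : volume {v : Euc d | velNorm V v ∈ A} = 0 := by
  have hm : MeasurableSet {v : Euc d | velNorm V v ∈ A} :=
    (by fun_prop : Measurable fun v : Euc d => velNorm V v) hA
  rw [← lintegral_indicator_one hm, lintegral_polar (measurable_one.indicator hm),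
    lintegral_eq_zero_of_ae_eq_zero]
  refine Eventually.of_forall fun ω => ?_
  refine (setLIntegral_congr_fun_ae measurableSet_Ioi (g := fun _ => 0) ?_).trans (by simp)
  have h := volume_sqrt_preimage_eq_zero (famNorm_nonneg V) hA0
  filter_upwards [compl_mem_ae_iff.2 h] with r hr hr0
  have hr0 : 0 < r := hr0
  rw [Set.indicator_of_notMem, mul_zero]
  intro hc
  refine hr ⟨hr0, ?_⟩
  have hc : velNorm V (r • (ω : Euc d)) ∈ A := hc
  rwa [velNorm_eq, norm_smul, norm_eq_of_mem_sphere, mul_one, Real.norm_of_nonneg hr0.le] at hc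

/-- The weight is only almost everywhere measurable on [0, T] × [0, ∞), so its composition with
|V_{s+1}| is measurable only once null sets are known to pull back to null sets. -/
lemma quasiMeasurePreserving_velNorm (T : ℝ) :
    Measure.QuasiMeasurePreserving
      (fun q : (ℝ × (Fin s → Euc d)) × Euc d => (q.1.1, velNorm q.1.2 q.2))
      (((volume.restrict (Set.Icc 0 T)).prod volume).prod volume)
      (volume.restrict (Set.Icc 0 T ×ˢ Set.Ici 0)) := by
  have hm : Measurable fun q : (ℝ × (Fin s → Euc d)) × Euc d => (q.1.1, velNorm q.1.2 q.2) := by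
    fun_prop
  refine ⟨hm, Measure.AbsolutelyContinuous.mk fun A hA hA0 => ?_⟩
  rw [Measure.volume_eq_prod, ← Measure.prod_restrict, Measure.measure_prod_null hA] at hA0
  rw [Measure.map_apply hm hA, Measure.measure_prod_null (hm hA)]
  have h1 := Measure.quasiMeasurePreserving_fst (μ := volume.restrict (Set.Icc 0 T))
    (ν := (volume : Measure (Fin s → Euc d))) |>.ae hA0
  filter_upwards [h1] with q hq
  rw [Pi.zero_apply, Measure.restrict_apply (measurable_prodMk_left hA)] at hq
  exact volume_velNorm_preimage_eq_zero q.2 (measurable_prodMk_left hA) hq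

lemma quasiMeasurePreserving_timeVel (ε T : ℝ) :
    Measure.QuasiMeasurePreserving (fun z : ℝ × Config d s => (z.1, z.2.2))
      (timePhaseMeasure d s ε T) ((volume.restrict (Set.Icc 0 T)).prod volume) := by
  have h1 : Measure.QuasiMeasurePreserving (Prod.snd : Config d s → _) (phaseMeasure d s ε)
      volume :=
    (Measure.quasiMeasurePreserving_snd (μ := (volume : Measure (Fin s → Euc d)))
      (ν := (volume : Measure (Fin s → Euc d)))).mono_left
      Measure.restrict_le_self.absolutelyContinuous
  exact QuasiMeasurePreserving.prodMap (Measure.QuasiMeasurePreserving.id _) h1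

variable {T : ℝ} {g : ℝ → ℝ → ℝ}

/-- The weight is measurable in the added velocity, and has uniformly bounded integrals. -/
lemma ae_integrable_weight (hT : 0 < T) (hg : IsVelocityWeight d s T g) (ε : ℝ) :
    ∃ C : ℝ, ∀ᵐ z ∂timePhaseMeasure d s ε T, z.1 ∈ Set.Ioc 0 T ∧
      AEStronglyMeasurable (fun v : Euc d => g z.1 (velNorm z.2.2 v)) ∧
      Integrable (fun v : Euc d => velNorm z.2.2 v * g T (velNorm z.2.2 v)) ∧
      ∫ v : Euc d, velNorm z.2.2 v * g T (velNorm z.2.2 v) ≤ C := by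
  have hTI : T ∈ Set.Icc 0 T := ⟨hT.le, le_rfl⟩
  -- As g is nondecreasing in time, the final time dominates all others; a single C and a single
  -- exceptional set of velocities suffice.
  obtain ⟨C, hC⟩ := hg.bounded T hTI
  have hq := quasiMeasurePreserving_timeVel (d := d) (s := s) ε T
  have h1 : ∀ᵐ q ∂(volume.restrict (Set.Icc 0 T)).prod (volume : Measure (Fin s → Euc d)),
      Integrable (fun v : Euc d => velNorm q.2 v * g T (velNorm q.2 v)) ∧
      ∫ v : Euc d, velNorm q.2 v * g T (velNorm q.2 v) ≤ C :=
    Measure.quasiMeasurePreserving_snd.ae ((hg.integrable T hTI).and hC)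
  have h2 : AEStronglyMeasurable
      (fun q : (ℝ × (Fin s → Euc d)) × Euc d => g q.1.1 (velNorm q.1.2 q.2))
      (((volume.restrict (Set.Icc 0 T)).prod volume).prod volume) :=
    (hg.measurable.comp_quasiMeasurePreserving
      (quasiMeasurePreserving_velNorm T)).aestronglyMeasurable
  have h3 : ∀ᵐ t ∂volume.restrict (Set.Icc 0 T), t ∈ Set.Ioc 0 T := by
    rw [restrict_Ioc_eq_restrict_Icc.symm]
    exact ae_restrict_mem measurableSet_Ioc
  refine ⟨C, ?_⟩
  filter_upwards [hq.ae h1, hq.ae h2.prodMk_left,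
    Measure.quasiMeasurePreserving_fst.ae h3] with z h4 h5 h6
  exact ⟨h6, h5, h4⟩

end Weights

/-! ### Convergence in L^∞ and uniqueness of limits -/

section EssentialSupremum

variable {α ι : Type*} [MeasurableSpace α] {μ : Measure α} {l : Filter ι}

lemma tendsto_eLpNorm_top_zero {f : ι → α → ℝ}
    (h : ∀ c : ℝ, 0 < c → ∀ᶠ a in l, ∀ᵐ z ∂μ, |f a z| ≤ c) :
    Tendsto (fun a => eLpNorm (f a) ∞ μ) l (𝓝 0) := by
  refine ENNReal.tendsto_nhds_zero.2 fun c hc => ?_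
  obtain ⟨c', hc'0, hc'⟩ : ∃ c' : ℝ, 0 < c' ∧ ENNReal.ofReal c' ≤ c := by
    rcases eq_or_ne c ∞ with rfl | hct
    · exact ⟨1, one_pos, le_top⟩
    · exact ⟨c.toReal, ENNReal.toReal_pos hc.ne' hct, (ENNReal.ofReal_toReal hct).le⟩
  filter_upwards [h c' hc'0] with a ha
  rw [eLpNorm_exponent_top]
  exact (eLpNormEssSup_le_of_ae_bound ha).trans hc'

lemma eventually_ae_abs_le_of_tendsto {f : ι → α → ℝ}
    (h : Tendsto (fun a => eLpNorm (f a) ∞ μ) l (𝓝 0)) {c : ℝ} (hc : 0 < c) :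
    ∀ᶠ a in l, ∀ᵐ z ∂μ, |f a z| ≤ c := by
  filter_upwards [h.eventually (gt_mem_nhds (ENNReal.ofReal_pos.2 hc))] with a ha
  filter_upwards [ae_le_eLpNormEssSup (f := f a) (μ := μ)] with z hz
  rw [← eLpNorm_exponent_top] at hz
  have := hz.trans ha.le
  rwa [← ofReal_norm, ENNReal.ofReal_le_ofReal_iff hc.le] at this

lemma ae_eq_of_tendsto_eLpNorm [NeBot l] {p : ℝ≥0∞} (hp : 1 ≤ p) {f f' : ι → α → ℝ} {a b : α → ℝ}
    (hf : ∀ᶠ n in l, AEStronglyMeasurable (f n) μ) (hff : ∀ᶠ n in l, f n =ᵐ[μ] f' n)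
    (ha : AEStronglyMeasurable a μ) (hb : AEStronglyMeasurable b μ)
    (h1 : Tendsto (fun n => eLpNorm (f n - a) p μ) l (𝓝 0))
    (h2 : Tendsto (fun n => eLpNorm (f' n - b) p μ) l (𝓝 0)) : a =ᵐ[μ] b := by
  have h3 : eLpNorm (a - b) p μ = 0 := by
    refine le_antisymm (ge_of_tendsto (by simpa using h1.add h2) ?_) zero_le
    filter_upwards [hf, hff] with n hn hn'
    have e1 : eLpNorm (f' n - b) p μ = eLpNorm (f n - b) p μ :=
      eLpNorm_congr_ae (hn'.symm.sub EventuallyEq.rfl)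
    have e2 : a - b = (f n - b) - (f n - a) := by abel
    rw [e1, e2, add_comm]
    exact eLpNorm_sub_le (hn.sub hb) (hn.sub ha) hp
  rw [eLpNorm_eq_zero_iff (ha.sub hb) (by positivity)] at h3
  filter_upwards [h3] with z hz using sub_eq_zero.1 hz

end EssentialSupremum

/-! ### Integrals of kernels over impact directions and added velocities -/

section Averages

variable {d s : ℕ} {ε T : ℝ}

/-- The integral of a kernel over the impact directions and the added velocities. -/
def average (ε : ℝ) (K : (ℝ × Config d s) × (USphere d × Euc d) → ℝ) (z : ℝ × Config d s) : ℝ :=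
  ε ^ (d - 1) * ∫ p, K (z, p) ∂((sphereMeasure d).prod volume)

variable {K : (ℝ × Config d s) × (USphere d × Euc d) → ℝ}

lemma integral_abs_indicator_le {z : ℝ × Config d s}
    (hK : Integrable (fun p => K (z, p)) ((sphereMeasure d).prod volume))
    (A : Set ((ℝ × Config d s) × (USphere d × Euc d))) :
    ∫ p, |A.indicator K (z, p)| ∂((sphereMeasure d).prod volume) ≤
      ∫ p, |K (z, p)| ∂((sphereMeasure d).prod volume) := by
  refine integral_mono_of_nonneg (Eventually.of_forall fun p => abs_nonneg _) hK.abs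
    (Eventually.of_forall fun p => ?_)
  simp only
  by_cases h : (z, p) ∈ A
  · rw [Set.indicator_of_mem h]
  · rw [Set.indicator_of_notMem h, abs_zero]
    exact abs_nonneg _

lemma integrable_indicator_section {z : ℝ × Config d s}
    (hK : Integrable (fun p => K (z, p)) ((sphereMeasure d).prod volume))
    {A : Set ((ℝ × Config d s) × (USphere d × Euc d))} (hA : MeasurableSet A) :
    Integrable (fun p => A.indicator K (z, p)) ((sphereMeasure d).prod volume) :=
  hK.indicator (measurable_prodMk_left (x := z) hA)

/-- Times and configurations with bounded positions and velocities. -/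
def timeBox (d s : ℕ) (R₁ R₂ : ℝ) : Set (ℝ × Config d s) :=
  Set.univ ×ˢ (posBox d s R₁ ×ˢ posBox d s R₂)

lemma measurableSet_timeBox (R₁ R₂ : ℝ) : MeasurableSet (timeBox d s R₁ R₂) :=
  MeasurableSet.univ.prod ((measurableSet_posBox s R₁).prod (measurableSet_posBox s R₂))

lemma mem_timeBox {i : Fin s} {R₁ R₂ : ℝ} {z : ℝ × Config d s} {p : USphere d × Euc d}
    (h1 : famNorm (adjoin ε i z.2 p.1 p.2).1 ≤ R₁) (h2 : velNorm z.2.2 p.2 ≤ R₂) :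
    z ∈ timeBox d s R₁ R₂ := by
  refine ⟨trivial, fun l => ?_, fun l => (norm_le_velNorm _ _ l).trans h2⟩
  have := norm_le_famNorm (adjoin ε i z.2 p.1 p.2).1 l.castSucc
  simp only [adjoin, Fin.snoc_castSucc] at this
  exact this.trans h1

lemma tendsto_average {ι : Type*} {l : Filter ι} [l.IsCountablyGenerated] {z : ℝ × Config d s}
    (hK : Integrable (fun p => K (z, p)) ((sphereMeasure d).prod volume))
    {A : ι → Set ((ℝ × Config d s) × (USphere d × Euc d))}
    {B : Set ((ℝ × Config d s) × (USphere d × Euc d))} (hA : ∀ a, MeasurableSet (A a))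
    (h : ∀ p, ∀ᶠ a in l, (A a).indicator K (z, p) = B.indicator K (z, p)) :
    Tendsto (fun a => average ε ((A a).indicator K) z) l (𝓝 (average ε (B.indicator K) z)) := by
  refine Tendsto.const_mul _ (tendsto_integral_filter_of_dominated_convergence
    (fun p => |K (z, p)|) (Eventually.of_forall fun a =>
      (integrable_indicator_section hK (hA a)).aestronglyMeasurable)
    (Eventually.of_forall fun a => Eventually.of_forall fun p => ?_) hK.abs
    (Eventually.of_forall fun p => tendsto_const_nhds.congr' ?_))
  · by_cases hp : (z, p) ∈ A a
    · rw [Set.indicator_of_mem hp, Real.norm_eq_abs]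
    · rw [Set.indicator_of_notMem hp, norm_zero]
      exact abs_nonneg _
  · filter_upwards [h p] with a ha using ha.symm

lemma average_eq_zero_of_notMem_timeBox {i : Fin s} {R₁ R₂ : ℝ} {z : ℝ × Config d s}
    {A : Set ((ℝ × Config d s) × (USphere d × Euc d))}
    (hA : ∀ w ∈ A, famNorm (adjoin ε i w.1.2 w.2.1 w.2.2).1 ≤ R₁ ∧ velNorm w.1.2.2 w.2.2 ≤ R₂)
    (hz : z ∉ timeBox d s R₁ R₂) : average ε (A.indicator K) z = 0 := by
  have : ∀ p, A.indicator K (z, p) = 0 := by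
    refine fun p => Set.indicator_of_notMem (fun h => ?_) _
    have h1 := hA (z, p) h
    exact hz (mem_timeBox (p := p) h1.1 h1.2)
  simp [average, this]

lemma abs_average_le (hε : 0 < ε) (z : ℝ × Config d s) :
    |average ε K z| ≤ ε ^ (d - 1) * ∫ p, |K (z, p)| ∂((sphereMeasure d).prod volume) := by
  rw [average, abs_mul, abs_of_pos (pow_pos hε _)]
  exact mul_le_mul_of_nonneg_left (norm_integral_le_integral_norm fun p => K (z, p))
    (pow_pos hε _).le

variable [NeZero d]

lemma aestronglyMeasurable_average (hK : AEStronglyMeasurable K (collisionMeasure d s ε T)) :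
    AEStronglyMeasurable (average ε K) (timePhaseMeasure d s ε T) :=
  (MeasureTheory.AEStronglyMeasurable.integral_prod_right' (E := ℝ) hK).const_mul _

lemma memLp_average_top (hε : 0 < ε) (hK : AEStronglyMeasurable K (collisionMeasure d s ε T))
    {M : ℝ} (hM : ∀ᵐ z ∂timePhaseMeasure d s ε T,
      ε ^ (d - 1) * ∫ p, |K (z, p)| ∂((sphereMeasure d).prod volume) ≤ M) :
    MemLp (average ε K) ∞ (timePhaseMeasure d s ε T) :=
  memLp_top_of_bound (aestronglyMeasurable_average hK) M (by
    filter_upwards [hM] with z hz using (abs_average_le hε z).trans hz)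

lemma timePhaseMeasure_timeBox_lt_top (ε T R₁ R₂ : ℝ) :
    timePhaseMeasure d s ε T (timeBox d s R₁ R₂) < ∞ := by
  rw [timePhaseMeasure, timeBox, Measure.prod_prod]
  refine ENNReal.mul_lt_top (by simp) ((Measure.restrict_apply_le _ _).trans_lt ?_)
  rw [Measure.volume_eq_prod, Measure.prod_prod]
  exact ENNReal.mul_lt_top (volume_posBox_lt_top s R₁) (volume_posBox_lt_top s R₂)

lemma memLp_average_one {i : Fin s} {R₁ R₂ : ℝ}
    {A : Set ((ℝ × Config d s) × (USphere d × Euc d))}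
    (hA : ∀ w ∈ A, famNorm (adjoin ε i w.1.2 w.2.1 w.2.2).1 ≤ R₁ ∧ velNorm w.1.2.2 w.2.2 ≤ R₂)
    (h : MemLp (average ε (A.indicator K)) ∞ (timePhaseMeasure d s ε T)) :
    MemLp (average ε (A.indicator K)) 1 (timePhaseMeasure d s ε T) := by
  have e : average ε (A.indicator K) =
      (timeBox d s R₁ R₂).indicator (average ε (A.indicator K)) := by
    funext z
    by_cases hz : z ∈ timeBox d s R₁ R₂
    · rw [Set.indicator_of_mem hz]
    · rw [Set.indicator_of_notMem hz, average_eq_zero_of_notMem_timeBox hA hz]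
  rw [e, memLp_indicator_iff_restrict (measurableSet_timeBox R₁ R₂)]
  have : IsFiniteMeasure ((timePhaseMeasure d s ε T).restrict (timeBox d s R₁ R₂)) :=
    ⟨by rw [Measure.restrict_apply_univ]; exact timePhaseMeasure_timeBox_lt_top ε T R₁ R₂⟩
  exact (h.restrict _).mono_exponent le_top

/-- Dominated convergence is used twice: in (ω, v) for almost every z, then in z. The averages
vanish outside `timeBox`, which has finite measure, and are bounded by M inside. -/
lemma tendsto_average_L1 (hε : 0 < ε) {i : Fin s} {R₁ R₂ M : ℝ} {ι : Type*} {l : Filter ι}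
    [l.IsCountablyGenerated]
    (hK : AEStronglyMeasurable K (collisionMeasure d s ε T))
    (hM : ∀ᵐ z ∂timePhaseMeasure d s ε T,
      Integrable (fun p => K (z, p)) ((sphereMeasure d).prod volume) ∧
      ε ^ (d - 1) * ∫ p, |K (z, p)| ∂((sphereMeasure d).prod volume) ≤ M)
    {A : ι → Set ((ℝ × Config d s) × (USphere d × Euc d))}
    {B : Set ((ℝ × Config d s) × (USphere d × Euc d))} (hA : ∀ a, MeasurableSet (A a))
    (hB : MeasurableSet B)
    (hA' : ∀ a, ∀ w ∈ A a,
      famNorm (adjoin ε i w.1.2 w.2.1 w.2.2).1 ≤ R₁ ∧ velNorm w.1.2.2 w.2.2 ≤ R₂)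
    (hB' : ∀ w ∈ B, famNorm (adjoin ε i w.1.2 w.2.1 w.2.2).1 ≤ R₁ ∧ velNorm w.1.2.2 w.2.2 ≤ R₂)
    (h : ∀ w, ∀ᶠ a in l, (A a).indicator K w = B.indicator K w) :
    Tendsto (fun a => eLpNorm (average ε ((A a).indicator K) - average ε (B.indicator K)) 1
      (timePhaseMeasure d s ε T)) l (𝓝 0) := by
  have hmeas : ∀ {A : Set ((ℝ × Config d s) × (USphere d × Euc d))}, MeasurableSet A →
      AEStronglyMeasurable (average ε (A.indicator K)) (timePhaseMeasure d s ε T) :=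
    fun hA => aestronglyMeasurable_average (hK.indicator hA)
  have hbound : ∀ {A : Set ((ℝ × Config d s) × (USphere d × Euc d))} {z : ℝ × Config d s},
      Integrable (fun p => K (z, p)) ((sphereMeasure d).prod volume) →
      ε ^ (d - 1) * ∫ p, |K (z, p)| ∂((sphereMeasure d).prod volume) ≤ M →
      |average ε (A.indicator K) z| ≤ M := by
    intro A z h1 h2
    refine (abs_average_le hε z).trans (le_trans ?_ h2)
    exact mul_le_mul_of_nonneg_left (integral_abs_indicator_le h1 A) (pow_pos hε _).le
  simp only [eLpNorm_one_eq_lintegral_enorm]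
  have hlim := tendsto_lintegral_filter_of_dominated_convergence' (l := l)
    (μ := timePhaseMeasure d s ε T)
    (F := fun a z => ‖(average ε ((A a).indicator K) - average ε (B.indicator K)) z‖ₑ)
    (f := fun _ => 0)
    (fun z => (timeBox d s R₁ R₂).indicator (fun _ => ENNReal.ofReal (2 * M)) z)
    (Eventually.of_forall fun a => ?_) (Eventually.of_forall fun a => ?_) ?_ ?_
  · simpa using hlim
  · exact ((hmeas (hA a)).sub (hmeas hB)).enorm
  · filter_upwards [hM] with z hz
    by_cases hzB : z ∈ timeBox d s R₁ R₂
    · rw [Set.indicator_of_mem hzB, ← ofReal_norm]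
      refine ENNReal.ofReal_le_ofReal ?_
      have h1 := hbound (A := A a) hz.1 hz.2
      have h2 := hbound (A := B) hz.1 hz.2
      rw [Pi.sub_apply]
      exact (norm_sub_le _ _).trans (by rw [two_mul]; exact add_le_add h1 h2)
    · rw [Pi.sub_apply, average_eq_zero_of_notMem_timeBox (hA' a) hzB,
        average_eq_zero_of_notMem_timeBox hB' hzB]
      simp
  · rw [lintegral_indicator_const (measurableSet_timeBox R₁ R₂)]
    exact ENNReal.mul_ne_top ENNReal.ofReal_ne_top (timePhaseMeasure_timeBox_lt_top ε T R₁ R₂).ne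
  · filter_upwards [hM] with z hz
    have h1 := tendsto_average (ε := ε) hz.1 hA (fun p => h (z, p))
    have h2 := (h1.sub_const (average ε (B.indicator K) z)).enorm
    simpa using h2

end Averages

/-! ### The collision kernel and its domination by the weight -/

section Kernel

variable {d s : ℕ}

lemma impact_le (sg : CollisionSign) (i : Fin s) (V : Fin s → Euc d) (p : USphere d × Euc d) :
    impact sg i V p ≤ ‖p.2 - V i‖ := by
  refine (part_le_abs _ _).trans ((abs_real_inner_le_norm _ _).trans ?_)
  rw [norm_eq_of_mem_sphere, one_mul]

lemma impact_le_velNorm (sg : CollisionSign) (i : Fin s) (V : Fin s → Euc d)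
    (p : USphere d × Euc d) : impact sg i V p ≤ Real.sqrt 2 * velNorm V p.2 :=
  (impact_le sg i V p).trans (norm_sub_le_velNorm V p.2 i)

variable {ε T : ℝ} {sg : CollisionSign} {i : Fin s}

variable {g : ℝ → ℝ → ℝ} {lam : ℝ}

/-- The estimates that hold for almost all times and configurations. -/
structure IsKernelSection (sg : CollisionSign) (i : Fin s) (T : ℝ) (g : ℝ → ℝ → ℝ) (lam : ℝ)
    (K : (ℝ × Config d s) × (USphere d × Euc d) → ℝ) (z : ℝ × Config d s) : Prop where
  time : z.1 ∈ Set.Ioc 0 T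
  measurable_weight : AEStronglyMeasurable fun v : Euc d => g z.1 (velNorm z.2.2 v)
  integrable_weight : Integrable fun v : Euc d => velNorm z.2.2 v * g z.1 (velNorm z.2.2 v)
  le : ∀ᵐ p ∂(sphereMeasure d).prod volume,
    |K (z, p)| ≤ impact sg i z.2.2 p * (lam * g z.1 (velNorm z.2.2 p.2))
  integrable : Integrable (fun p => K (z, p)) ((sphereMeasure d).prod volume)

variable {K : (ℝ × Config d s) × (USphere d × Euc d) → ℝ} {z : ℝ × Config d s}

lemma IsKernelSection.integrable_sum (hg : IsVelocityWeight d s T g)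
    (h : IsKernelSection sg i T g lam K z) :
    Integrable fun v : Euc d => (‖z.2.2 i‖ + ‖v‖) * g z.1 (velNorm z.2.2 v) := by
  refine (h.integrable_weight.const_mul 2).mono'
    ((Continuous.aestronglyMeasurable (by fun_prop)).mul h.measurable_weight)
    (Eventually.of_forall fun v => ?_)
  have hg0 : 0 ≤ g z.1 (velNorm z.2.2 v) :=
    hg.nonneg _ ⟨h.time.1.le, h.time.2⟩ _ (velNorm_nonneg _ _)
  rw [Real.norm_of_nonneg (by positivity), ← mul_assoc]
  refine mul_le_mul_of_nonneg_right ?_ hg0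
  linarith [norm_le_velNorm z.2.2 v i, norm_le_velNorm_last z.2.2 v]

/-- The configurations with velocities bounded by `R`. -/
def speedSet (d s : ℕ) (R : ℝ) : Set ((ℝ × Config d s) × (USphere d × Euc d)) :=
  {w | velNorm w.1.2.2 w.2.2 ≤ R}

lemma measurableSet_speedSet (R : ℝ) : MeasurableSet (speedSet d s R) :=
  measurableSet_le (by fun_prop) measurable_const

/-- The weight does not depend on ω, so the sphere is integrated first; this produces half its
surface times |v - v_i| ≤ |v_i| + |v|. -/
lemma IsKernelSection.abs_average_le (hε : 0 < ε) (hg : IsVelocityWeight d s T g) (hlam : 0 ≤ lam)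
    (h : IsKernelSection sg i T g lam K z) :
    |average ε K z| ≤ lam * ε ^ (d - 1) * ((sphereMeasure d).real Set.univ / 2) *
      ∫ v : Euc d, (‖z.2.2 i‖ + ‖v‖) * g z.1 (velNorm z.2.2 v) := by
  have hg0 : ∀ v : Euc d, 0 ≤ g z.1 (velNorm z.2.2 v) := fun v =>
    hg.nonneg _ ⟨h.time.1.le, h.time.2⟩ _ (velNorm_nonneg _ _)
  have hsum := h.integrable_sum hg
  have hmaj : Integrable (fun p : USphere d × Euc d =>
      impact sg i z.2.2 p * (lam * g z.1 (velNorm z.2.2 p.2))) ((sphereMeasure d).prod volume) := by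
    refine ((hsum.comp_snd (sphereMeasure d)).const_mul lam).mono'
      ((Measurable.aestronglyMeasurable (by fun_prop)).mul
        ((h.measurable_weight.comp_snd (μ := sphereMeasure d)).const_mul lam))
      (Eventually.of_forall fun p => ?_)
    rw [Real.norm_of_nonneg (mul_nonneg (impact_nonneg _ _ _ _) (mul_nonneg hlam (hg0 _)))]
    have h1 : impact sg i z.2.2 p ≤ ‖z.2.2 i‖ + ‖p.2‖ := by
      rw [add_comm]
      exact (impact_le sg i z.2.2 p).trans (norm_sub_le _ _)
    calc _ ≤ (‖z.2.2 i‖ + ‖p.2‖) * (lam * g z.1 (velNorm z.2.2 p.2)) :=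
          mul_le_mul_of_nonneg_right h1 (mul_nonneg hlam (hg0 _))
      _ = _ := by ring
  have h1 : ∫ p, |K (z, p)| ∂((sphereMeasure d).prod volume) ≤
      ∫ p, impact sg i z.2.2 p * (lam * g z.1 (velNorm z.2.2 p.2))
        ∂((sphereMeasure d).prod volume) :=
    integral_mono_of_nonneg (Eventually.of_forall fun p => abs_nonneg _) hmaj h.le
  have h2 : ∫ p, impact sg i z.2.2 p * (lam * g z.1 (velNorm z.2.2 p.2))
      ∂((sphereMeasure d).prod volume) ≤ ∫ v : Euc d, (sphereMeasure d).real Set.univ / 2 * lam *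
        ((‖z.2.2 i‖ + ‖v‖) * g z.1 (velNorm z.2.2 v)) := by
    rw [integral_prod_symm _ hmaj]
    refine integral_mono_of_nonneg (Eventually.of_forall fun v => integral_nonneg fun ω =>
      mul_nonneg (impact_nonneg _ _ _ _) (mul_nonneg hlam (hg0 _))) (hsum.const_mul _)
      (Eventually.of_forall fun v => ?_)
    simp only [integral_mul_const]
    have h3 : ∫ ω, impact sg i z.2.2 (ω, v) ∂sphereMeasure d ≤
        (sphereMeasure d).real Set.univ / 2 * (‖z.2.2 i‖ + ‖v‖) := by
      refine (integral_part_inner_le sg (v - z.2.2 i)).trans ?_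
      gcongr
      rw [add_comm]
      exact norm_sub_le _ _
    calc _ ≤ (sphereMeasure d).real Set.univ / 2 * (‖z.2.2 i‖ + ‖v‖) *
          (lam * g z.1 (velNorm z.2.2 v)) :=
          mul_le_mul_of_nonneg_right h3 (mul_nonneg hlam (hg0 _))
      _ = _ := by ring
  rw [integral_const_mul] at h2
  refine (HardSphere.abs_average_le hε z).trans ?_
  calc _ ≤ ε ^ (d - 1) * ((sphereMeasure d).real Set.univ / 2 * lam *
        ∫ v : Euc d, (‖z.2.2 i‖ + ‖v‖) * g z.1 (velNorm z.2.2 v)) :=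
        mul_le_mul_of_nonneg_left (h1.trans h2) (pow_pos hε _).le
    _ = _ := by ring

/-- The error lives on speeds above R, where the relative velocity is at most √2 |V_{s+1}|; what
remains is the tail integral of the hypotheses on g, whose smallness is uniform in z. -/
lemma IsKernelSection.abs_average_sub_le (hε : 0 < ε) (hg : IsVelocityWeight d s T g)
    (hlam : 0 ≤ lam) (h : IsKernelSection sg i T g lam K z) (R : ℝ) :
    |average ε ((speedSet d s R).indicator K) z - average ε K z| ≤
      ε ^ (d - 1) * ((sphereMeasure d).real Set.univ * (Real.sqrt 2 * lam)) *
        ∫ v in {v : Euc d | R ≤ velNorm z.2.2 v}, velNorm z.2.2 v * g z.1 (velNorm z.2.2 v) := by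
  have hg0 : ∀ v : Euc d, 0 ≤ g z.1 (velNorm z.2.2 v) := fun v =>
    hg.nonneg _ ⟨h.time.1.le, h.time.2⟩ _ (velNorm_nonneg _ _)
  have hSm : MeasurableSet {v : Euc d | R ≤ velNorm z.2.2 v} :=
    measurableSet_le measurable_const (by fun_prop)
  have hint := (h.integrable_weight.indicator hSm).const_mul (Real.sqrt 2 * lam)
  have hI := integrable_indicator_section h.integrable (measurableSet_speedSet R)
  have e1 : average ε ((speedSet d s R).indicator K) z - average ε K z =
      average ε (fun w => (speedSet d s R).indicator K w - K w) z := by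
    rw [average, average, average, integral_sub hI h.integrable]
    ring
  rw [e1]
  refine (HardSphere.abs_average_le hε z).trans ?_
  rw [mul_assoc, mul_assoc]
  refine mul_le_mul_of_nonneg_left ?_ (pow_pos hε _).le
  refine (integral_mono_of_nonneg (Eventually.of_forall fun p => abs_nonneg _)
    (hint.comp_snd (sphereMeasure d)) ?_).trans_eq ?_
  · filter_upwards [h.le] with p hp
    by_cases hw : (z, p) ∈ speedSet d s R
    · rw [Set.indicator_of_mem hw, sub_self, abs_zero]
      exact mul_nonneg (by positivity) (Set.indicator_nonneg
        (fun v _ => mul_nonneg (velNorm_nonneg _ _) (hg0 v)) _)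
    · have hw' : R ≤ velNorm z.2.2 p.2 := (not_le.1 hw).le
      rw [Set.indicator_of_notMem hw, zero_sub, abs_neg,
        Set.indicator_of_mem (show p.2 ∈ {v : Euc d | R ≤ velNorm z.2.2 v} from hw')]
      refine hp.trans ?_
      calc _ ≤ Real.sqrt 2 * velNorm z.2.2 p.2 * (lam * g z.1 (velNorm z.2.2 p.2)) :=
            mul_le_mul_of_nonneg_right (impact_le_velNorm _ _ _ _) (mul_nonneg hlam (hg0 _))
        _ = _ := by ring
  · rw [integral_fun_snd (μ := sphereMeasure d) (ν := volume) fun v => Real.sqrt 2 * lam *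
      ({v : Euc d | R ≤ velNorm z.2.2 v}.indicator
        (fun v => velNorm z.2.2 v * g z.1 (velNorm z.2.2 v)) v), smul_eq_mul,
      integral_const_mul, integral_indicator hSm]

variable [NeZero d]

/-- The contribution to the collision operator of the adjoined configurations, for the functions
`ψ t` transported backward. -/
def collisionKernel (sg : CollisionSign) (ε : ℝ) (i : Fin s) (ψ : ℝ → Config d (s + 1) → ℝ) :
    (ℝ × Config d s) × (USphere d × Euc d) → ℝ :=
  (collisional sg ε i).indicator fun w => impact sg i w.1.2.2 w.2 * ψ w.1.1 (backward sg ε i w)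

lemma aestronglyMeasurable_collisionKernel (hε : 0 < ε) {ψ : ℝ → Config d (s + 1) → ℝ}
    (hψ : Measurable fun q : ℝ × Config d (s + 1) => ψ q.1 q.2) :
    AEStronglyMeasurable (collisionKernel sg ε i ψ) (collisionMeasure d s ε T) := by
  refine AEMeasurable.aestronglyMeasurable
    ((aemeasurable_indicator_iff (measurableSet_collisional sg i)).2 ?_)
  refine AEMeasurable.mul (Measurable.aemeasurable (by fun_prop)) ?_
  exact hψ.comp_aemeasurable
    (AEMeasurable.prodMk (Measurable.aemeasurable (by fun_prop)) (aemeasurable_backward hε sg i))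

/-- The backward transport conserves |V_{s+1}|, so the bound on H at the transported configuration
is λ g(t, |V_{s+1}|) for the adjoined velocities themselves. -/
lemma ae_isKernelSection (hε : 0 < ε) (hT : 0 < T) (hg : IsVelocityWeight d s T g)
    (hlam : 0 ≤ lam) {H : ℝ → Config d (s + 1) → ℝ}
    (hH : Measurable fun q : ℝ × Config d (s + 1) => H q.1 q.2)
    (hHg : ∀ t ∈ Set.Ioc 0 T, ∀ Z, |H t Z| ≤ lam * g t (famNorm Z.2)) :
    ∃ M : ℝ, ∀ᵐ z ∂timePhaseMeasure d s ε T,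
      IsKernelSection sg i T g lam (collisionKernel sg ε i H) z ∧
      ε ^ (d - 1) * ∫ p, |collisionKernel sg ε i H (z, p)| ∂((sphereMeasure d).prod volume) ≤ M := by
  obtain ⟨C, hC⟩ := ae_integrable_weight hT hg ε
  have hTI : T ∈ Set.Icc 0 T := ⟨hT.le, le_rfl⟩
  have hKm := aestronglyMeasurable_collisionKernel (sg := sg) (i := i) (T := T) hε hH
  refine ⟨ε ^ (d - 1) * ((sphereMeasure d).real Set.univ * (Real.sqrt 2 * lam * C)), ?_⟩
  filter_upwards [hC, Measure.ae_ae_of_ae_prod (ae_backward (T := T) hε sg i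
    (p := fun _ => True) (by simp)), hKm.prodMk_left] with z ⟨ht, h1, h2, h3⟩ h4 h5
  have htI : z.1 ∈ Set.Icc 0 T := ⟨ht.1.le, ht.2⟩
  have hg0 : ∀ v : Euc d, 0 ≤ g z.1 (velNorm z.2.2 v) := fun v =>
    hg.nonneg _ htI _ (velNorm_nonneg _ _)
  have hmono : ∀ v : Euc d, velNorm z.2.2 v * g z.1 (velNorm z.2.2 v) ≤
      velNorm z.2.2 v * g T (velNorm z.2.2 v) := fun v =>
    mul_le_mul_of_nonneg_left (hg.increasing _ (velNorm_nonneg _ _) htI hTI ht.2)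
      (velNorm_nonneg _ _)
  have hint : Integrable fun v : Euc d => velNorm z.2.2 v * g z.1 (velNorm z.2.2 v) := by
    refine h2.mono' ((Measurable.aestronglyMeasurable (by fun_prop)).mul h1)
      (Eventually.of_forall fun v => ?_)
    rw [Real.norm_of_nonneg (mul_nonneg (velNorm_nonneg _ _) (hg0 v))]
    exact hmono v
  have hle : ∀ᵐ p ∂(sphereMeasure d).prod volume, |collisionKernel sg ε i H (z, p)| ≤
      impact sg i z.2.2 p * (lam * g z.1 (velNorm z.2.2 p.2)) := by
    filter_upwards [h4] with p hp
    by_cases hw : (z, p) ∈ collisional sg ε i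
    · rw [collisionKernel, Set.indicator_of_mem hw, abs_mul, abs_of_nonneg (impact_nonneg _ _ _ _),
        ← (hp hw).2]
      exact mul_le_mul_of_nonneg_left (hHg _ ht _) (impact_nonneg _ _ _ _)
    · rw [collisionKernel, Set.indicator_of_notMem hw, abs_zero]
      exact mul_nonneg (impact_nonneg _ _ _ _) (mul_nonneg hlam (hg0 _))
  have hle' : ∀ᵐ p ∂(sphereMeasure d).prod volume, |collisionKernel sg ε i H (z, p)| ≤
      Real.sqrt 2 * lam * (velNorm z.2.2 p.2 * g z.1 (velNorm z.2.2 p.2)) := by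
    filter_upwards [hle] with p hp
    refine hp.trans ?_
    calc _ ≤ Real.sqrt 2 * velNorm z.2.2 p.2 * (lam * g z.1 (velNorm z.2.2 p.2)) :=
          mul_le_mul_of_nonneg_right (impact_le_velNorm _ _ _ _) (mul_nonneg hlam (hg0 _))
      _ = _ := by ring
  have hB : Integrable (fun p : USphere d × Euc d =>
      Real.sqrt 2 * lam * (velNorm z.2.2 p.2 * g z.1 (velNorm z.2.2 p.2)))
      ((sphereMeasure d).prod volume) := (hint.comp_snd (sphereMeasure d)).const_mul _
  refine ⟨⟨ht, h1, hint, hle, hB.mono' h5 hle'⟩, ?_⟩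
  refine mul_le_mul_of_nonneg_left ?_ (pow_pos hε _).le
  refine (integral_mono_of_nonneg (Eventually.of_forall fun p => abs_nonneg _) hB hle').trans ?_
  rw [integral_fun_snd (μ := sphereMeasure d) (ν := volume)
    fun v => Real.sqrt 2 * lam * (velNorm z.2.2 v * g z.1 (velNorm z.2.2 v)), smul_eq_mul,
    integral_const_mul]
  have hIC : ∫ v : Euc d, velNorm z.2.2 v * g z.1 (velNorm z.2.2 v) ≤ C :=
    (integral_mono hint h2 hmono).trans h3
  gcongr

end Kernel

/-! ### The truncated operators as integrals of the single kernel -/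

section Limits

lemma gridTime_mem {τ t : ℝ} (hτ : 0 < τ) (ht : 0 ≤ t) :
    0 ≤ gridTime τ t ∧ gridTime τ t ≤ t ∧ t < gridTime τ t + τ := by
  refine ⟨mul_nonneg (Int.cast_nonneg (Int.floor_nonneg.2 (by positivity))) hτ.le, ?_, ?_⟩
  · rw [gridTime, ← le_div_iff₀ hτ]
    exact Int.floor_le _
  · have := Int.lt_floor_add_one (t / τ)
    rw [div_lt_iff₀ hτ] at this
    rw [gridTime]
    linarith

variable {d s : ℕ} {ε T : ℝ} {sg : CollisionSign} {i : Fin s}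

/-- The adjoined configurations with bounded positions and velocities. -/
def boundedSet (ε : ℝ) (i : Fin s) (R₁ R₂ : ℝ) : Set ((ℝ × Config d s) × (USphere d × Euc d)) :=
  {w | famNorm (adjoin ε i w.1.2 w.2.1 w.2.2).1 ≤ R₁} ∩ speedSet d s R₂

lemma measurableSet_boundedSet (R₁ R₂ : ℝ) :
    MeasurableSet (boundedSet (d := d) ε i R₁ R₂) := by
  have hA : Measurable fun w : (ℝ × Config d s) × (USphere d × Euc d) =>
      adjoin ε i w.1.2 w.2.1 w.2.2 := by fun_prop
  exact (measurableSet_le (continuous_famNorm.measurable.comp hA.fst) measurable_const).inter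
    (measurableSet_speedSet R₂)

lemma eventually_indicator_boundedSet (R₂ : ℝ)
    (K : (ℝ × Config d s) × (USphere d × Euc d) → ℝ)
    (w : (ℝ × Config d s) × (USphere d × Euc d)) :
    ∀ᶠ R₁ in atTop, (boundedSet ε i R₁ R₂).indicator K w = (speedSet d s R₂).indicator K w := by
  filter_upwards [eventually_ge_atTop (famNorm (adjoin ε i w.1.2 w.2.1 w.2.2).1)] with R₁ hR
  have h1 : w ∈ boundedSet ε i R₁ R₂ ↔ w ∈ speedSet d s R₂ := ⟨fun h => h.2, fun h => ⟨hR, h⟩⟩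
  by_cases hw : w ∈ speedSet d s R₂
  · rw [Set.indicator_of_mem hw, Set.indicator_of_mem (h1.2 hw)]
  · rw [Set.indicator_of_notMem hw, Set.indicator_of_notMem (mt h1.1 hw)]

lemma integrable_closedBall_indicator (R c : ℝ) :
    Integrable (fun p : USphere d × Euc d =>
      (Metric.closedBall (0 : Euc d) R).indicator (fun _ => c) p.2)
      ((sphereMeasure d).prod volume) :=
  ((integrable_indicator_iff measurableSet_closedBall).2
    (integrableOn_const (measure_closedBall_lt_top.ne))).comp_snd (sphereMeasure d)

variable [NeZero d]

/-- The graph of the cut-off domain. -/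
def cutoffSet (ε : ℝ) (i : Fin s) (δ R₁ R₂ : ℝ) : Set ((ℝ × Config d s) × (USphere d × Euc d)) :=
  {w | w.2 ∈ cutoffDomain ε i δ R₁ R₂ w.1.2}

/-- The margins shrink to 0, so each collisional configuration ends up in the cut-off set as soon as
it satisfies the bounds R₁ and R₂; elsewhere the kernel vanishes. -/
lemma eventually_indicator_cutoffSet (R₁ R₂ : ℝ) (ψ : ℝ → Config d (s + 1) → ℝ)
    (w : (ℝ × Config d s) × (USphere d × Euc d)) :
    ∀ᶠ δ in 𝓝[>] (0 : ℝ), (cutoffSet ε i δ R₁ R₂).indicator (collisionKernel sg ε i ψ) w =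
      (boundedSet ε i R₁ R₂).indicator (collisionKernel sg ε i ψ) w := by
  by_cases hw : w ∈ collisional sg ε i
  · by_cases hb : w ∈ boundedSet ε i R₁ R₂
    · filter_upwards [eventually_mem_cutoffDomain hw.1.1 hw.1.2 hb.1 hb.2] with δ hδ
      rw [Set.indicator_of_mem hb, Set.indicator_of_mem (show w ∈ cutoffSet ε i δ R₁ R₂ from hδ)]
    · refine Eventually.of_forall fun δ => ?_
      rw [Set.indicator_of_notMem hb, Set.indicator_of_notMem fun h => hb ⟨h.2.2.1, h.2.2.2⟩]
  · refine Eventually.of_forall fun δ => ?_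
    have h0 : collisionKernel sg ε i ψ w = 0 := Set.indicator_of_notMem hw _
    rw [Set.indicator_apply_eq_zero.2 fun _ => h0, Set.indicator_apply_eq_zero.2 fun _ => h0]

lemma abs_indicator_cutoffSet_le {δ R₁ R₂ B : ℝ} (hR₂ : 0 ≤ R₂) (hB : 0 ≤ B)
    {z : ℝ × Config d s}
    {K : (ℝ × Config d s) × (USphere d × Euc d) → ℝ}
    (hK : ∀ p, |K (z, p)| ≤ impact sg i z.2.2 p * B) (p : USphere d × Euc d) :
    |(cutoffSet ε i δ R₁ R₂).indicator K (z, p)| ≤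
      (Metric.closedBall (0 : Euc d) R₂).indicator (fun _ => Real.sqrt 2 * R₂ * B) p.2 := by
  by_cases hw : (z, p) ∈ cutoffSet ε i δ R₁ R₂
  · have h1 : velNorm z.2.2 p.2 ≤ R₂ := hw.2.2.2
    rw [Set.indicator_of_mem hw, Set.indicator_of_mem
      (mem_closedBall_zero_iff.2 ((norm_le_velNorm_last z.2.2 p.2).trans h1))]
    refine (hK p).trans (mul_le_mul_of_nonneg_right ?_ hB)
    exact (impact_le_velNorm sg i z.2.2 p).trans
      (mul_le_mul_of_nonneg_left h1 (Real.sqrt_nonneg 2))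
  · rw [Set.indicator_of_notMem hw, abs_zero]
    exact Set.indicator_nonneg (fun _ _ => by positivity) _

variable {h : ℝ → Lp ℝ ∞ (phaseMeasure d (s + 1) ε)} {H : ℝ → Config d (s + 1) → ℝ}

/-- A step function in time uses φ only at the countably many times kτ, where it agrees with H off
one common null set. Nonsingularity of the backward transport then removes any dependence on the
representative. -/
lemma ae_cutoffIntegrand_step (hε : 0 < ε) {δ τ : ℝ} (hδ : 0 < δ) (hτ : 0 < τ) (R₁ : ℝ) {R₂ : ℝ}
    (hR₂ : 0 ≤ R₂) {φ : ℝ → Config d (s + 1) → ℝ}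
    (hφ : ∀ t ∈ Set.Icc 0 T, φ t =ᵐ[phaseMeasure d (s + 1) ε] H t) :
    ∀ᵐ w ∂collisionMeasure d s ε T,
      cutoffIntegrand sg ε i δ R₁ R₂ (stepInTime τ φ) w.1 w.2 =
        (cutoffSet ε i δ R₁ R₂).indicator (collisionKernel sg ε i (stepInTime τ H)) w := by
  have h1 : ∀ᵐ Z ∂phaseMeasure d (s + 1) ε, ∀ k : ℤ, (k : ℝ) * τ ∈ Set.Icc 0 T →
      φ (k * τ) Z = H (k * τ) Z := by
    refine ae_all_iff.2 fun k => ?_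
    by_cases hk : (k : ℝ) * τ ∈ Set.Icc 0 T
    · filter_upwards [hφ _ hk] with Z hZ _ using hZ
    · exact Eventually.of_forall fun Z h => absurd h hk
  have h2 : ∀ᵐ w ∂collisionMeasure d s ε T, w.1.1 ∈ Set.Icc 0 T :=
    Measure.quasiMeasurePreserving_fst.ae
      (Measure.quasiMeasurePreserving_fst.ae (ae_restrict_mem measurableSet_Icc))
  filter_upwards [ae_cutoffIntegrand_eq hε sg i hδ R₁ R₂, ae_backward hε sg i h1, h2]
    with w h3 h4 h5
  rw [h3]
  by_cases hw : w ∈ cutoffSet ε i δ R₁ R₂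
  · have hw' : w.2 ∈ cutoffDomain ε i δ R₁ R₂ w.1.2 := hw
    rw [Set.indicator_of_mem hw, Set.indicator_of_mem hw']
    rcases (impact_nonneg sg i w.1.2.2 w.2).eq_or_lt with h6 | h6
    · rw [← h6, zero_mul, collisionKernel, Set.indicator_of_notMem fun h => h.2.ne h6]
    · have hc : w ∈ collisional sg ε i := by
        refine ⟨⟨fun j k hjk hne => lt_of_le_of_lt ?_ (hw'.1 j k hjk hne),
          fun l => lt_of_le_of_lt ?_ (hw'.2.1 l)⟩, h6⟩
        · have : (0 : ℝ) ≤ Real.sqrt 2 * δ * R₂ := by positivity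
          linarith
        · have : (0 : ℝ) ≤ δ * R₂ := by positivity
          linarith
      obtain ⟨h7, h8, -⟩ := gridTime_mem hτ h5.1
      rw [collisionKernel, Set.indicator_of_mem hc]
      exact congrArg _ ((h4 hc).1 ⌊w.1.1 / τ⌋ ⟨h7, h8.trans h5.2⟩)
  · have hw' : w.2 ∉ cutoffDomain ε i δ R₁ R₂ w.1.2 := hw
    rw [Set.indicator_of_notMem hw, Set.indicator_of_notMem hw']

/-- For speeds below R₂ the domain of integration has finite measure and the impact factor is
bounded, so the modulus of continuity of h in L^∞ controls the error uniformly in z as τ → 0. -/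
theorem isCutoffTransportCollision (hε : 0 < ε) (hcont : ContinuousOn h (Set.Icc 0 T))
    (hHm : Measurable fun q : ℝ × Config d (s + 1) => H q.1 q.2)
    (hHh : ∀ t ∈ Set.Icc 0 T, H t =ᵐ[phaseMeasure d (s + 1) ε] h t)
    (hHsub : ∀ t ∈ Set.Icc 0 T, ∀ t' ∈ Set.Icc 0 T, ∀ Z, |H t Z - H t' Z| ≤ ‖h t - h t'‖)
    (hHle : ∀ t ∈ Set.Icc 0 T, ∀ Z, |H t Z| ≤ ‖h t‖)
    {φ : ℝ → Config d (s + 1) → ℝ}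
    (hφ : ∀ t ∈ Set.Icc 0 T, φ t =ᵐ[phaseMeasure d (s + 1) ε] h t)
    {δ R₁ R₂ : ℝ} (hδ : 0 < δ) (hR₂ : 0 < R₂) :
    IsCutoffTransportCollision sg ε T i δ R₁ R₂ φ
      (average ε ((cutoffSet ε i δ R₁ R₂).indicator (collisionKernel sg ε i H))) := by
  obtain ⟨B, hB⟩ := isCompact_Icc.exists_bound_of_continuousOn hcont
  have hcm : MeasurableSet (cutoffSet (d := d) ε i δ R₁ R₂) := measurableSet_cutoffDomain i δ R₁ R₂
  have htime : ∀ᵐ z ∂timePhaseMeasure d s ε T, z.1 ∈ Set.Icc 0 T :=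
    Measure.quasiMeasurePreserving_fst.ae (ae_restrict_mem measurableSet_Icc)
  have hφH : ∀ t ∈ Set.Icc 0 T, φ t =ᵐ[phaseMeasure d (s + 1) ε] H t := fun t ht =>
    (hφ t ht).trans (hHh t ht).symm
  have hstepm : ∀ τ : ℝ, Measurable fun q : ℝ × Config d (s + 1) => stepInTime τ H q.1 q.2 := by
    intro τ
    have : Measurable (gridTime τ) := by unfold gridTime; fun_prop
    exact hHm.comp ((this.comp measurable_fst).prodMk measurable_snd)
  have hgrid : ∀ τ : ℝ, 0 < τ → ∀ t ∈ Set.Icc 0 T, gridTime τ t ∈ Set.Icc 0 T :=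
    fun τ hτ t ht => ⟨(gridTime_mem hτ ht.1).1, (gridTime_mem hτ ht.1).2.1.trans ht.2⟩
  have hsec : ∀ {ψ : ℝ → Config d (s + 1) → ℝ} {c : ℝ} {z : ℝ × Config d s}, 0 ≤ c →
      (∀ Z, |ψ z.1 Z| ≤ c) → ∀ p, |(cutoffSet ε i δ R₁ R₂).indicator
        (collisionKernel sg ε i ψ) (z, p)| ≤
        (Metric.closedBall (0 : Euc d) R₂).indicator (fun _ => Real.sqrt 2 * R₂ * c) p.2 := by
    intro ψ c z hc hψ p
    refine abs_indicator_cutoffSet_le hR₂.le hc (sg := sg) (fun p => ?_) p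
    rw [collisionKernel]
    by_cases hw : (z, p) ∈ collisional sg ε i
    · rw [Set.indicator_of_mem hw, abs_mul, abs_of_nonneg (impact_nonneg _ _ _ _)]
      exact mul_le_mul_of_nonneg_left (hψ _) (impact_nonneg _ _ _ _)
    · rw [Set.indicator_of_notMem hw, abs_zero]
      exact mul_nonneg (impact_nonneg _ _ _ _) hc
  have hker : ∀ {ψ : ℝ → Config d (s + 1) → ℝ} {c : ℝ}, 0 ≤ c →
      (Measurable fun q : ℝ × Config d (s + 1) => ψ q.1 q.2) →
      (∀ t ∈ Set.Icc 0 T, ∀ Z, |ψ t Z| ≤ c) →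
      (∀ᵐ z ∂timePhaseMeasure d s ε T, Integrable (fun p => (cutoffSet ε i δ R₁ R₂).indicator
        (collisionKernel sg ε i ψ) (z, p)) ((sphereMeasure d).prod volume)) ∧
      (∀ᵐ z ∂timePhaseMeasure d s ε T, ε ^ (d - 1) * ∫ p, |(cutoffSet ε i δ R₁ R₂).indicator
        (collisionKernel sg ε i ψ) (z, p)| ∂((sphereMeasure d).prod volume) ≤
        ε ^ (d - 1) * ((sphereMeasure d).real Set.univ *
          (volume.real (Metric.closedBall (0 : Euc d) R₂) * (Real.sqrt 2 * R₂ * c)))) := by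
    intro ψ c hc hψm hψ
    have hm := (aestronglyMeasurable_collisionKernel (sg := sg) (i := i) (T := T) hε hψm).indicator
      hcm
    constructor
    · filter_upwards [hm.prodMk_left, htime] with z h1 h2
      exact (integrable_closedBall_indicator R₂ (Real.sqrt 2 * R₂ * c)).mono' h1
        (Eventually.of_forall (hsec hc (hψ z.1 h2)))
    · filter_upwards [htime] with z h2
      refine mul_le_mul_of_nonneg_left ?_ (pow_pos hε _).le
      refine (integral_mono_of_nonneg (Eventually.of_forall fun p => abs_nonneg _)
        (integrable_closedBall_indicator R₂ (Real.sqrt 2 * R₂ * c))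
        (Eventually.of_forall (hsec hc (hψ z.1 h2)))).trans_eq ?_
      rw [integral_fun_snd (μ := sphereMeasure d) (ν := volume) fun v =>
        (Metric.closedBall (0 : Euc d) R₂).indicator (fun _ => Real.sqrt 2 * R₂ * c) v,
        smul_eq_mul, integral_indicator_const _ measurableSet_closedBall, smul_eq_mul]
  have hB0 : ∀ t ∈ Set.Icc 0 T, ∀ Z, |H t Z| ≤ max B 0 := fun t ht Z =>
    ((hHle t ht Z).trans (hB t ht)).trans (le_max_left _ _)
  have hopeq : ∀ τ : ℝ, 0 < τ → ∀ᵐ z ∂timePhaseMeasure d s ε T,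
      (cutoffIntegrand sg ε i δ R₁ R₂ (stepInTime τ φ) z =ᵐ[(sphereMeasure d).prod volume]
        fun p => (cutoffSet ε i δ R₁ R₂).indicator
          (collisionKernel sg ε i (stepInTime τ H)) (z, p)) :=
    fun τ hτ => Measure.ae_ae_of_ae_prod (ae_cutoffIntegrand_step hε hδ hτ R₁ hR₂.le hφH)
  have hop : ∀ τ : ℝ, 0 < τ → cutoffOperator sg ε i δ R₁ R₂ (stepInTime τ φ)
      =ᵐ[timePhaseMeasure d s ε T] average ε ((cutoffSet ε i δ R₁ R₂).indicator
        (collisionKernel sg ε i (stepInTime τ H))) := by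
    intro τ hτ
    filter_upwards [hopeq τ hτ] with z hz
    rw [cutoffOperator, average, integral_congr_ae hz]
  have hstepB : ∀ τ : ℝ, 0 < τ → ∀ t ∈ Set.Icc 0 T, ∀ Z, |stepInTime τ H t Z| ≤ max B 0 :=
    fun τ hτ t ht Z => hB0 _ (hgrid τ hτ t ht) Z
  have hm0 : (0 : ℝ) ≤ max B 0 := le_max_right _ _
  refine ⟨fun τ hτ => ⟨?_, ?_⟩, ?_, ?_⟩
  · filter_upwards [hopeq τ hτ, (hker hm0 (hstepm τ) (hstepB τ hτ)).1] with z h1 h2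
    exact h2.congr h1.symm
  · refine MemLp.ae_eq (hop τ hτ).symm (memLp_average_top hε
      ((aestronglyMeasurable_collisionKernel hε (hstepm τ)).indicator hcm)
      (hker hm0 (hstepm τ) (hstepB τ hτ)).2)
  · exact memLp_average_top hε ((aestronglyMeasurable_collisionKernel hε hHm).indicator hcm)
      (hker hm0 hHm hB0).2
  · refine tendsto_eLpNorm_top_zero fun c hc => ?_
    set C := ε ^ (d - 1) * ((sphereMeasure d).real Set.univ *
      (volume.real (Metric.closedBall (0 : Euc d) R₂) * (Real.sqrt 2 * R₂))) with hC
    have hC0 : 0 ≤ C := by positivity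
    -- C is the operator bound for inputs bounded by 1; dividing by C + 1 allows C = 0.
    obtain ⟨η, hη, hunif⟩ := Metric.uniformContinuousOn_iff.1
      (isCompact_Icc.uniformContinuousOn_of_continuous hcont) (c / (C + 1)) (by positivity)
    filter_upwards [Ioo_mem_nhdsGT hη] with τ hτ
    have hdiff : ∀ t ∈ Set.Icc 0 T, ∀ Z, |(stepInTime τ H t Z - H t Z)| ≤ c / (C + 1) := by
      intro t ht Z
      have h1 := gridTime_mem hτ.1 ht.1
      refine (hHsub _ (hgrid τ hτ.1 t ht) t ht Z).trans ?_
      rw [← dist_eq_norm]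
      refine (hunif _ (hgrid τ hτ.1 t ht) t ht ?_).le
      rw [Real.dist_eq, abs_lt]
      exact ⟨by linarith [hτ.2, h1.2.2], by linarith [h1.2.1]⟩
    have hd := (hker (ψ := fun t Z => stepInTime τ H t Z - H t Z) (c := c / (C + 1))
      (by positivity) ((hstepm τ).sub hHm) hdiff).2
    filter_upwards [hop τ hτ.1, (hker hm0 (hstepm τ) (hstepB τ hτ.1)).1, (hker hm0 hHm hB0).1, hd]
      with z h1 h2 h3 h4
    have e1 : (cutoffOperator sg ε i δ R₁ R₂ (stepInTime τ φ) -
        average ε ((cutoffSet ε i δ R₁ R₂).indicator (collisionKernel sg ε i H))) z =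
        average ε ((cutoffSet ε i δ R₁ R₂).indicator
          (collisionKernel sg ε i fun t Z => stepInTime τ H t Z - H t Z)) z := by
      rw [Pi.sub_apply, h1, average, average, average, ← mul_sub, ← integral_sub h2 h3]
      congr 2
      funext p
      by_cases h5 : (z, p) ∈ cutoffSet ε i δ R₁ R₂
      · simp only [Set.indicator_of_mem h5, collisionKernel]
        by_cases h6 : (z, p) ∈ collisional sg ε i
        · simp only [Set.indicator_of_mem h6]
          ring
        · simp only [Set.indicator_of_notMem h6, sub_self]
      · simp only [Set.indicator_of_notMem h5, sub_self]
    rw [e1]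
    refine (abs_average_le hε z).trans (h4.trans ?_)
    calc _ = C * (c / (C + 1)) := by rw [hC]; ring
      _ ≤ c := by
        rw [mul_div_assoc', div_le_iff₀ (by positivity)]
        nlinarith

end Limits

/-! ### The three successive limits: existence and uniqueness -/

section Definition

variable {d s : ℕ} [NeZero d] {ε T : ℝ} {sg : CollisionSign} {i : Fin s}
  {h : ℝ → Lp ℝ ∞ (phaseMeasure d (s + 1) ε)} {H : ℝ → Config d (s + 1) → ℝ}
  {φ : ℝ → Config d (s + 1) → ℝ} {g : ℝ → ℝ → ℝ} {lam : ℝ}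

lemma tendsto_average_speedSet (hε : 0 < ε) (hg : IsVelocityWeight d s T g) (hlam : 0 ≤ lam)
    {K : (ℝ × Config d s) × (USphere d × Euc d) → ℝ}
    (hK : ∀ᵐ z ∂timePhaseMeasure d s ε T, IsKernelSection sg i T g lam K z) :
    Tendsto (fun R => eLpNorm (average ε ((speedSet d s R).indicator K) - average ε K) ∞
      (timePhaseMeasure d s ε T)) atTop (𝓝 0) := by
  refine tendsto_eLpNorm_top_zero fun c hc => ?_
  set C := ε ^ (d - 1) * ((sphereMeasure d).real Set.univ * (Real.sqrt 2 * lam)) with hC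
  have hC0 : 0 ≤ C := by positivity
  filter_upwards [eventually_ae_abs_le_of_tendsto hg.tail (c := c / (C + 1)) (by positivity)]
    with R hR
  filter_upwards [hK, (quasiMeasurePreserving_timeVel ε T).ae hR] with z h1 h2
  refine (h1.abs_average_sub_le hε hg hlam R).trans ?_
  calc _ ≤ C * (c / (C + 1)) := mul_le_mul_of_nonneg_left ((le_abs_self _).trans h2) hC0
    _ ≤ c := by
      rw [mul_div_assoc', div_le_iff₀ (by positivity)]
      nlinarith

/-- The three families are averages of one kernel over `cutoffSet`, `boundedSet` and `speedSet`. The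
bound M for the full kernel dominates them all; only the last limit, being uniform, uses the tail of
g. -/
theorem isTransportCollision (hε : 0 < ε) (hT : 0 < T) (hg : IsVelocityWeight d s T g)
    (hlam : 0 ≤ lam) (hcont : ContinuousOn h (Set.Icc 0 T))
    (hHm : Measurable fun q : ℝ × Config d (s + 1) => H q.1 q.2)
    (hHh : ∀ t ∈ Set.Icc 0 T, H t =ᵐ[phaseMeasure d (s + 1) ε] h t)
    (hHsub : ∀ t ∈ Set.Icc 0 T, ∀ t' ∈ Set.Icc 0 T, ∀ Z, |H t Z - H t' Z| ≤ ‖h t - h t'‖)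
    (hHle : ∀ t ∈ Set.Icc 0 T, ∀ Z, |H t Z| ≤ ‖h t‖)
    (hHg : ∀ t ∈ Set.Ioc 0 T, ∀ Z, |H t Z| ≤ lam * g t (famNorm Z.2))
    (hφ : ∀ t ∈ Set.Icc 0 T, φ t =ᵐ[phaseMeasure d (s + 1) ε] h t) :
    IsTransportCollision sg ε T i φ (average ε (collisionKernel sg ε i H)) := by
  obtain ⟨M, hM⟩ := ae_isKernelSection (sg := sg) (i := i) hε hT hg hlam hHm hHg
  have hKm := aestronglyMeasurable_collisionKernel (sg := sg) (i := i) (T := T) hε hHm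
  have htop : ∀ {A : Set ((ℝ × Config d s) × (USphere d × Euc d))}, MeasurableSet A →
      MemLp (average ε (A.indicator (collisionKernel sg ε i H))) ∞ (timePhaseMeasure d s ε T) := by
    intro A hA
    refine memLp_average_top hε (hKm.indicator hA) (M := M) ?_
    filter_upwards [hM] with z hz
    exact (mul_le_mul_of_nonneg_left (integral_abs_indicator_le hz.1.integrable A)
      (pow_pos hε _).le).trans hz.2
  have hcm : ∀ δ R₁ R₂, MeasurableSet (cutoffSet (d := d) ε i δ R₁ R₂) :=
    measurableSet_cutoffDomain i
  have hcb : ∀ δ R₁ R₂, ∀ w ∈ cutoffSet (d := d) ε i δ R₁ R₂,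
      famNorm (adjoin ε i w.1.2 w.2.1 w.2.2).1 ≤ R₁ ∧ velNorm w.1.2.2 w.2.2 ≤ R₂ :=
    fun δ R₁ R₂ w hw => ⟨hw.2.2.1, hw.2.2.2⟩
  have hbb : ∀ R₁ R₂, ∀ w ∈ boundedSet (d := d) ε i R₁ R₂,
      famNorm (adjoin ε i w.1.2 w.2.1 w.2.2).1 ≤ R₁ ∧ velNorm w.1.2.2 w.2.2 ≤ R₂ :=
    fun R₁ R₂ w hw => hw
  refine ⟨fun δ R₁ R₂ => average ε ((cutoffSet ε i δ R₁ R₂).indicator (collisionKernel sg ε i H)),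
    fun R₁ R₂ => average ε ((boundedSet ε i R₁ R₂).indicator (collisionKernel sg ε i H)),
    fun R₂ => average ε ((speedSet d s R₂).indicator (collisionKernel sg ε i H)),
    fun δ R₁ R₂ hδ _ hR₂ => ⟨isCutoffTransportCollision hε hcont hHm hHh hHsub hHle hφ hδ hR₂,
      memLp_average_one (hcb δ R₁ R₂) (htop (hcm δ R₁ R₂))⟩,
    fun R₁ R₂ _ _ => ⟨memLp_average_one (hbb R₁ R₂) (htop (measurableSet_boundedSet R₁ R₂)),
      htop (measurableSet_boundedSet R₁ R₂), ?_⟩,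
    fun R₂ _ => ⟨htop (measurableSet_speedSet R₂), ?_⟩,
    tendsto_average_speedSet hε hg hlam (hM.mono fun z hz => hz.1)⟩
  · exact tendsto_average_L1 hε hKm (hM.mono fun z hz => ⟨hz.1.integrable, hz.2⟩)
      (fun δ => hcm δ R₁ R₂) (measurableSet_boundedSet R₁ R₂) (fun δ => hcb δ R₁ R₂) (hbb R₁ R₂)
      (eventually_indicator_cutoffSet R₁ R₂ H)
  · filter_upwards [hM] with z hz
    exact tendsto_average hz.1.integrable (fun R₁ => measurableSet_boundedSet R₁ R₂)
      fun p => eventually_indicator_boundedSet R₂ _ (z, p)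

/-- The families of intermediate limits are not prescribed, so uniqueness is propagated stage by
stage, from the truncated operators, which depend on φ alone, up to Q. -/
theorem isTransportCollision_ae_eq {Q Q' : ℝ × Config d s → ℝ}
    (h : IsTransportCollision sg ε T i φ Q) (h' : IsTransportCollision sg ε T i φ Q')
    (hQ : AEStronglyMeasurable Q (timePhaseMeasure d s ε T))
    (hQ' : AEStronglyMeasurable Q' (timePhaseMeasure d s ε T)) :
    Q =ᵐ[timePhaseMeasure d s ε T] Q' := by
  obtain ⟨q₃, q₂, q₁, h3, h2, h1, h0⟩ := h
  obtain ⟨q₃', q₂', q₁', h3', h2', h1', h0'⟩ := h'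
  have e3 : ∀ {δ R₁ R₂}, 0 < δ → 0 < R₁ → 0 < R₂ →
      q₃ δ R₁ R₂ =ᵐ[timePhaseMeasure d s ε T] q₃' δ R₁ R₂ := by
    intro δ R₁ R₂ hδ hR₁ hR₂
    obtain ⟨⟨ha, hb, hc⟩, -⟩ := h3 δ R₁ R₂ hδ hR₁ hR₂
    obtain ⟨⟨-, hb', hc'⟩, -⟩ := h3' δ R₁ R₂ hδ hR₁ hR₂
    refine ae_eq_of_tendsto_eLpNorm le_top ?_ (Eventually.of_forall fun _ => EventuallyEq.rfl)
      hb.aestronglyMeasurable hb'.aestronglyMeasurable hc hc'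
    filter_upwards [self_mem_nhdsWithin] with τ hτ using (ha τ hτ).2.aestronglyMeasurable
  have e2 : ∀ {R₁ R₂}, 0 < R₁ → 0 < R₂ →
      q₂ R₁ R₂ =ᵐ[timePhaseMeasure d s ε T] q₂' R₁ R₂ := by
    intro R₁ R₂ hR₁ hR₂
    obtain ⟨ha, -, hc⟩ := h2 R₁ R₂ hR₁ hR₂
    obtain ⟨ha', -, hc'⟩ := h2' R₁ R₂ hR₁ hR₂
    refine ae_eq_of_tendsto_eLpNorm le_rfl ?_ ?_ ha.aestronglyMeasurable
      ha'.aestronglyMeasurable hc hc'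
    · filter_upwards [self_mem_nhdsWithin] with δ hδ
        using (h3 δ R₁ R₂ hδ hR₁ hR₂).2.aestronglyMeasurable
    · filter_upwards [self_mem_nhdsWithin] with δ hδ using e3 hδ hR₁ hR₂
  have e1 : ∀ {R₂}, 0 < R₂ → q₁ R₂ =ᵐ[timePhaseMeasure d s ε T] q₁' R₂ := by
    intro R₂ hR₂
    -- The equalities for the various R₁ hold off sets depending on R₁; restricting R₁ to the
    -- integers n + 1 leaves countably many exceptional sets.
    have hn : Tendsto (fun n : ℕ => (n : ℝ) + 1) atTop atTop :=
      tendsto_atTop_add_const_right _ _ tendsto_natCast_atTop_atTop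
    filter_upwards [(h1 R₂ hR₂).2, (h1' R₂ hR₂).2,
      ae_all_iff.2 fun n : ℕ => e2 (n.cast_add_one_pos (α := ℝ)) hR₂] with z ha hb hc
    refine tendsto_nhds_unique (ha.comp hn) ((hb.comp hn).congr fun n => (hc n).symm)
  refine ae_eq_of_tendsto_eLpNorm le_top ?_ ?_ hQ hQ' h0 h0'
  · filter_upwards [eventually_gt_atTop 0] with R₂ hR₂ using (h1 R₂ hR₂).1.aestronglyMeasurable
  · filter_upwards [eventually_gt_atTop 0] with R₂ hR₂ using e1 hR₂

lemma isTransportCollision_congr {Q Q' : ℝ × Config d s → ℝ}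
    (h : IsTransportCollision sg ε T i φ Q) (hQ : Q =ᵐ[timePhaseMeasure d s ε T] Q') :
    IsTransportCollision sg ε T i φ Q' := by
  obtain ⟨q₃, q₂, q₁, h3, h2, h1, h0⟩ := h
  refine ⟨q₃, q₂, q₁, h3, h2, h1, h0.congr fun R₂ => eLpNorm_congr_ae ?_⟩
  exact EventuallyEq.rfl.sub hQ

end Definition

end HardSphere

end

/-! ### The theorem -/

theorem mainTheorem7 (d : ℕ) [NeZero d] (hd : 2 ≤ d) (s : ℕ) (ε T : ℝ) (hε : 0 < ε) (hT : 0 < T)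
    (g : ℝ → ℝ → ℝ) (hg : IsVelocityWeight d s T g)
    (sg : CollisionSign) (i : Fin s)
    (h : ℝ → Lp ℝ ∞ (phaseMeasure d (s + 1) ε)) (hcont : ContinuousOn h (Set.Icc 0 T))
    (lam : ℝ) (hlam : 0 ≤ lam)
    (hdom : ∀ᵐ t ∂volume.restrict (Set.Icc 0 T), ∀ᵐ Z ∂phaseMeasure d (s + 1) ε,
      |h t Z| ≤ lam * g t (famNorm Z.2)) :
    ∃ Q : Lp ℝ ∞ (timePhaseMeasure d s ε T),
      (∀ φ : ℝ → Config d (s + 1) → ℝ,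
        (∀ t ∈ Set.Icc 0 T, φ t =ᵐ[phaseMeasure d (s + 1) ε] h t) →
        ∀ Q' : Lp ℝ ∞ (timePhaseMeasure d s ε T),
          IsTransportCollision sg ε T i φ Q' ↔ Q' = Q) ∧
      ∀ᵐ z ∂timePhaseMeasure d s ε T,
        Integrable (fun v : Euc d => (‖z.2.2 i‖ + ‖v‖) * g z.1 (velNorm z.2.2 v)) ∧
        |Q z| ≤ lam * ε ^ (d - 1) * ((sphereMeasure d).real Set.univ / 2) *
          ∫ v : Euc d, (‖z.2.2 i‖ + ‖v‖) * g z.1 (velNorm z.2.2 v) := by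
  obtain ⟨H, hHm, hHh, hHsub, hHle, hHg⟩ := HardSphere.exists_continuous_representative hT hcont
    (b := fun t Z => lam * g t (famNorm Z.2))
    (fun t ht Z => mul_nonneg hlam (hg.nonneg t ht _ (Real.sqrt_nonneg _)))
    (fun Z t ht t' ht' htt => mul_le_mul_of_nonneg_left
      (hg.increasing _ (Real.sqrt_nonneg _) ht ht' htt) hlam) hdom
  obtain ⟨M, hM⟩ :=
    HardSphere.ae_isKernelSection (sg := sg) (i := i) hε hT hg hlam hHm hHg
  have hQ : MemLp (HardSphere.average ε (HardSphere.collisionKernel sg ε i H)) ∞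
      (timePhaseMeasure d s ε T) :=
    HardSphere.memLp_average_top hε (HardSphere.aestronglyMeasurable_collisionKernel hε hHm)
      (hM.mono fun z hz => hz.2)
  -- Q is built from H alone, which was fixed before φ: this is the independence of the
  -- representatives.
  refine ⟨hQ.toLp, fun φ hφ Q' => ?_, ?_⟩
  · have hφQ : IsTransportCollision sg ε T i φ hQ.toLp :=
      HardSphere.isTransportCollision_congr
        (HardSphere.isTransportCollision hε hT hg hlam hcont hHm hHh hHsub hHle hHg hφ)
        hQ.coeFn_toLp.symm
    refine ⟨fun hQ' => Lp.ext ?_, fun hQ' => hQ' ▸ hφQ⟩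
    exact HardSphere.isTransportCollision_ae_eq hQ' hφQ (Lp.aestronglyMeasurable _)
      (Lp.aestronglyMeasurable _)
  · filter_upwards [hM, hQ.coeFn_toLp] with z hz hQz
    rw [hQz]
    exact ⟨hz.1.integrable_sum hg, hz.1.abs_average_le hε hg hlam⟩
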